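/- Throughout, indices run over $1,\dots,n$, the summation convention is used, and everything is smooth. Let $(M,g)$ be an $n$-dimensional Riemannian manifold. For a local chart $(U,x^1,\dots,x^n)$ of $M$ let $(q^1,\dots,q^n,p_1,\dots,p_n)$ be the induced chart on $\pi^{-1}(U)\subset T^*M$. Let $\Gamma^k_{ij}$ be the Christoffel symbols of $g$ and $R^h_{kij}$ the components of its curvature tensor, $R(\partial_i,\partial_j)\partial_k=R^h_{kij}\partial_h$, and put $$\Gamma^0_{ij}=p_k\Gamma^k_{ij},\quad R^0_{kij}=p_hR^h_{kij},\quad g^{0i}=p_hg^{hi},\quad t=\tfrac12 g^{ik}p_ip_k,\quad \frac{\delta}{\delta q^i}=\frac{\partial}{\partial q^i}+\Gamma^0_{ih}\frac{\partial}{\partial p_h},\quad Dp_i=dp_i-\Gamma^0_{ij}dq^j .$$ Let $c_1,c_2,d_1,d_2$ be smooth functions of $t\in[0,\infty)$ with $c_1,\ c_2,\ c_1+2td_1,\ c_2+2td_2>0$ for all $t\ge 0$, and let $$G=G^{(1)}_{ij}dq^idq^j+G_{(2)}^{ij}Dp_iDp_j,\qquad G^{(1)}_{ij}=c_1g_{ij}+d_1p_ip_j,\quad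 G_{(2)}^{ij}=c_2g^{ij}+d_2g^{0i}g^{0j},$$ a Riemannian metric on $T^*M$. Let $$H_{(1)}^{jk}=\frac1{c_1}g^{jk}-\frac{d_1}{c_1(c_1+2td_1)}g^{0j}g^{0k},\qquad H^{(2)}_{jk}=\frac1{c_2}g_{jk}-\frac{d_2}{c_2(c_2+2td_2)}p_jp_k$$ be the inverse matrices of $G^{(1)}$ and $G_{(2)}$. (a) In the adapted frame of every induced chart, the Levi-Civita connection $\nabla$ of $G$ (the connection with $\nabla G=0$ and zero torsion) is given by $$\nabla_{\frac{\partial}{\partial p_i}}\frac{\partial}{\partial p_j}=Q^{ij}_h\frac{\partial}{\partial p_h},\qquad \nabla_{\frac{\delta}{\delta q^i}}\frac{\partial}{\partial p_j}=-\Gamma^j_{ih}\frac{\partial}{\partial p_h}+P^{hj}_i\frac{\delta}{\delta q^h},$$ $$\nabla_{\frac{\partial}{\partial p_i}}\frac{\delta}{\delta q^j}=P^{hi}_j\frac{\delta}{\delta q^h},\qquad \nabla_{\frac{\delta}{\delta q^i}}\frac{\delta}{\delta q^j}=\Gamma^h_{ij}\frac{\delta}{\delta q^h}+S_{hij}\frac{\partial}{\partial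 p_h},$$ where $$Q^{ij}_h=\tfrac12H^{(2)}_{hk}\Big(\frac{\partial G_{(2)}^{jk}}{\partial p_i}+\frac{\partial G_{(2)}^{ik}}{\partial p_j}-\frac{\partial G_{(2)}^{ij}}{\partial p_k}\Big),\quad P^{hi}_j=\tfrac12H_{(1)}^{hk}\Big(\frac{\partial G^{(1)}_{jk}}{\partial p_i}-G_{(2)}^{il}R^0_{ljk}\Big),\quad S_{hij}=-\tfrac12H^{(2)}_{hk}\frac{\partial G^{(1)}_{ij}}{\partial p_k}+\tfrac12R^0_{hij}.$$ Moreover $Q,P,S$ are M-tensor fields on $T^*M$ of types $(2,1),(2,1),(0,3)$: their components are smooth functions of $(q,p)$, and under a change of chart of $M$ they transform like the components of tensor fields of these types on $M$. (b) Let $c,A\in\mathbb R$ with $A>0$, and let $\lambda$ be a smooth function of $t\in[0,\infty)$ such that $\lambda>0$, $A^2-2ct\lambda^2>0$ and $\lambda+2t\lambda'>0$ for all $t\ge0$. Then the functions $$c_1=A,\quad c_2=\frac{\lambda^2}{A},\quad d_1=-\frac{c\lambda^2}{A},\quad d_2=\frac{c\lambda^4+2A^2\lambda'(\lambda+t\lambda')}{A(A^2-2ct\lambda^2)}$$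 satisfy the conditions above, so that (a) applies to the corresponding metric $G$ (which is Kähler when $(M,g)$ has constant sectional curvature $c$). If $(M,g)$ has constant sectional curvature $c$, then for this $G$ $$Q^{ij}_h=\frac{c\lambda^3+A^2\lambda'}{A\lambda(\lambda+2t\lambda')}J_{(2)}^{ij}p_h+\frac{\lambda'}{\lambda}\big(\delta^i_hg^{0j}+\delta^j_hg^{0i}\big)+\frac{\lambda\lambda''-3\lambda'^2}{\lambda(\lambda+2t\lambda')}g^{0i}g^{0j}p_h,$$ $$P^{hi}_j=-\frac{c\lambda}{A}J_{(2)}^{hi}p_j,\qquad S_{hij}=\frac{c\lambda}{A}J^{(1)}_{hj}p_i,$$ where $$J^{(1)}_{ij}=\frac A\lambda g_{ij}-\frac{c\lambda^3+A^2\lambda'}{A\lambda(\lambda+2t\lambda')}p_ip_j,\qquad J_{(2)}^{ij}=\frac\lambda Ag^{ij}+\frac{c\lambda^3+A^2\lambda'}{A(A^2-2ct\lambda^2)}g^{0i}g^{0j}.$$ -/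

import Mathlib

open scoped Manifold ContDiff
open Set

noncomputable section

namespace CotangentLift

/-! ### Coordinates on the base manifold -/

/-- The coordinate space `ℝⁿ`. -/
abbrev Coord (n : ℕ) : Type := EuclideanSpace ℝ (Fin n)

/-- The `i`-th vector of the standard basis of `ℝⁿ`. -/
def stdVec {n : ℕ} (i : Fin n) : Coord n := EuclideanSpace.single i (1 : ℝ)

/-- The `i`-th partial derivative of a function on (an open subset of) `ℝⁿ`. -/
def pderiv {n : ℕ} (i : Fin n) (f : Coord n → ℝ) (y : Coord n) : ℝ :=
  fderiv ℝ f y (stdVec i)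

/-- The Kronecker symbol. -/
def kron {n : ℕ} (i j : Fin n) : ℝ := if i = j then 1 else 0

/-- Smooth Riemannian metrics on the manifold `M` modelled on `ℝⁿ`. -/
abbrev RMetric (n : ℕ) (M : Type*) [TopologicalSpace M] [ChartedSpace (Coord n) M]
    [IsManifold (𝓡 n) ∞ M] :=
  Bundle.ContMDiffRiemannianMetric (𝓡 n) ∞ (Coord n) (fun x : M => TangentSpace (𝓡 n) x)

/-- Local charts of `M` with values in `ℝⁿ`; they are always used together with the hypothesis
that the chart belongs to the smooth maximal atlas. -/
abbrev LocalChart (n : ℕ) (M : Type*) [TopologicalSpace M] := OpenPartialHomeomorph M (Coord n)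

/-- The cotangent bundle `T*M`, with Mathlib's bundle topology and manifold structure. -/
abbrev TStar (n : ℕ) (M : Type*) [TopologicalSpace M] [ChartedSpace (Coord n) M] :=
  Bundle.TotalSpace (Coord n →L[ℝ] ℝ) (fun x : M => TangentSpace (𝓡 n) x →L[ℝ] ℝ)

/-- The model with corners of the `2n`-dimensional manifold `T*M`. -/
abbrev TI (n : ℕ) := (𝓡 n).prod 𝓘(ℝ, Coord n →L[ℝ] ℝ)

section Base

variable {n : ℕ} {M : Type*} [TopologicalSpace M] [ChartedSpace (Coord n) M]

/-- The coordinate vector `∂/∂xⁱ` of the chart `φ` at the point `φ⁻¹(y)`. -/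
def coordVec (φ : LocalChart n M) (y : Coord n) (i : Fin n) : TangentSpace (𝓡 n) (φ.symm y) :=
  mfderiv 𝓘(ℝ, Coord n) (𝓡 n) φ.symm y (stdVec i)

variable [IsManifold (𝓡 n) ∞ M]

/-- `g_{ij}` in the chart `φ`. -/
def gLow (g : RMetric n M) (φ : LocalChart n M) (y : Coord n) (i j : Fin n) : ℝ :=
  g.inner (φ.symm y) (coordVec φ y i) (coordVec φ y j)

/-- `g^{ij}`, the entries of the inverse matrix of `(g_{ij})`. -/
def gUp (g : RMetric n M) (φ : LocalChart n M) (y : Coord n) (i j : Fin n) : ℝ :=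
  (Matrix.of (gLow g φ y))⁻¹ i j

/-- The Christoffel symbols `Γᵏ_{ij}` of `g` in the chart `φ`. -/
def Gam (g : RMetric n M) (φ : LocalChart n M) (y : Coord n) (k i j : Fin n) : ℝ :=
  (1 / 2) * ∑ l, gUp g φ y k l *
    (pderiv i (fun z => gLow g φ z j l) y + pderiv j (fun z => gLow g φ z i l) y
      - pderiv l (fun z => gLow g φ z i j) y)

/-- The components `R^h_{kij}` of the curvature tensor `R(X,Y)Z = ∇_X∇_Y Z - ∇_Y∇_X Z - ∇_{[X,Y]}Z`
of `g`, in the convention `R(∂_i, ∂_j) ∂_k = R^h_{kij} ∂_h`. -/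
def Riem (g : RMetric n M) (φ : LocalChart n M) (y : Coord n) (h k i j : Fin n) : ℝ :=
  pderiv i (fun z => Gam g φ z h j k) y - pderiv j (fun z => Gam g φ z h i k) y
    + ∑ l, (Gam g φ y h i l * Gam g φ y l j k - Gam g φ y h j l * Gam g φ y l i k)

/-- `g(u, v)` for tangent vectors given by their components in the chart `φ`. -/
def gPair (g : RMetric n M) (φ : LocalChart n M) (y : Coord n) (u v : Fin n → ℝ) : ℝ :=
  ∑ i, ∑ j, gLow g φ y i j * u i * v j

/-- The sectional curvature `g(R(u,v)v,u) / (g(u,u) g(v,v) - g(u,v)²)` of the plane spanned by two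
linearly independent tangent vectors, given by their components in the chart `φ`. -/
def sectionalCurvature (g : RMetric n M) (φ : LocalChart n M) (y : Coord n)
    (u v : Fin n → ℝ) : ℝ :=
  gPair g φ y (fun h => ∑ k, ∑ i, ∑ j, Riem g φ y h k i j * u i * v j * v k) u /
    (gPair g φ y u u * gPair g φ y v v - gPair g φ y u v ^ 2)

/-- `(M, g)` has constant sectional curvature `c`. -/
def HasConstantCurvature (g : RMetric n M) (c : ℝ) : Prop :=
  ∀ φ ∈ IsManifold.maximalAtlas (𝓡 n) ∞ M, ∀ y ∈ φ.target, ∀ u v : Fin n → ℝ,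
    LinearIndependent ℝ ![u, v] → sectionalCurvature g φ y u v = c

end Base

/-! ### Induced coordinates and the adapted frame on the cotangent bundle -/

section Induced

variable {n : ℕ} {M : Type*} [TopologicalSpace M] [ChartedSpace (Coord n) M]
  [IsManifold (𝓡 n) ∞ M]

/-- The induced chart `Φ = (q¹, …, qⁿ, p₁, …, pₙ)` on `π⁻¹(U)`: the `qⁱ` are the coordinates of the
base point and `p_i` is the value of the covector on `∂/∂xⁱ`. -/
def cotChart (φ : LocalChart n M) (P : TStar n M) : Coord n × Coord n :=
  (φ P.proj, WithLp.toLp 2 fun i =>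
    P.snd (coordVec φ (φ P.proj) i : TangentSpace (𝓡 n) P.proj))

/-- The inverse `Φ⁻¹` of the induced chart: `(q, p) ↦ p_i dxⁱ` at the point `φ⁻¹(q)`. -/
def cotChartInv (φ : LocalChart n M) (z : Coord n × Coord n) : TStar n M :=
  ⟨φ.symm z.1, ∑ i, z.2 i •
    ((EuclideanSpace.proj i : Coord n →L[ℝ] ℝ).comp (mvfderiv (𝓡 n) φ (φ.symm z.1)))⟩

/-- The local vector field `∂/∂qⁱ` on `π⁻¹(U)` (with irrelevant values outside). -/
def dq (φ : LocalChart n M) (i : Fin n) (P : TStar n M) : TangentSpace (TI n) P :=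
  mfderiv 𝓘(ℝ, Coord n × Coord n) (TI n) (cotChartInv φ) (cotChart φ P)
    ((stdVec i, 0) : Coord n × Coord n)

/-- The local vector field `∂/∂p_i` on `π⁻¹(U)` (with irrelevant values outside). -/
def dp (φ : LocalChart n M) (i : Fin n) (P : TStar n M) : TangentSpace (TI n) P :=
  mfderiv 𝓘(ℝ, Coord n × Coord n) (TI n) (cotChartInv φ) (cotChart φ P)
    ((0, stdVec i) : Coord n × Coord n)

/-- `Γ⁰_{ij} = p_k Γᵏ_{ij}`. -/
def Gam0 (g : RMetric n M) (φ : LocalChart n M) (y p : Coord n) (i j : Fin n) : ℝ :=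
  ∑ k, p k * Gam g φ y k i j

/-- `R⁰_{kij} = p_h R^h_{kij}`. -/
def Riem0 (g : RMetric n M) (φ : LocalChart n M) (y p : Coord n) (k i j : Fin n) : ℝ :=
  ∑ h, p h * Riem g φ y h k i j

/-- `g^{0i} = p_h g^{hi}`. -/
def g0 (g : RMetric n M) (φ : LocalChart n M) (y p : Coord n) (i : Fin n) : ℝ :=
  ∑ h, p h * gUp g φ y h i

/-- The energy density `t = ½ g^{ik} p_i p_k`. -/
def energy (g : RMetric n M) (φ : LocalChart n M) (y p : Coord n) : ℝ :=
  (1 / 2) * ∑ i, ∑ k, gUp g φ y i k * p i * p k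

/-- The horizontal local vector field `δ/δqⁱ = ∂/∂qⁱ + Γ⁰_{ih} ∂/∂p_h` on `π⁻¹(U)`. -/
def deltaq (g : RMetric n M) (φ : LocalChart n M) (i : Fin n) (P : TStar n M) :
    TangentSpace (TI n) P :=
  dq φ i P + ∑ h, Gam0 g φ (cotChart φ P).1 (cotChart φ P).2 i h • dp φ h P

/-- The value of the 1-form `dqⁱ` on a tangent vector of `T*M`. -/
def formdq (φ : LocalChart n M) (i : Fin n) (P : TStar n M) (X : TangentSpace (TI n) P) : ℝ :=
  (mvfderiv (TI n) (cotChart φ) P X).1 i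

/-- The value of the 1-form `Dp_i = dp_i - Γ⁰_{ij} dqʲ` on a tangent vector of `T*M`. -/
def formDp (g : RMetric n M) (φ : LocalChart n M) (i : Fin n) (P : TStar n M)
    (X : TangentSpace (TI n) P) : ℝ :=
  (mvfderiv (TI n) (cotChart φ) P X).2 i
    - ∑ j, Gam0 g φ (cotChart φ P).1 (cotChart φ P).2 i j * formdq φ j P X

end Induced

/-! ### M-tensor fields -/

section MTensor

variable {n : ℕ} {M : Type*} [TopologicalSpace M] [ChartedSpace (Coord n) M]

/-- `∂x'ᵃ/∂xⁱ` at the point with `φ`-coordinates `y`, where `xⁱ` are the coordinates of `φ` and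
`x'ᵃ` those of `ψ`. -/
def jac (φ ψ : LocalChart n M) (y : Coord n) (a i : Fin n) : ℝ :=
  pderiv i (fun z => ψ (φ.symm z) a) y

variable [IsManifold (𝓡 n) ∞ M]

variable (n M) in
/-- A smooth M-tensor field of type `(r, s)` on `T*M`: for every chart `φ` of `M`, components which
are smooth functions of the induced coordinates `(q, p)`, with `r` upper and `s` lower indices, such
that the components in two charts are related as those of a tensor field of type `(r, s)` on `M`. -/
structure IsMTensorField (r s : ℕ)
    (T : LocalChart n M → Coord n → Coord n → (Fin r → Fin n) → (Fin s → Fin n) → ℝ) : Prop where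
  smooth : ∀ φ ∈ IsManifold.maximalAtlas (𝓡 n) ∞ M, ∀ up low,
    ContDiffOn ℝ ∞ (fun z : Coord n × Coord n => T φ z.1 z.2 up low) (φ.target ×ˢ univ)
  change : ∀ φ ∈ IsManifold.maximalAtlas (𝓡 n) ∞ M, ∀ ψ ∈ IsManifold.maximalAtlas (𝓡 n) ∞ M,
    ∀ P : TStar n M, P.proj ∈ φ.source → P.proj ∈ ψ.source → ∀ up low,
      T ψ (cotChart ψ P).1 (cotChart ψ P).2 up low =
        ∑ up' : Fin r → Fin n, ∑ low' : Fin s → Fin n,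
          (∏ k, jac φ ψ (φ P.proj) (up k) (up' k)) *
          (∏ k, jac ψ φ (ψ P.proj) (low' k) (low k)) *
          T φ (cotChart φ P).1 (cotChart φ P).2 up' low'

end MTensor

/-! ### Natural metrics of diagonal type -/

/-- The four coefficients `c₁, c₂, d₁, d₂` (functions of the energy density `t ≥ 0`) of a natural
metric of diagonal type. -/
structure DiagCoeffs where
  c₁ : ℝ → ℝ
  c₂ : ℝ → ℝ
  d₁ : ℝ → ℝ
  d₂ : ℝ → ℝ

/-- The coefficients are smooth on `[0, ∞)` and satisfy the positivity conditions which make the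
natural metric of diagonal type a Riemannian metric. -/
structure DiagCoeffs.Admissible (C : DiagCoeffs) : Prop where
  smooth_c₁ : ContDiffOn ℝ ∞ C.c₁ (Ici 0)
  smooth_c₂ : ContDiffOn ℝ ∞ C.c₂ (Ici 0)
  smooth_d₁ : ContDiffOn ℝ ∞ C.d₁ (Ici 0)
  smooth_d₂ : ContDiffOn ℝ ∞ C.d₂ (Ici 0)
  pos_c₁ : ∀ t, 0 ≤ t → 0 < C.c₁ t
  pos_c₂ : ∀ t, 0 ≤ t → 0 < C.c₂ t
  pos_d₁ : ∀ t, 0 ≤ t → 0 < C.c₁ t + 2 * t * C.d₁ t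
  pos_d₂ : ∀ t, 0 ≤ t → 0 < C.c₂ t + 2 * t * C.d₂ t

/-- The derivative of a function on `[0, ∞)` (one-sided at `0`). -/
def deriv0 (f : ℝ → ℝ) (t : ℝ) : ℝ := derivWithin f (Ici 0) t

/-- The coefficients of the Kähler metric with parameters `A`, `c`, `lam`:
`c₁ = A`, `c₂ = λ²/A`, `d₁ = -cλ²/A`,
`d₂ = (cλ⁴ + 2A²λ'(λ + tλ')) / (A(A² - 2ctλ²))`. -/
def kahlerCoeffs (A c : ℝ) (lam : ℝ → ℝ) : DiagCoeffs where
  c₁ := fun _ => A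
  c₂ := fun t => lam t ^ 2 / A
  d₁ := fun t => -(c * lam t ^ 2 / A)
  d₂ := fun t => (c * lam t ^ 4 + 2 * A ^ 2 * deriv0 lam t * (lam t + deriv0 lam t * t)) /
    (A * (A ^ 2 - 2 * c * t * lam t ^ 2))

section Natural

variable {n : ℕ} {M : Type*} [TopologicalSpace M] [ChartedSpace (Coord n) M]
  [IsManifold (𝓡 n) ∞ M]

/-- `G^{(1)}_{ij} = c₁ g_{ij} + d₁ p_i p_j`. -/
def G1 (g : RMetric n M) (C : DiagCoeffs) (φ : LocalChart n M) (y p : Coord n)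
    (i j : Fin n) : ℝ :=
  C.c₁ (energy g φ y p) * gLow g φ y i j + C.d₁ (energy g φ y p) * p i * p j

/-- `G_{(2)}^{ij} = c₂ g^{ij} + d₂ g^{0i} g^{0j}`. -/
def G2 (g : RMetric n M) (C : DiagCoeffs) (φ : LocalChart n M) (y p : Coord n)
    (i j : Fin n) : ℝ :=
  C.c₂ (energy g φ y p) * gUp g φ y i j
    + C.d₂ (energy g φ y p) * g0 g φ y p i * g0 g φ y p j

/-- `H_{(1)}^{jk}`, the inverse matrix of `G^{(1)}`. -/
def H1 (g : RMetric n M) (C : DiagCoeffs) (φ : LocalChart n M) (y p : Coord n)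
    (j k : Fin n) : ℝ :=
  let t := energy g φ y p
  1 / C.c₁ t * gUp g φ y j k
    - C.d₁ t / (C.c₁ t * (C.c₁ t + 2 * t * C.d₁ t)) * g0 g φ y p j * g0 g φ y p k

/-- `H^{(2)}_{jk}`, the inverse matrix of `G_{(2)}`. -/
def H2 (g : RMetric n M) (C : DiagCoeffs) (φ : LocalChart n M) (y p : Coord n)
    (j k : Fin n) : ℝ :=
  let t := energy g φ y p
  1 / C.c₂ t * gLow g φ y j k
    - C.d₂ t / (C.c₂ t * (C.c₂ t + 2 * t * C.d₂ t)) * p j * p k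

/-- The symmetric form `G^{(1)}_{ij} dqⁱ dqʲ + G_{(2)}^{ij} Dp_i Dp_j` on `π⁻¹(U)`, written in the
induced coordinates of the chart `φ`. -/
def metricInChart (g : RMetric n M) (C : DiagCoeffs) (φ : LocalChart n M) (P : TStar n M)
    (X Y : TangentSpace (TI n) P) : ℝ :=
  ∑ i, ∑ j,
    (G1 g C φ (cotChart φ P).1 (cotChart φ P).2 i j * formdq φ i P X * formdq φ j P Y
      + G2 g C φ (cotChart φ P).1 (cotChart φ P).2 i j * formDp g φ i P X * formDp g φ j P Y)

/-- The natural metric of diagonal type `G` on the whole of `T*M`. The expression in local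
coordinates does not depend on the chart around the base point; the preferred one is used. -/
def naturalMetric (g : RMetric n M) (C : DiagCoeffs) (P : TStar n M)
    (X Y : TangentSpace (TI n) P) : ℝ :=
  metricInChart g C (chartAt (Coord n) P.proj) P X Y

/-- `∂/∂p_i` of a function of the induced coordinates. -/
def vderiv (i : Fin n) (f : Coord n → Coord n → ℝ) (y p : Coord n) : ℝ := pderiv i (f y) p

/-- `Q_h^{ij} = ½ H^{(2)}_{hk} (∂G_{(2)}^{jk}/∂p_i + ∂G_{(2)}^{ik}/∂p_j - ∂G_{(2)}^{ij}/∂p_k)`. -/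
def coefQ (g : RMetric n M) (C : DiagCoeffs) (φ : LocalChart n M) (y p : Coord n)
    (h i j : Fin n) : ℝ :=
  (1 / 2) * ∑ k, H2 g C φ y p h k *
    (vderiv i (fun y p => G2 g C φ y p j k) y p + vderiv j (fun y p => G2 g C φ y p i k) y p
      - vderiv k (fun y p => G2 g C φ y p i j) y p)

/-- `P_j^{hi} = ½ H_{(1)}^{hk} (∂G^{(1)}_{jk}/∂p_i - G_{(2)}^{il} R⁰_{ljk})`;
the arguments are ordered `j h i`. -/
def coefP (g : RMetric n M) (C : DiagCoeffs) (φ : LocalChart n M) (y p : Coord n)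
    (j h i : Fin n) : ℝ :=
  (1 / 2) * ∑ k, H1 g C φ y p h k *
    (vderiv i (fun y p => G1 g C φ y p j k) y p
      - ∑ l, G2 g C φ y p i l * Riem0 g φ y p l j k)

/-- `S_{hij} = -½ H^{(2)}_{hk} ∂G^{(1)}_{ij}/∂p_k + ½ R⁰_{hij}`. -/
def coefS (g : RMetric n M) (C : DiagCoeffs) (φ : LocalChart n M) (y p : Coord n)
    (h i j : Fin n) : ℝ :=
  -((1 / 2) * ∑ k, H2 g C φ y p h k * vderiv k (fun y p => G1 g C φ y p i j) y p)
    + (1 / 2) * Riem0 g φ y p h i j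

/-- `J^{(1)}_{ij} = (A/λ) g_{ij} - (cλ³ + A²λ')/(Aλ(λ + 2tλ')) p_i p_j`. -/
def J1 (g : RMetric n M) (A c : ℝ) (lam : ℝ → ℝ) (φ : LocalChart n M) (y p : Coord n)
    (i j : Fin n) : ℝ :=
  let t := energy g φ y p
  A / lam t * gLow g φ y i j
    - (c * lam t ^ 3 + A ^ 2 * deriv0 lam t) / (A * lam t * (lam t + 2 * t * deriv0 lam t))
      * p i * p j

/-- `J_{(2)}^{ij} = (λ/A) g^{ij} + (cλ³ + A²λ')/(A(A² - 2ctλ²)) g^{0i} g^{0j}`. -/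
def J2 (g : RMetric n M) (A c : ℝ) (lam : ℝ → ℝ) (φ : LocalChart n M) (y p : Coord n)
    (i j : Fin n) : ℝ :=
  let t := energy g φ y p
  lam t / A * gUp g φ y i j
    + (c * lam t ^ 3 + A ^ 2 * deriv0 lam t) / (A * (A ^ 2 - 2 * c * t * lam t ^ 2))
      * g0 g φ y p i * g0 g φ y p j

/-! ### The Levi-Civita connection -/

/-- Covariant derivatives on the tangent bundle of `T*M`; `cov Y P X` is `∇_X Y` at `P`. -/
abbrev TStarConnection (n : ℕ) (M : Type*) [TopologicalSpace M] [ChartedSpace (Coord n) M]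
    [IsManifold (𝓡 n) ∞ M] :=
  CovariantDerivative (TI n) (Coord n × (Coord n →L[ℝ] ℝ))
    (fun P : TStar n M => TangentSpace (TI n) P)

/-- `P ↦ Y P` is a vector field on `T*M` which is differentiable at `P`. -/
def VFDiffAt (Y : ∀ P : TStar n M, TangentSpace (TI n) P) (P : TStar n M) : Prop :=
  MDifferentiableAt (TI n) (TI n).tangent
    (fun P' => (⟨P', Y P'⟩ : TangentBundle (TI n) (TStar n M))) P

/-- `cov` is the Levi-Civita connection of `G`: it is torsion-free and `∇G = 0`. -/
structure IsLeviCivita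
    (G : ∀ P : TStar n M, TangentSpace (TI n) P → TangentSpace (TI n) P → ℝ)
    (cov : TStarConnection n M) : Prop where
  torsion_free : ∀ (X Y : ∀ P : TStar n M, TangentSpace (TI n) P) (P : TStar n M),
    VFDiffAt X P → VFDiffAt Y P →
      cov Y P (X P) - cov X P (Y P) = VectorField.mlieBracket (TI n) X Y P
  metric : ∀ (X Y Z : ∀ P : TStar n M, TangentSpace (TI n) P) (P : TStar n M),
    VFDiffAt Y P → VFDiffAt Z P →
      mvfderiv (TI n) (fun P' => G P' (Y P') (Z P')) P (X P) =
        G P (cov Y P (X P)) (Z P) + G P (Y P) (cov Z P (X P))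

/-- The connection `cov` has, in the adapted frame `(δ/δqⁱ, ∂/∂p_i)` of the chart `φ`, the form
`∇_{∂/∂p_i} ∂/∂p_j = Q_h^{ij} ∂/∂p_h`, `∇_{δ/δqⁱ} ∂/∂p_j = -Γ^j_{ih} ∂/∂p_h + P_i^{hj} δ/δq^h`,
`∇_{∂/∂p_i} δ/δqʲ = P_j^{hi} δ/δq^h`, `∇_{δ/δqⁱ} δ/δqʲ = Γ^h_{ij} δ/δq^h + S_{hij} ∂/∂p_h`. -/
def HasAdaptedForm (g : RMetric n M) (cov : TStarConnection n M) (φ : LocalChart n M)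
    (Q Pc S : Coord n → Coord n → Fin n → Fin n → Fin n → ℝ) : Prop :=
  ∀ P : TStar n M, P.proj ∈ φ.source → ∀ i j : Fin n,
    let y := (cotChart φ P).1
    let p := (cotChart φ P).2
    cov (dp φ j) P (dp φ i P) = ∑ h, Q y p h i j • dp φ h P ∧
    cov (dp φ j) P (deltaq g φ i P) =
      -(∑ h, Gam g φ y j i h • dp φ h P) + ∑ h, Pc y p i h j • deltaq g φ h P ∧
    cov (deltaq g φ j) P (dp φ i P) = ∑ h, Pc y p j h i • deltaq g φ h P ∧
    cov (deltaq g φ j) P (deltaq g φ i P) =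
      ∑ h, Gam g φ y h i j • deltaq g φ h P + ∑ h, S y p h i j • dp φ h P

end Natural

end CotangentLift

end

open CotangentLift

set_option linter.unusedSectionVars false

/-! The connection is read off from the Koszul formula in the adapted frame, which needs only the
derivatives of the metric coefficients along the frame and the brackets of the frame.

Vertical fields commute. The bracket of a vertical with a horizontal field is vertical with
Christoffel coefficients, and the bracket of two horizontal fields is vertical with coefficients
`Riem0`: curvature is the obstruction to integrability of the horizontal distribution
(`mlieBracket_dp_deltaq`, `mlieBracket_deltaq_deltaq`). Along a horizontal field the momentum and
`g` are parallel, hence the energy `t` is constant (`fderiv_energy_horVec`), and `G1` and `G2`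
change only through Christoffel terms (`fderiv_G1_horVec`, `fderiv_G2_horVec`). In the Koszul
formula these terms cancel against the brackets or combine into the Γ-part of the connection. What
is left is the vertical derivatives of `G1` and `G2` and the curvature. Raising and lowering with
`H1` and `H2` gives `coefQ`, `coefP` and `coefS` (`cov_dp_dp`, `cov_dp_deltaq`,
`cov_deltaq_deltaq`).

The metric is independent of the chart because `Dp` is a covector: the second derivatives of the
transition map in the transformation of `dp` and of Γ cancel (`pair_vertForm_trans`). For the
M-tensor property, the coefficients are first computed explicitly, then recognised as the values on
basis vectors of the trilinear forms `formQ`, `formP`, `formS`. These are built from `t`, the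
momentum, `g`, the raising of indices and the curvature, all of which are intrinsic. Trilinear
expansion produces the Jacobian factors.

For the Kähler coefficients, admissibility rests on two identities, for `c₁ + 2t d₁` and `c₂ + 2t
d₂`, the second being a completed square. Constant sectional curvature forces `R(u,v)w = c (g(v,w) u
- g(u,w) v)`, since the difference of the two sides is an algebraic curvature tensor without
sectional curvature (`curvForm_of_constantCurvature`). The relation `d₁ = -c c₂` then collapses `P`
and `S` to single terms, and `Q` follows by rational algebra in `λ, λ', λ''`.

Calculus on the base takes place on open subsets of `ℝⁿ` with fields of multilinear maps
(`IsCoordMetric`); vector fields on the cotangent bundle are moved to `ℝⁿ × ℝⁿ` by the induced chart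
(`liftField`). -/

namespace CotangentLift

open Filter Topology

/-! ### Charts of the manifold and smoothness of the induced charts. -/

section Charts

variable {n : ℕ} {M : Type*} [TopologicalSpace M] [ChartedSpace (Coord n) M]
  [IsManifold (𝓡 n) ∞ M] {φ : LocalChart n M}

lemma contMDiffAt_chart (hφ : φ ∈ IsManifold.maximalAtlas (𝓡 n) ∞ M) {x : M}
    (hx : x ∈ φ.source) : ContMDiffAt (𝓡 n) 𝓘(ℝ, Coord n) ∞ φ x :=
  contMDiffAt_of_mem_maximalAtlas hφ hx

lemma contMDiffAt_chart_symm (hφ : φ ∈ IsManifold.maximalAtlas (𝓡 n) ∞ M) {y : Coord n}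
    (hy : y ∈ φ.target) : ContMDiffAt 𝓘(ℝ, Coord n) (𝓡 n) ∞ φ.symm y :=
  contMDiffAt_symm_of_mem_maximalAtlas hφ hy

lemma mdifferentiableAt_chart (hφ : φ ∈ IsManifold.maximalAtlas (𝓡 n) ∞ M) {x : M}
    (hx : x ∈ φ.source) : MDifferentiableAt (𝓡 n) 𝓘(ℝ, Coord n) φ x :=
  (contMDiffAt_chart hφ hx).mdifferentiableAt (by simp)

lemma mdifferentiableAt_chart_symm (hφ : φ ∈ IsManifold.maximalAtlas (𝓡 n) ∞ M) {y : Coord n}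
    (hy : y ∈ φ.target) : MDifferentiableAt 𝓘(ℝ, Coord n) (𝓡 n) φ.symm y :=
  (contMDiffAt_chart_symm hφ hy).mdifferentiableAt (by simp)

/-- The value of the differential of `φ⁻¹` on a vector, as a section of the tangent bundle
along `φ⁻¹`. -/
lemma contMDiffAt_mfderiv_symm (hφ : φ ∈ IsManifold.maximalAtlas (𝓡 n) ∞ M) {y : Coord n}
    (hy : y ∈ φ.target) (u : Coord n) :
    ContMDiffAt 𝓘(ℝ, Coord n) (𝓡 n).tangent ∞
      (fun z => (⟨φ.symm z, mfderiv 𝓘(ℝ, Coord n) (𝓡 n) φ.symm z u⟩ :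
        TangentBundle (𝓡 n) M)) y := by
  have h := contMDiffAt_chart_symm hφ hy
  have h1 : ContMDiffAt 𝓘(ℝ, Coord n) 𝓘(ℝ, Coord n →L[ℝ] Coord n) ∞
      (inTangentCoordinates 𝓘(ℝ, Coord n) (𝓡 n) id φ.symm
        (mfderiv 𝓘(ℝ, Coord n) (𝓡 n) φ.symm) y) y := h.mfderiv_const le_rfl
  have h2 : ContMDiffAt 𝓘(ℝ, Coord n) 𝓘(ℝ, Coord n).tangent ∞
      (fun z : Coord n => (⟨z, u⟩ : TangentBundle 𝓘(ℝ, Coord n) (Coord n))) y := by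
    exact contMDiffAt_vectorSpace_iff_contDiffAt.2 contDiffAt_const
  exact ContMDiffAt.clm_apply_of_inCoordinates (b₁ := id) (b₂ := φ.symm)
    (E₁ := TangentSpace 𝓘(ℝ, Coord n)) (E₂ := TangentSpace (𝓡 n))
    (ϕ := mfderiv 𝓘(ℝ, Coord n) (𝓡 n) φ.symm) (v := fun _ => u) h1 h2 h

lemma mfderiv_chart_comp_symm (hφ : φ ∈ IsManifold.maximalAtlas (𝓡 n) ∞ M) {y : Coord n}
    (hy : y ∈ φ.target) (u : Coord n) :
    mvfderiv (𝓡 n) φ (φ.symm y) (mfderiv 𝓘(ℝ, Coord n) (𝓡 n) φ.symm y u) = u := by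
  have h := mfderiv_comp y (mdifferentiableAt_chart hφ (φ.map_target hy))
    (mdifferentiableAt_chart_symm hφ hy)
  have h2 : mfderiv 𝓘(ℝ, Coord n) 𝓘(ℝ, Coord n) (φ ∘ φ.symm) y =
      mfderiv 𝓘(ℝ, Coord n) 𝓘(ℝ, Coord n) id y := by
    apply Filter.EventuallyEq.mfderiv_eq
    filter_upwards [φ.open_target.mem_nhds hy] with z hz using φ.right_inv hz
  rw [h2, mfderiv_id] at h
  have h3 := congrArg (fun L => L u) h
  exact h3.symm

lemma mfderiv_symm_comp_chart (hφ : φ ∈ IsManifold.maximalAtlas (𝓡 n) ∞ M) {x : M}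
    (hx : x ∈ φ.source) (u : TangentSpace (𝓡 n) x) :
    (mfderiv 𝓘(ℝ, Coord n) (𝓡 n) φ.symm (φ x) (mvfderiv (𝓡 n) φ x u) : Coord n) = u := by
  have h := mfderiv_comp x (mdifferentiableAt_chart_symm hφ (φ.map_source hx))
    (mdifferentiableAt_chart hφ hx)
  have h2 : mfderiv (𝓡 n) (𝓡 n) (φ.symm ∘ φ) x = mfderiv (𝓡 n) (𝓡 n) id x := by
    apply Filter.EventuallyEq.mfderiv_eq
    filter_upwards [φ.open_source.mem_nhds hx] with z hz using φ.left_inv hz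
  rw [h2, mfderiv_id] at h
  have h3 := congrArg (fun L => L u) h
  exact h3.symm

/-- The differential of `φ⁻¹` as a map between model spaces. -/
noncomputable def dchartSymm (φ : LocalChart n M) (y : Coord n) : Coord n →L[ℝ] Coord n :=
  mfderiv 𝓘(ℝ, Coord n) (𝓡 n) φ.symm y

/-- The differential of `φ` as a map between model spaces. -/
noncomputable def dchart (φ : LocalChart n M) (x : M) : Coord n →L[ℝ] Coord n :=
  mvfderiv (𝓡 n) φ x

/-- With values in the fixed model space, base points such as `φ (φ.symm y)` can be rewritten
without transporting between tangent spaces. -/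
lemma dchart_dchartSymm (hφ : φ ∈ IsManifold.maximalAtlas (𝓡 n) ∞ M) {y : Coord n}
    (hy : y ∈ φ.target) (u : Coord n) : dchart φ (φ.symm y) (dchartSymm φ y u) = u :=
  mfderiv_chart_comp_symm hφ hy u

lemma dchartSymm_dchart (hφ : φ ∈ IsManifold.maximalAtlas (𝓡 n) ∞ M) {x : M}
    (hx : x ∈ φ.source) (u : Coord n) : dchartSymm φ (φ x) (dchart φ x u) = u :=
  mfderiv_symm_comp_chart hφ hx u

lemma cotChart_snd (φ : LocalChart n M) (P : TStar n M) (i : Fin n) :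
    (cotChart φ P).2 i =
      (show Coord n →L[ℝ] ℝ from P.snd) (dchartSymm φ (φ P.proj) (stdVec i)) := rfl

lemma cotChartInv_snd (φ : LocalChart n M) (z : Coord n × Coord n) :
    (show Coord n →L[ℝ] ℝ from (cotChartInv φ z).snd) =
      ∑ i, z.2 i • ((EuclideanSpace.proj i : Coord n →L[ℝ] ℝ).comp
        (dchart φ (φ.symm z.1))) := rfl

lemma sum_smul_stdVec (u : Coord n) : ∑ i, u i • stdVec i = u := by
  ext j
  simp [stdVec, Pi.single_apply]

lemma cotChart_cotChartInv (hφ : φ ∈ IsManifold.maximalAtlas (𝓡 n) ∞ M)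
    {z : Coord n × Coord n} (hz : z.1 ∈ φ.target) : cotChart φ (cotChartInv φ z) = z := by
  refine Prod.ext (φ.right_inv hz) ?_
  ext i
  rw [cotChart_snd, cotChartInv_snd]
  have h1 : φ (cotChartInv φ z).proj = z.1 := φ.right_inv hz
  rw [h1]
  simp [dchart_dchartSymm hφ hz, stdVec]

lemma cotChartInv_cotChart (hφ : φ ∈ IsManifold.maximalAtlas (𝓡 n) ∞ M)
    {P : TStar n M} (hP : P.proj ∈ φ.source) : cotChartInv φ (cotChart φ P) = P := by
  -- The two covectors lie in fibres over points not yet identified, so they are compared as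
  -- functionals on the model space.
  have key : (show Coord n →L[ℝ] ℝ from (cotChartInv φ (cotChart φ P)).snd) =
      (show Coord n →L[ℝ] ℝ from P.snd) := by
    rw [cotChartInv_snd]
    have h1 : φ.symm (cotChart φ P).1 = P.proj := φ.left_inv hP
    rw [h1]
    ext u
    have h2 := dchartSymm_dchart hφ hP u
    conv_rhs => rw [← h2, ← sum_smul_stdVec (dchart φ P.proj u), map_sum, map_sum]
    simp only [sum_apply, cotChart_snd, map_smul]
    refine Finset.sum_congr rfl fun i _ => ?_
    rw [_root_.map_smul (show Coord n →L[ℝ] ℝ from P.snd), smul_apply, smul_eq_mul, mul_comm]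
    rfl
  have h0 : (cotChartInv φ (cotChart φ P)).proj = P.proj := φ.left_inv hP
  obtain ⟨x, ξ⟩ := P
  -- Once the point is a free variable, the equality of base points can be substituted and the
  -- fibres become the same type.
  generalize cotChartInv φ (cotChart φ ⟨x, ξ⟩) = Q at key h0
  obtain ⟨x', ξ'⟩ := Q
  simp only at h0
  subst h0
  congr 1

/-- The momentum `p_i` is the tautological covector evaluated on the coordinate field `∂/∂xⁱ` pulled
back along the projection, and both are smooth. -/
lemma contMDiffAt_cotChart (hφ : φ ∈ IsManifold.maximalAtlas (𝓡 n) ∞ M)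
    {P : TStar n M} (hP : P.proj ∈ φ.source) :
    ContMDiffAt (TI n) 𝓘(ℝ, Coord n × Coord n) ∞ (cotChart φ) P := by
  have hb : ContMDiffAt (TI n) (𝓡 n) ∞ (fun Q : TStar n M => Q.proj) P :=
    Bundle.contMDiffAt_proj _
  have h1 : ContMDiffAt (TI n) 𝓘(ℝ, Coord n) ∞ (fun Q : TStar n M => φ Q.proj) P :=
    (contMDiffAt_chart hφ hP).comp P hb
  -- The identity map, read as the tautological covector along the projection.
  have hid : ContMDiffAt (TI n) ((𝓡 n).prod 𝓘(ℝ, Coord n →L[ℝ] ℝ)) ∞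
      (fun Q : TStar n M => (⟨Q.proj, Q.snd⟩ : TStar n M)) P := contMDiffAt_id
  have hv : ∀ i, ContMDiffAt (TI n) (𝓡 n).tangent ∞
      (fun Q : TStar n M => (⟨Q.proj, (show Coord n from dchartSymm φ (φ Q.proj) (stdVec i))⟩ :
        TangentBundle (𝓡 n) M)) P := by
    intro i
    have h2 := (contMDiffAt_mfderiv_symm hφ (φ.map_source hP) (stdVec i)).comp P h1
    refine h2.congr_of_eventuallyEq ?_
    have : ∀ᶠ Q : TStar n M in 𝓝 P, Q.proj ∈ φ.source :=
      hb.continuousAt.eventually (φ.open_source.mem_nhds hP)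
    filter_upwards [this] with Q hQ
    have h3 := φ.left_inv hQ
    simp only [Function.comp]
    congr 1
    exact h3.symm
  have h2 : ∀ i, ContMDiffAt (TI n) 𝓘(ℝ, ℝ) ∞ (fun Q : TStar n M => (cotChart φ Q).2 i) P := by
    intro i
    have h3 := hid.clm_bundle_apply (b := fun Q : TStar n M => Q.proj)
      (E₁ := fun x : M => TangentSpace (𝓡 n) x) (E₂ := fun _ : M => ℝ) (hv i)
    rw [Bundle.contMDiffAt_totalSpace] at h3
    exact h3.2
  have h3 : ContMDiffAt (TI n) 𝓘(ℝ, Coord n) ∞ (fun Q : TStar n M => (cotChart φ Q).2) P := by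
    have h4 : ContMDiffAt (TI n) 𝓘(ℝ, Fin n → ℝ) ∞
      (fun Q : TStar n M => fun i => (cotChart φ Q).2 i) P := contMDiffAt_pi_space.2 h2
    have h5 : ContMDiff 𝓘(ℝ, Fin n → ℝ) 𝓘(ℝ, Coord n) ∞
      (EuclideanSpace.equiv (Fin n) ℝ).symm :=
      (EuclideanSpace.equiv (Fin n) ℝ).symm.contDiff.contMDiff
    exact h5.contMDiffAt.comp P h4
  exact h1.prodMk_space h3

/-- In a trivialization, the covector field `dxⁱ` is a component of the coordinate expression of the
differential of `φ`, which is smooth. -/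
lemma contMDiffAt_dchart (hφ : φ ∈ IsManifold.maximalAtlas (𝓡 n) ∞ M) {x : M}
    (hx : x ∈ φ.source) (i : Fin n) :
    ContMDiffAt (𝓡 n) (TI n) ∞ (fun x' => (⟨x', ((EuclideanSpace.proj i : Coord n →L[ℝ] ℝ).comp
      (mvfderiv (𝓡 n) φ x'))⟩ : TStar n M)) x := by
  rw [contMDiffAt_hom_bundle]
  refine ⟨contMDiffAt_id, ?_⟩
  have h1 : ContMDiffAt (𝓡 n) 𝓘(ℝ, Coord n →L[ℝ] Coord n) ∞
      (inTangentCoordinates (𝓡 n) 𝓘(ℝ, Coord n) id φ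
        (mfderiv (𝓡 n) 𝓘(ℝ, Coord n) φ) x) x :=
    (contMDiffAt_chart hφ hx).mfderiv_const le_rfl
  have h2 : ContDiff ℝ ∞ (fun L : Coord n →L[ℝ] Coord n =>
      (EuclideanSpace.proj i : Coord n →L[ℝ] ℝ).comp L) :=
    contDiff_const.clm_comp contDiff_id
  refine (h2.contMDiff.contMDiffAt.comp x h1).congr_of_eventuallyEq ?_
  filter_upwards with x'
  ext u
  simp [inTangentCoordinates, ContinuousLinearMap.inCoordinates, mvfderiv]
  rfl

lemma contMDiffAt_cotChartInv (hφ : φ ∈ IsManifold.maximalAtlas (𝓡 n) ∞ M)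
    {z : Coord n × Coord n} (hz : z.1 ∈ φ.target) :
    ContMDiffAt 𝓘(ℝ, Coord n × Coord n) (TI n) ∞ (cotChartInv φ) z := by
  have h1 : ContMDiffAt 𝓘(ℝ, Coord n × Coord n) (𝓡 n) ∞
      (fun w : Coord n × Coord n => φ.symm w.1) z :=
    (contMDiffAt_chart_symm hφ hz).comp z contDiff_fst.contMDiff.contMDiffAt
  have h2 : ∀ i, ContMDiffAt 𝓘(ℝ, Coord n × Coord n) 𝓘(ℝ, ℝ) ∞
      (fun w : Coord n × Coord n => w.2 i) z := by
    intro i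
    have : ContDiff ℝ ∞ (fun w : Coord n × Coord n => w.2 i) := by fun_prop
    exact this.contMDiff.contMDiffAt
  have h3 := fun i => ((contMDiffAt_dchart hφ (φ.map_target hz) i).comp z h1)
  simp only [contMDiffAt_hom_bundle] at h3
  rw [contMDiffAt_hom_bundle]
  refine ⟨h1, ?_⟩
  have h4 := ContMDiffAt.sum (t := Finset.univ) (fun i _ => (h2 i).smul (h3 i).2)
  refine h4.congr_of_eventuallyEq ?_
  filter_upwards with w
  ext u
  simp [ContinuousLinearMap.inCoordinates, cotChartInv]

instance : IsManifold (TI n) (minSmoothness ℝ 2) (TStar n M) :=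
  IsManifold.of_le (n := ∞) (by simpa using (WithTop.coe_le_coe.2 le_top : ((2 : ℕ∞) : ℕ∞ω) ≤ ∞))

end Charts

/-! ### Riemannian geometry on an open subset of a vector space -/

section Flat

variable {E : Type*} [NormedAddCommGroup E] [NormedSpace ℝ E]

/-- `G` is a Riemannian metric on the open set `U` of a vector space, with Christoffel form `Γ`. -/
structure IsCoordMetric (U : Set E) (G : E → E →L[ℝ] E →L[ℝ] ℝ) (Γ : E → E →L[ℝ] E →L[ℝ] E) :
    Prop where
  isOpen : IsOpen U
  smooth : ContDiffOn ℝ ∞ G U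
  smooth_christoffel : ContDiffOn ℝ ∞ Γ U
  symm : ∀ y ∈ U, ∀ u v, G y u v = G y v u
  pos : ∀ y ∈ U, ∀ u, u ≠ 0 → 0 < G y u u
  christoffel : ∀ y ∈ U, ∀ u v w, 2 * G y (Γ y u v) w =
    fderiv ℝ G y u v w + fderiv ℝ G y v u w - fderiv ℝ G y w u v

/-- The curvature `R(u, v) w` of a Christoffel form. -/
noncomputable def curvForm (Γ : E → E →L[ℝ] E →L[ℝ] E) (y u v w : E) : E :=
  fderiv ℝ Γ y u v w - fderiv ℝ Γ y v u w + (Γ y u (Γ y v w) - Γ y v (Γ y u w))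

lemma differentiableAt_of_smooth {F : Type*} [NormedAddCommGroup F] [NormedSpace ℝ F]
    {f : E → F} {U : Set E} (hf : ContDiffOn ℝ ∞ f U) (hU : IsOpen U) {y : E} (hy : y ∈ U) :
    DifferentiableAt ℝ f y :=
  (hf.contDiffAt (hU.mem_nhds hy)).differentiableAt (by simp)

lemma contDiffOn_fderiv_of_smooth {F : Type*} [NormedAddCommGroup F] [NormedSpace ℝ F]
    {f : E → F} {U : Set E} (hf : ContDiffOn ℝ ∞ f U) (hU : IsOpen U) :
    ContDiffOn ℝ ∞ (fderiv ℝ f) U :=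
  hf.fderiv_of_isOpen hU (by simp)

lemma fderiv_fderiv_symm_of_smooth {F : Type*} [NormedAddCommGroup F] [NormedSpace ℝ F]
    {f : E → F} {U : Set E} (hf : ContDiffOn ℝ ∞ f U) (hU : IsOpen U) {y : E} (hy : y ∈ U)
    (u v : E) : fderiv ℝ (fderiv ℝ f) y u v = fderiv ℝ (fderiv ℝ f) y v u :=
  ((hf.contDiffAt (hU.mem_nhds hy)).isSymmSndFDerivAt
    (by simpa using (WithTop.coe_le_coe.2 le_top : ((2 : ℕ∞) : ℕ∞ω) ≤ ∞))).eq u v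

/-! ### Metric compatibility and the symmetries of the curvature. -/

namespace IsCoordMetric

variable {U : Set E} {G : E → E →L[ℝ] E →L[ℝ] ℝ} {Γ : E → E →L[ℝ] E →L[ℝ] E}

/-- Definiteness gives nondegeneracy: the difference is orthogonal to itself. Identities between
vectors are proved below by lowering the index. -/
lemma ext (h : IsCoordMetric U G Γ) {y : E} (hy : y ∈ U) {a b : E}
    (hab : ∀ w, G y a w = G y b w) : a = b := by
  by_contra hne
  have := h.pos y hy (a - b) (sub_ne_zero.2 hne)
  simp [hab] at this

lemma fderiv_symm (h : IsCoordMetric U G Γ) {y : E} (hy : y ∈ U) (w u v : E) :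
    fderiv ℝ G y w u v = fderiv ℝ G y w v u := by
  have hd := (differentiableAt_of_smooth h.smooth h.isOpen hy).hasFDerivAt
  have h1 := (hd.clm_apply (hasFDerivAt_const u y)).clm_apply (hasFDerivAt_const v y)
  have h2 := (hd.clm_apply (hasFDerivAt_const v y)).clm_apply (hasFDerivAt_const u y)
  have h3 : (fun z => G z u v) =ᶠ[𝓝 y] fun z => G z v u := by
    filter_upwards [h.isOpen.mem_nhds hy] with z hz using h.symm z hz u v
  have h4 := congrArg (fun L => L w) (h1.unique (h2.congr_of_eventuallyEq h3))
  simpa using h4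

lemma christoffel_symm (h : IsCoordMetric U G Γ) {y : E} (hy : y ∈ U) (u v : E) :
    Γ y u v = Γ y v u := by
  refine h.ext hy fun w => ?_
  have h1 := h.christoffel y hy u v w
  have h2 := h.christoffel y hy v u w
  have h3 := h.fderiv_symm hy w u v
  linarith

/-- `∇g = 0`: in the sum of the Christoffel identities for `(w, u, v)` and `(w, v, u)` all
derivatives cancel except those along `w`. -/
lemma compat (h : IsCoordMetric U G Γ) {y : E} (hy : y ∈ U) (w u v : E) :
    fderiv ℝ G y w u v = G y (Γ y w u) v + G y u (Γ y w v) := by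
  have h1 := h.christoffel y hy w u v
  have h2 := h.christoffel y hy w v u
  have h3 := h.fderiv_symm hy w u v
  have h4 := h.fderiv_symm hy u w v
  have h5 := h.fderiv_symm hy v w u
  rw [h.symm y hy u]
  linarith

lemma hasFDerivAt_christoffel (h : IsCoordMetric U G Γ) {y : E} (hy : y ∈ U) (v w : E) :
    HasFDerivAt (fun z => Γ z v w) (((fderiv ℝ Γ y).flip v).flip w) y := by
  have hd := (differentiableAt_of_smooth h.smooth_christoffel h.isOpen hy).hasFDerivAt
  convert (hd.clm_apply (hasFDerivAt_const v y)).clm_apply (hasFDerivAt_const w y) using 1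
  ext
  simp

lemma fderiv_christoffel_symm (h : IsCoordMetric U G Γ) {y : E} (hy : y ∈ U) (u v w : E) :
    fderiv ℝ Γ y u v w = fderiv ℝ Γ y u w v := by
  have h3 : (fun z => Γ z v w) =ᶠ[𝓝 y] fun z => Γ z w v := by
    filter_upwards [h.isOpen.mem_nhds hy] with z hz using h.christoffel_symm hz v w
  have h4 := congrArg (fun L => L u) ((h.hasFDerivAt_christoffel hy v w).unique
    ((h.hasFDerivAt_christoffel hy w v).congr_of_eventuallyEq h3))
  simpa using h4

/-- Symmetry of Γ and of its derivative in the last two slots makes the terms of the cyclic sum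
cancel in pairs. -/
lemma curv_bianchi (h : IsCoordMetric U G Γ) {y : E} (hy : y ∈ U) (u v w : E) :
    curvForm Γ y u v w + curvForm Γ y v w u + curvForm Γ y w u v = 0 := by
  simp only [curvForm]
  rw [h.fderiv_christoffel_symm hy u w v, h.fderiv_christoffel_symm hy v w u,
    h.fderiv_christoffel_symm hy w v u, h.christoffel_symm hy w v, h.christoffel_symm hy w u,
    h.christoffel_symm hy v u]
  abel

-- Differentiating `∇g = 0` once more expresses the Hessian of `G` through Γ; antisymmetrizing in
-- the two directions kills the Hessian and leaves the skewness of the curvature.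
set_option maxSynthPendingDepth 3 in
lemma curv_skew (h : IsCoordMetric U G Γ) {y : E} (hy : y ∈ U) (u v w x : E) :
    G y (curvForm Γ y u v w) x = - G y w (curvForm Γ y u v x) := by
  -- Product rule applied to `compat`, followed by `compat` for the derivatives of `G` that arise.
  have key : ∀ a b : E, fderiv ℝ (fderiv ℝ G) y a b w x =
      G y (Γ y a (Γ y b w)) x + G y (Γ y b w) (Γ y a x) + G y (fderiv ℝ Γ y a b w) x
      + (G y (Γ y a w) (Γ y b x) + G y w (Γ y a (Γ y b x)) + G y w (fderiv ℝ Γ y a b x)) := by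
    intro a b
    have hd := (differentiableAt_of_smooth h.smooth h.isOpen hy).hasFDerivAt
    have hdd := (differentiableAt_of_smooth (contDiffOn_fderiv_of_smooth h.smooth h.isOpen)
      h.isOpen hy).hasFDerivAt
    have h1 := ((hdd.clm_apply (hasFDerivAt_const b y)).clm_apply
      (hasFDerivAt_const w y)).clm_apply (hasFDerivAt_const x y)
    have h2 := ((hd.clm_apply (h.hasFDerivAt_christoffel hy b w)).clm_apply
      (hasFDerivAt_const x y)).add ((hd.clm_apply (hasFDerivAt_const w y)).clm_apply
        (h.hasFDerivAt_christoffel hy b x))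
    have h3 : (fun z => fderiv ℝ G z b w x) =ᶠ[𝓝 y]
        fun z => G z (Γ z b w) x + G z w (Γ z b x) := by
      filter_upwards [h.isOpen.mem_nhds hy] with z hz using h.compat hz b w x
    have h4 := congrArg (fun L => L a) (h1.unique (h2.congr_of_eventuallyEq h3))
    simp at h4
    rw [h4, h.compat hy a (Γ y b w) x, h.compat hy a w (Γ y b x)]
    ring
  have h1 := key u v
  have h2 := key v u
  have h3 := congrArg (fun L => L w x) (fderiv_fderiv_symm_of_smooth h.smooth h.isOpen hy u v)
  simp only [curvForm, map_add, map_sub, add_apply, sub_apply]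
  linarith

end IsCoordMetric

lemma curvForm_swap (Γ : E → E →L[ℝ] E →L[ℝ] E) (y u v w : E) :
    curvForm Γ y u v w = - curvForm Γ y v u w := by
  simp only [curvForm]
  abel

/-! ### Behaviour of Γ and of the curvature under local isometries. -/

section Transition

variable {U U' V : Set E} {G G' : E → E →L[ℝ] E →L[ℝ] ℝ} {Γ Γ' : E → E →L[ℝ] E →L[ℝ] E}
  {F : E → E}

/-- Transformation law of the Christoffel form under a local isometry. -/
lemma christoffel_transition (h : IsCoordMetric U G Γ) (h' : IsCoordMetric U' G' Γ')
    (hV : IsOpen V) (hVU' : V ⊆ U') (hF : ContDiffOn ℝ ∞ F V) (hFU : MapsTo F V U)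
    (hG : ∀ z ∈ V, ∀ u v, G' z u v = G (F z) (fderiv ℝ F z u) (fderiv ℝ F z v))
    (hsurj : ∀ z ∈ V, Function.Surjective (fderiv ℝ F z)) {y : E} (hy : y ∈ V) (u v : E) :
    fderiv ℝ F y (Γ' y u v) =
      fderiv ℝ (fderiv ℝ F) y u v + Γ (F y) (fderiv ℝ F y u) (fderiv ℝ F y v) := by
  have hFy := (differentiableAt_of_smooth hF hV hy).hasFDerivAt
  have hdF := (differentiableAt_of_smooth (contDiffOn_fderiv_of_smooth hF hV) hV hy).hasFDerivAt
  -- The derivative of the isometry relation `G'(b, c) = G(dF b, dF c)`.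
  have key : ∀ a b c : E, fderiv ℝ G' y a b c =
      fderiv ℝ G (F y) (fderiv ℝ F y a) (fderiv ℝ F y b) (fderiv ℝ F y c)
      + G (F y) (fderiv ℝ (fderiv ℝ F) y a b) (fderiv ℝ F y c)
      + G (F y) (fderiv ℝ F y b) (fderiv ℝ (fderiv ℝ F) y a c) := by
    intro a b c
    have h1 := ((differentiableAt_of_smooth h'.smooth h'.isOpen
      (hVU' hy)).hasFDerivAt.clm_apply (hasFDerivAt_const b y)).clm_apply (hasFDerivAt_const c y)
    have hGF := (differentiableAt_of_smooth h.smooth h.isOpen (hFU hy)).hasFDerivAt.comp y hFy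
    have h2 := (hGF.clm_apply (hdF.clm_apply (hasFDerivAt_const b y))).clm_apply
      (hdF.clm_apply (hasFDerivAt_const c y))
    have h3 : (fun z => G' z b c) =ᶠ[𝓝 y]
        fun z => (G ∘ F) z (fderiv ℝ F z b) (fderiv ℝ F z c) := by
      filter_upwards [hV.mem_nhds hy] with z hz using hG z hz b c
    have h4 := congrArg (fun L => L a) (h1.unique (h2.congr_of_eventuallyEq h3))
    simp at h4
    rw [h4]
    ring
  refine h.ext (hFU hy) fun x => ?_
  obtain ⟨w, rfl⟩ := hsurj y hy x
  rw [← hG y hy]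
  -- Six Hessian terms of `F` appear; by symmetry of second derivatives all cancel except twice the
  -- one in `(u, v)`, which is the inhomogeneous term of the law.
  have e1 := h'.christoffel y (hVU' hy) u v w
  rw [key, key, key, fderiv_fderiv_symm_of_smooth hF hV hy w u,
    fderiv_fderiv_symm_of_smooth hF hV hy w v, fderiv_fderiv_symm_of_smooth hF hV hy v u] at e1
  have e2 := h.christoffel (F y) (hFU hy) (fderiv ℝ F y u) (fderiv ℝ F y v) (fderiv ℝ F y w)
  have e3 := h.symm (F y) (hFU hy) (fderiv ℝ F y u) (fderiv ℝ (fderiv ℝ F) y v w)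
  have e4 := h.symm (F y) (hFU hy) (fderiv ℝ F y v) (fderiv ℝ (fderiv ℝ F) y u w)
  simp only [map_add, add_apply]
  linarith

/-- The curvature form is a tensor. -/
lemma curvForm_transition (h : IsCoordMetric U G Γ) (h' : IsCoordMetric U' G' Γ')
    (hV : IsOpen V) (hVU' : V ⊆ U') (hF : ContDiffOn ℝ ∞ F V) (hFU : MapsTo F V U)
    (hG : ∀ z ∈ V, ∀ u v, G' z u v = G (F z) (fderiv ℝ F z u) (fderiv ℝ F z v))
    (hsurj : ∀ z ∈ V, Function.Surjective (fderiv ℝ F z)) {y : E} (hy : y ∈ V) (u v w : E) :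
    fderiv ℝ F y (curvForm Γ' y u v w) =
      curvForm Γ (F y) (fderiv ℝ F y u) (fderiv ℝ F y v) (fderiv ℝ F y w) := by
  have law := fun (z : E) (hz : z ∈ V) (a b : E) =>
    christoffel_transition h h' hV hVU' hF hFU hG hsurj hz a b
  have hdFon := contDiffOn_fderiv_of_smooth hF hV
  have hFy := (differentiableAt_of_smooth hF hV hy).hasFDerivAt
  have hdF := (differentiableAt_of_smooth hdFon hV hy).hasFDerivAt
  have hddF := (differentiableAt_of_smooth (contDiffOn_fderiv_of_smooth hdFon hV)
    hV hy).hasFDerivAt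
  have hΓF := (differentiableAt_of_smooth h.smooth_christoffel h.isOpen
    (hFU hy)).hasFDerivAt.comp y hFy
  -- The derivative of the transformation law of Γ, solved for the derivative of `Γ'`.
  have key : ∀ a b c : E, fderiv ℝ F y (fderiv ℝ Γ' y a b c) =
      fderiv ℝ (fderiv ℝ (fderiv ℝ F)) y a b c
      + fderiv ℝ Γ (F y) (fderiv ℝ F y a) (fderiv ℝ F y b) (fderiv ℝ F y c)
      + Γ (F y) (fderiv ℝ (fderiv ℝ F) y a b) (fderiv ℝ F y c)
      + Γ (F y) (fderiv ℝ F y b) (fderiv ℝ (fderiv ℝ F) y a c)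
      - fderiv ℝ (fderiv ℝ F) y a (Γ' y b c) := by
    intro a b c
    have h1 := hdF.clm_apply (h'.hasFDerivAt_christoffel (hVU' hy) b c)
    have h2 := ((hddF.clm_apply (hasFDerivAt_const b y)).clm_apply (hasFDerivAt_const c y)).add
      ((hΓF.clm_apply (hdF.clm_apply (hasFDerivAt_const b y))).clm_apply
      (hdF.clm_apply (hasFDerivAt_const c y)))
    have h3 : (fun z => fderiv ℝ F z (Γ' z b c)) =ᶠ[𝓝 y]
        fun z => fderiv ℝ (fderiv ℝ F) z b c +
          (Γ ∘ F) z (fderiv ℝ F z b) (fderiv ℝ F z c) := by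
      filter_upwards [hV.mem_nhds hy] with z hz using law z hz b c
    have h4 := congrArg (fun L => L a) (h1.unique (h2.congr_of_eventuallyEq h3))
    simp at h4
    rw [eq_sub_iff_add_eq]
    refine Eq.trans ?_ (h4.trans ?_) <;> abel
  -- Antisymmetrizing removes the third derivatives of `F`; its second derivatives disappear once
  -- `law` is used for the quadratic terms.
  have h3 := congrArg (fun L => L w) (fderiv_fderiv_symm_of_smooth hdFon hV hy u v)
  have e0 := fderiv_fderiv_symm_of_smooth hF hV hy u v
  simp only [curvForm, map_add, map_sub, key, law y hy] at h3 ⊢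
  rw [h3, e0]
  rw [h.christoffel_symm (hFU hy) (fderiv ℝ F y u) (fderiv ℝ (fderiv ℝ F) y v w),
    h.christoffel_symm (hFU hy) (fderiv ℝ F y v) (fderiv ℝ (fderiv ℝ F) y u w)]
  abel

end Transition

end Flat

/-! ### The metric of the base in a chart -/

lemma trilinear_eq_zero {n : ℕ} {T : Coord n → Coord n → Coord n → ℝ}
    (h1 : ∀ v w, IsLinearMap ℝ fun u => T u v w) (h2 : ∀ u w, IsLinearMap ℝ fun v => T u v w)
    (h3 : ∀ u v, IsLinearMap ℝ fun w => T u v w)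
    (h : ∀ i j k, T (stdVec i) (stdVec j) (stdVec k) = 0) (u v w : Coord n) : T u v w = 0 := by
  have e1 : ∀ u v w, T u v w = ∑ i, u i * T (stdVec i) v w := fun u v w => by
    have := map_sum (IsLinearMap.mk' _ (h1 v w)) (fun i => u i • stdVec i) Finset.univ
    simpa [sum_smul_stdVec, (h1 v w).map_smul] using this
  have e2 : ∀ u v w, T u v w = ∑ i, v i * T u (stdVec i) w := fun u v w => by
    have := map_sum (IsLinearMap.mk' _ (h2 u w)) (fun i => v i • stdVec i) Finset.univ
    simpa [sum_smul_stdVec, (h2 u w).map_smul] using this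
  have e3 : ∀ u v w, T u v w = ∑ i, w i * T u v (stdVec i) := fun u v w => by
    have := map_sum (IsLinearMap.mk' _ (h3 u v)) (fun i => w i • stdVec i) Finset.univ
    simpa [sum_smul_stdVec, (h3 u v).map_smul] using this
  rw [e1]
  refine Finset.sum_eq_zero fun i _ => ?_
  rw [e2]
  simp [e3 _ _ w, h]

lemma stdVec_apply {n : ℕ} (i j : Fin n) : (stdVec i : Coord n) j = if j = i then 1 else 0 := by
  simp [stdVec]

/-! ### Smooth dependence of the inverse matrix. -/

section MatrixSmooth

variable {E : Type*} [NormedAddCommGroup E] [NormedSpace ℝ E] {m : ℕ} {s : Set E}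

lemma contDiffOn_det {A : E → Matrix (Fin m) (Fin m) ℝ}
    (hA : ∀ i j, ContDiffOn ℝ ∞ (fun y => A y i j) s) : ContDiffOn ℝ ∞ (fun y => (A y).det) s := by
  simp only [Matrix.det_apply]
  exact ContDiffOn.sum fun σ _ => (contDiffOn_prod fun i _ => hA _ _).const_smul _

/-- Cramer's rule: the entries are adjugate entries divided by the determinant, both built
polynomially from the entries of the matrix. -/
lemma contDiffOn_matrix_inv {A : E → Matrix (Fin m) (Fin m) ℝ}
    (hA : ∀ i j, ContDiffOn ℝ ∞ (fun y => A y i j) s) (hdet : ∀ y ∈ s, (A y).det ≠ 0)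
    (i j : Fin m) : ContDiffOn ℝ ∞ (fun y => (A y)⁻¹ i j) s := by
  have h1 : ContDiffOn ℝ ∞ (fun y => (A y).det⁻¹ * (A y).adjugate i j) s := by
    refine ((contDiffOn_det hA).inv hdet).mul ?_
    simp only [Matrix.adjugate_apply]
    refine contDiffOn_det fun k l => ?_
    simp only [Matrix.updateRow_apply]
    split_ifs
    · exact contDiffOn_const
    · exact hA _ _
  refine h1.congr fun y hy => ?_
  simp [Matrix.inv_def]

end MatrixSmooth

section Base

variable {n : ℕ} {M : Type*} [TopologicalSpace M] [ChartedSpace (Coord n) M]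
  [IsManifold (𝓡 n) ∞ M] {φ ψ : LocalChart n M} (g : RMetric n M)

/-- The metric in a chart, as a field of bilinear forms. -/
noncomputable def gForm (φ : LocalChart n M) (y : Coord n) : Coord n →L[ℝ] Coord n →L[ℝ] ℝ :=
  (show Coord n →L[ℝ] Coord n →L[ℝ] ℝ from g.inner (φ.symm y)).bilinearComp
    (dchartSymm φ y) (dchartSymm φ y)

lemma gLow_eq (φ : LocalChart n M) (y : Coord n) (i j : Fin n) :
    gLow g φ y i j = gForm g φ y (stdVec i) (stdVec j) := rfl

lemma gForm_symm (φ : LocalChart n M) (y u v : Coord n) : gForm g φ y u v = gForm g φ y v u :=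
  g.symm _ _ _

lemma gLow_symm (φ : LocalChart n M) (y : Coord n) (i j : Fin n) :
    gLow g φ y i j = gLow g φ y j i := gForm_symm g φ y _ _

lemma gForm_pos (hφ : φ ∈ IsManifold.maximalAtlas (𝓡 n) ∞ M) {y : Coord n} (hy : y ∈ φ.target)
    {u : Coord n} (hu : u ≠ 0) : 0 < gForm g φ y u u := by
  refine g.pos (φ.symm y) (dchartSymm φ y u) fun h => hu ?_
  have h1 := dchart_dchartSymm hφ hy u
  have h2 : dchartSymm φ y u = 0 := h
  rw [← h1, h2, map_zero]

lemma gForm_apply (φ : LocalChart n M) (y u v : Coord n) :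
    gForm g φ y u v = ∑ i, ∑ j, gLow g φ y i j * u i * v j := by
  conv_lhs => rw [← sum_smul_stdVec u, ← sum_smul_stdVec v]
  simp only [map_sum, map_smul, sum_apply, smul_apply, smul_eq_mul, Finset.mul_sum, gLow_eq]
  rw [Finset.sum_comm]
  exact Finset.sum_congr rfl fun i _ => Finset.sum_congr rfl fun j _ => by ring

lemma contDiffOn_gForm (hφ : φ ∈ IsManifold.maximalAtlas (𝓡 n) ∞ M) :
    ContDiffOn ℝ ∞ (gForm g φ) φ.target := by
  refine contDiffOn_clm_apply.2 fun u => contDiffOn_clm_apply.2 fun v => fun y hy => ?_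
  refine ContDiffAt.contDiffWithinAt (ContMDiffAt.contDiffAt ?_)
  have hg := (g.contMDiff (φ.symm y)).comp y (contMDiffAt_chart_symm hφ hy)
  have h := ContMDiffAt.clm_bundle_apply₂ (b := φ.symm) (E₁ := fun x : M => TangentSpace (𝓡 n) x)
    (E₂ := fun x : M => TangentSpace (𝓡 n) x) (E₃ := fun _ : M => ℝ) hg
    (contMDiffAt_mfderiv_symm hφ hy u) (contMDiffAt_mfderiv_symm hφ hy v)
  rw [Bundle.contMDiffAt_totalSpace] at h
  exact h.2

lemma contDiffOn_gLow (hφ : φ ∈ IsManifold.maximalAtlas (𝓡 n) ∞ M) (i j : Fin n) :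
    ContDiffOn ℝ ∞ (fun y => gLow g φ y i j) φ.target :=
  ((contDiffOn_gForm g hφ).clm_apply contDiffOn_const).clm_apply contDiffOn_const

/-- The matrix `(g_{ij})`. -/
noncomputable abbrev gMat (φ : LocalChart n M) (y : Coord n) : Matrix (Fin n) (Fin n) ℝ :=
  Matrix.of (gLow g φ y)

/-- The matrix `(g^{ij})`. -/
noncomputable abbrev gInv (φ : LocalChart n M) (y : Coord n) : Matrix (Fin n) (Fin n) ℝ :=
  Matrix.of (gUp g φ y)

/-- A nonzero kernel vector of the matrix would be a null vector of the positive definite form. -/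
lemma gMat_det_ne_zero (hφ : φ ∈ IsManifold.maximalAtlas (𝓡 n) ∞ M) {y : Coord n}
    (hy : y ∈ φ.target) : (gMat g φ y).det ≠ 0 := by
  intro h0
  obtain ⟨v, hv, h⟩ := Matrix.exists_mulVec_eq_zero_iff.2 h0
  have h1 := gForm_pos g hφ hy (u := WithLp.toLp 2 v) (by
    intro h2; exact hv (by simpa using h2))
  have h2 : gForm g φ y (WithLp.toLp 2 v) (WithLp.toLp 2 v) = v ⬝ᵥ (gMat g φ y).mulVec v := by
    simp only [gForm_apply, dotProduct, Matrix.mulVec, Finset.mul_sum, Matrix.of_apply]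
    exact Finset.sum_congr rfl fun i _ => Finset.sum_congr rfl fun j _ => by ring
  rw [h2, h] at h1
  simp at h1

lemma gMat_mul_gInv (hφ : φ ∈ IsManifold.maximalAtlas (𝓡 n) ∞ M) {y : Coord n}
    (hy : y ∈ φ.target) : gMat g φ y * gInv g φ y = 1 :=
  Matrix.mul_nonsing_inv _ (isUnit_iff_ne_zero.2 (gMat_det_ne_zero g hφ hy))

lemma gInv_mul_gMat (hφ : φ ∈ IsManifold.maximalAtlas (𝓡 n) ∞ M) {y : Coord n}
    (hy : y ∈ φ.target) : gInv g φ y * gMat g φ y = 1 :=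
  Matrix.nonsing_inv_mul _ (isUnit_iff_ne_zero.2 (gMat_det_ne_zero g hφ hy))

lemma gMat_transpose (φ : LocalChart n M) (y : Coord n) : (gMat g φ y).transpose = gMat g φ y := by
  ext i j
  exact gLow_symm g φ y j i

lemma gInv_transpose (φ : LocalChart n M) (y : Coord n) : (gInv g φ y).transpose = gInv g φ y := by
  change (gMat g φ y)⁻¹.transpose = (gMat g φ y)⁻¹
  rw [Matrix.transpose_nonsing_inv, gMat_transpose]

lemma gUp_symm (φ : LocalChart n M) (y : Coord n) (i j : Fin n) :
    gUp g φ y i j = gUp g φ y j i := congrFun (congrFun (gInv_transpose g φ y) j) i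

lemma sum_gUp_mul_gLow (hφ : φ ∈ IsManifold.maximalAtlas (𝓡 n) ∞ M) {y : Coord n}
    (hy : y ∈ φ.target) (i j : Fin n) : ∑ k, gUp g φ y i k * gLow g φ y k j = kron i j := by
  have := congrFun (congrFun (gInv_mul_gMat g hφ hy) i) j
  simpa [Matrix.mul_apply, Matrix.one_apply, kron] using this

lemma contDiffOn_gUp (hφ : φ ∈ IsManifold.maximalAtlas (𝓡 n) ∞ M) (i j : Fin n) :
    ContDiffOn ℝ ∞ (fun y => gUp g φ y i j) φ.target :=
  contDiffOn_matrix_inv (A := gMat g φ) (fun k l => contDiffOn_gLow g hφ k l)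
    (fun _ hy => gMat_det_ne_zero g hφ hy) i j

lemma pderiv_gLow (hφ : φ ∈ IsManifold.maximalAtlas (𝓡 n) ∞ M) {y : Coord n}
    (hy : y ∈ φ.target) (i j k : Fin n) : pderiv i (fun z => gLow g φ z j k) y =
      fderiv ℝ (gForm g φ) y (stdVec i) (stdVec j) (stdVec k) := by
  have h := ((differentiableAt_of_smooth (contDiffOn_gForm g hφ) φ.open_target
    hy).hasFDerivAt.clm_apply (hasFDerivAt_const (stdVec j) y)).clm_apply
      (hasFDerivAt_const (stdVec k) y)
  have h1 := congrArg (fun L => L (stdVec i)) h.fderiv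
  simpa [pderiv, gLow_eq] using h1

lemma contDiffOn_pderiv {f : Coord n → ℝ} {U : Set (Coord n)} (hf : ContDiffOn ℝ ∞ f U)
    (hU : IsOpen U) (i : Fin n) : ContDiffOn ℝ ∞ (pderiv i f) U :=
  (contDiffOn_fderiv_of_smooth hf hU).clm_apply contDiffOn_const

lemma contDiffOn_Gam (hφ : φ ∈ IsManifold.maximalAtlas (𝓡 n) ∞ M) (k i j : Fin n) :
    ContDiffOn ℝ ∞ (fun y => Gam g φ y k i j) φ.target := by
  have h := fun a b c => contDiffOn_pderiv (contDiffOn_gLow g hφ a b) φ.open_target c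
  exact contDiffOn_const.mul (ContDiffOn.sum fun l _ => (contDiffOn_gUp g hφ k l).mul
    (((h _ _ _).add (h _ _ _)).sub (h _ _ _)))

lemma contDiffOn_Riem (hφ : φ ∈ IsManifold.maximalAtlas (𝓡 n) ∞ M) (h k i j : Fin n) :
    ContDiffOn ℝ ∞ (fun y => Riem g φ y h k i j) φ.target := by
  have h1 := fun a b c d => contDiffOn_pderiv (contDiffOn_Gam g hφ a b c) φ.open_target d
  have h2 := contDiffOn_Gam g hφ
  exact ((h1 _ _ _ _).sub (h1 _ _ _ _)).add (ContDiffOn.sum fun l _ =>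
    ((h2 _ _ _).mul (h2 _ _ _)).sub ((h2 _ _ _).mul (h2 _ _ _)))

/-- The Christoffel symbols as a field of bilinear maps. -/
noncomputable def gamForm (φ : LocalChart n M) (y : Coord n) :
    Coord n →L[ℝ] Coord n →L[ℝ] Coord n :=
  ∑ i, ∑ j, ∑ k, Gam g φ y k i j • (EuclideanSpace.proj i : Coord n →L[ℝ] ℝ).smulRight
    ((EuclideanSpace.proj j : Coord n →L[ℝ] ℝ).smulRight (stdVec k))

lemma gamForm_apply (φ : LocalChart n M) (y u v : Coord n) (k : Fin n) :
    gamForm g φ y u v k = ∑ i, ∑ j, Gam g φ y k i j * u i * v j := by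
  simp [gamForm, stdVec_apply, mul_assoc]

lemma gamForm_std (φ : LocalChart n M) (y : Coord n) (k i j : Fin n) :
    gamForm g φ y (stdVec i) (stdVec j) k = Gam g φ y k i j := by
  simp [gamForm_apply, stdVec_apply]

set_option maxSynthPendingDepth 3 in
lemma contDiffOn_gamForm (hφ : φ ∈ IsManifold.maximalAtlas (𝓡 n) ∞ M) :
    ContDiffOn ℝ ∞ (gamForm g φ) φ.target :=
  ContDiffOn.sum fun _ _ => ContDiffOn.sum fun _ _ => ContDiffOn.sum fun _ _ =>
    (contDiffOn_Gam g hφ _ _ _).smul contDiffOn_const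

/-- The Christoffel identity is trilinear, hence can be tested on basis vectors, where lowering with
`g_{kl}` undoes the `g^{kl}` in the definition of `Gam`. -/
lemma isCoordMetric (hφ : φ ∈ IsManifold.maximalAtlas (𝓡 n) ∞ M) :
    IsCoordMetric φ.target (gForm g φ) (gamForm g φ) where
  isOpen := φ.open_target
  smooth := contDiffOn_gForm g hφ
  smooth_christoffel := contDiffOn_gamForm g hφ
  symm := fun y _ u v => gForm_symm g φ y u v
  pos := fun y hy u hu => gForm_pos g hφ hy hu
  christoffel := by
    intro y hy u v w
    rw [← sub_eq_zero]
    refine trilinear_eq_zero (T := fun u v w => 2 * gForm g φ y (gamForm g φ y u v) w -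
      (fderiv ℝ (gForm g φ) y u v w + fderiv ℝ (gForm g φ) y v u w -
        fderiv ℝ (gForm g φ) y w u v)) ?_ ?_ ?_ ?_ u v w
    · intro v w; constructor <;> intros <;> simp <;> ring
    · intro v w; constructor <;> intros <;> simp <;> ring
    · intro v w; constructor <;> intros <;> simp <;> ring
    intro i j l
    rw [gForm_apply]
    simp only [gamForm_std, stdVec_apply, ← pderiv_gLow g hφ hy]
    simp only [mul_ite, mul_one, mul_zero, Finset.sum_ite_eq', Finset.mem_univ, if_true, Gam]
    rw [sub_eq_zero, Finset.mul_sum]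
    simp only [Finset.mul_sum]
    rw [Finset.sum_comm]
    have h1 : ∀ m, ∑ k, gLow g φ y k l * gUp g φ y k m = kron l m := fun m => by
      have h3 : kron l m = kron m l := by simp only [kron, eq_comm]
      rw [h3, ← sum_gUp_mul_gLow g hφ hy m l]
      exact Finset.sum_congr rfl fun k _ => by rw [gUp_symm g φ y m k]; ring
    have h2 : ∀ m : Fin n, ∀ X : ℝ, ∑ k, 2 * (gLow g φ y k l * (1 / 2 * (gUp g φ y k m * X))) =
        kron l m * X := fun m X => by
      rw [← h1, Finset.sum_mul]
      exact Finset.sum_congr rfl fun k _ => by ring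
    simp only [h2]
    simp [kron]

lemma fderiv_gamForm_std (hφ : φ ∈ IsManifold.maximalAtlas (𝓡 n) ∞ M) {y : Coord n}
    (hy : y ∈ φ.target) (h i j k : Fin n) :
    fderiv ℝ (gamForm g φ) y (stdVec i) (stdVec j) (stdVec k) h =
      pderiv i (fun z => Gam g φ z h j k) y := by
  have h1 := (EuclideanSpace.proj h : Coord n →L[ℝ] ℝ).hasFDerivAt.comp y
    ((isCoordMetric g hφ).hasFDerivAt_christoffel hy (stdVec j) (stdVec k))
  have h2 := congrArg (fun L => L (stdVec i)) h1.fderiv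
  simp only [pderiv, ← gamForm_std]
  simpa [Function.comp_def] using h2.symm

lemma curvForm_std (hφ : φ ∈ IsManifold.maximalAtlas (𝓡 n) ∞ M) {y : Coord n}
    (hy : y ∈ φ.target) (h k i j : Fin n) :
    curvForm (gamForm g φ) y (stdVec i) (stdVec j) (stdVec k) h = Riem g φ y h k i j := by
  simp only [curvForm, Riem, PiLp.add_apply, PiLp.sub_apply, fderiv_gamForm_std g hφ hy]
  rw [gamForm_apply, gamForm_apply]
  simp [gamForm_std, stdVec_apply, Finset.sum_sub_distrib]

end Base

/-! ### Changes of charts -/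

section Transition

variable {n : ℕ} {M : Type*} [TopologicalSpace M] [ChartedSpace (Coord n) M]
  [IsManifold (𝓡 n) ∞ M] {φ ψ : LocalChart n M} (g : RMetric n M)

/-- The change of coordinates from `φ` to `ψ`. -/
def trans (φ ψ : LocalChart n M) (y : Coord n) : Coord n := ψ (φ.symm y)

/-- The domain of the change of coordinates from `φ` to `ψ`. -/
def overlap (φ ψ : LocalChart n M) : Set (Coord n) := φ.target ∩ φ.symm ⁻¹' ψ.source

lemma isOpen_overlap (φ ψ : LocalChart n M) : IsOpen (overlap φ ψ) :=
  φ.symm.isOpen_inter_preimage ψ.open_source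

lemma mem_overlap {x : M} (hx : x ∈ φ.source) (hx' : x ∈ ψ.source) : φ x ∈ overlap φ ψ :=
  ⟨φ.map_source hx, by simpa [φ.left_inv hx] using hx'⟩

lemma contDiffOn_trans (hφ : φ ∈ IsManifold.maximalAtlas (𝓡 n) ∞ M)
    (hψ : ψ ∈ IsManifold.maximalAtlas (𝓡 n) ∞ M) :
    ContDiffOn ℝ ∞ (trans φ ψ) (overlap φ ψ) := fun y hy =>
  (((contMDiffAt_chart hψ hy.2).comp y
    (contMDiffAt_chart_symm hφ hy.1)).contDiffAt).contDiffWithinAt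

lemma mapsTo_trans (φ ψ : LocalChart n M) : MapsTo (trans φ ψ) (overlap φ ψ) ψ.target :=
  fun _ hy => ψ.map_source hy.2

lemma fderiv_trans (hφ : φ ∈ IsManifold.maximalAtlas (𝓡 n) ∞ M)
    (hψ : ψ ∈ IsManifold.maximalAtlas (𝓡 n) ∞ M) {y : Coord n} (hy : y ∈ overlap φ ψ)
    (u : Coord n) :
    fderiv ℝ (trans φ ψ) y u = dchart ψ (φ.symm y) (dchartSymm φ y u) := by
  have h := mfderiv_comp y (mdifferentiableAt_chart hψ hy.2) (mdifferentiableAt_chart_symm hφ hy.1)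
  have h1 := congrArg (fun L => L u) h
  rw [mfderiv_eq_fderiv] at h1
  exact h1

lemma dchartSymm_fderiv_trans (hφ : φ ∈ IsManifold.maximalAtlas (𝓡 n) ∞ M)
    (hψ : ψ ∈ IsManifold.maximalAtlas (𝓡 n) ∞ M) {y : Coord n} (hy : y ∈ overlap φ ψ)
    (u : Coord n) :
    dchartSymm ψ (trans φ ψ y) (fderiv ℝ (trans φ ψ) y u) = dchartSymm φ y u := by
  rw [fderiv_trans hφ hψ hy]
  exact dchartSymm_dchart hψ hy.2 _

lemma fderiv_trans_fderiv_trans (hφ : φ ∈ IsManifold.maximalAtlas (𝓡 n) ∞ M)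
    (hψ : ψ ∈ IsManifold.maximalAtlas (𝓡 n) ∞ M) {x : M} (hx : x ∈ φ.source) (hx' : x ∈ ψ.source)
    (u : Coord n) :
    fderiv ℝ (trans ψ φ) (ψ x) (fderiv ℝ (trans φ ψ) (φ x) u) = u := by
  have h1 := dchartSymm_fderiv_trans hφ hψ (mem_overlap hx hx') u
  have h2 : trans φ ψ (φ x) = ψ x := by simp [trans, φ.left_inv hx]
  rw [h2] at h1
  rw [fderiv_trans hψ hφ (mem_overlap hx' hx), h1, ψ.left_inv hx']
  have h3 := dchart_dchartSymm hφ (φ.map_source hx) u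
  rwa [φ.left_inv hx] at h3

lemma gForm_trans (hφ : φ ∈ IsManifold.maximalAtlas (𝓡 n) ∞ M)
    (hψ : ψ ∈ IsManifold.maximalAtlas (𝓡 n) ∞ M) {y : Coord n} (hy : y ∈ overlap φ ψ)
    (u v : Coord n) : gForm g φ y u v =
      gForm g ψ (trans φ ψ y) (fderiv ℝ (trans φ ψ) y u) (fderiv ℝ (trans φ ψ) y v) := by
  have h1 : ψ.symm (trans φ ψ y) = φ.symm y := ψ.left_inv hy.2
  have h2 : ∀ z u v, gForm g ψ z u v =
      (show Coord n →L[ℝ] Coord n →L[ℝ] ℝ from g.inner (ψ.symm z))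
        (dchartSymm ψ z u) (dchartSymm ψ z v) := fun _ _ _ => rfl
  rw [h2, dchartSymm_fderiv_trans hφ hψ hy, dchartSymm_fderiv_trans hφ hψ hy, h1]
  rfl

lemma surjective_fderiv_trans (hφ : φ ∈ IsManifold.maximalAtlas (𝓡 n) ∞ M)
    (hψ : ψ ∈ IsManifold.maximalAtlas (𝓡 n) ∞ M) {y : Coord n} (hy : y ∈ overlap φ ψ) :
    Function.Surjective (fderiv ℝ (trans φ ψ) y) := fun v => by
  have h := fderiv_trans_fderiv_trans hψ hφ hy.2 (φ.map_target hy.1) v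
  rw [φ.right_inv hy.1] at h
  exact ⟨_, h⟩

/-- The second derivative of the transition map occurring here is what compensates the non-tensorial
change of `dp` in `pair_vertForm_trans`. -/
lemma gamForm_trans (hφ : φ ∈ IsManifold.maximalAtlas (𝓡 n) ∞ M)
    (hψ : ψ ∈ IsManifold.maximalAtlas (𝓡 n) ∞ M) {y : Coord n} (hy : y ∈ overlap φ ψ)
    (u v : Coord n) :
    fderiv ℝ (trans φ ψ) y (gamForm g φ y u v) = fderiv ℝ (fderiv ℝ (trans φ ψ)) y u v +
      gamForm g ψ (trans φ ψ y) (fderiv ℝ (trans φ ψ) y u) (fderiv ℝ (trans φ ψ) y v) :=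
  christoffel_transition (isCoordMetric g hψ) (isCoordMetric g hφ) (isOpen_overlap φ ψ)
    inter_subset_left (contDiffOn_trans hφ hψ) (mapsTo_trans φ ψ)
    (fun _ hz => gForm_trans g hφ hψ hz) (fun _ hz => surjective_fderiv_trans hφ hψ hz) hy u v

lemma curvForm_trans (hφ : φ ∈ IsManifold.maximalAtlas (𝓡 n) ∞ M)
    (hψ : ψ ∈ IsManifold.maximalAtlas (𝓡 n) ∞ M) {y : Coord n} (hy : y ∈ overlap φ ψ)
    (u v w : Coord n) :
    fderiv ℝ (trans φ ψ) y (curvForm (gamForm g φ) y u v w) =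
      curvForm (gamForm g ψ) (trans φ ψ y) (fderiv ℝ (trans φ ψ) y u)
        (fderiv ℝ (trans φ ψ) y v) (fderiv ℝ (trans φ ψ) y w) :=
  curvForm_transition (isCoordMetric g hψ) (isCoordMetric g hφ) (isOpen_overlap φ ψ)
    inter_subset_left (contDiffOn_trans hφ hψ) (mapsTo_trans φ ψ)
    (fun _ hz => gForm_trans g hφ hψ hz) (fun _ hz => surjective_fderiv_trans hφ hψ hz) hy u v w

lemma jac_eq (hφ : φ ∈ IsManifold.maximalAtlas (𝓡 n) ∞ M)
    (hψ : ψ ∈ IsManifold.maximalAtlas (𝓡 n) ∞ M) {y : Coord n} (hy : y ∈ overlap φ ψ)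
    (a i : Fin n) : jac φ ψ y a i = fderiv ℝ (trans φ ψ) y (stdVec i) a := by
  have h := (EuclideanSpace.proj a : Coord n →L[ℝ] ℝ).hasFDerivAt.comp y
    (differentiableAt_of_smooth (contDiffOn_trans hφ hψ) (isOpen_overlap φ ψ) hy).hasFDerivAt
  exact congrArg (fun L => L (stdVec i)) h.fderiv

lemma fderiv_trans_apply (hφ : φ ∈ IsManifold.maximalAtlas (𝓡 n) ∞ M)
    (hψ : ψ ∈ IsManifold.maximalAtlas (𝓡 n) ∞ M) {y : Coord n} (hy : y ∈ overlap φ ψ)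
    (u : Coord n) (a : Fin n) : fderiv ℝ (trans φ ψ) y u a = ∑ i, jac φ ψ y a i * u i := by
  conv_lhs => rw [← sum_smul_stdVec u]
  simp [jac_eq hφ hψ hy, mul_comm]

/-- The pairing of a covector and a vector given by their components. -/
noncomputable def pair : Coord n →L[ℝ] Coord n →L[ℝ] ℝ := innerSL ℝ

lemma pair_apply (p u : Coord n) : pair p u = ∑ i, p i * u i := by
  rw [pair, innerSL_apply_apply, PiLp.inner_apply]
  simp [mul_comm]

lemma pair_std (p : Coord n) (i : Fin n) : pair p (stdVec i) = p i := by
  simp [pair_apply, stdVec_apply]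

lemma snd_dchartSymm (φ : LocalChart n M) (P : TStar n M) (u : Coord n) :
    (show Coord n →L[ℝ] ℝ from P.snd) (dchartSymm φ (φ P.proj) u) = pair (cotChart φ P).2 u := by
  conv_lhs => rw [← sum_smul_stdVec u]
  simp only [map_sum, map_smul, pair_apply, cotChart_snd, mul_comm]
  exact map_sum (show Coord n →L[ℝ] ℝ from P.snd) _ _ |>.trans
    (Finset.sum_congr rfl fun i _ => _root_.map_smul (show Coord n →L[ℝ] ℝ from P.snd) _ _)

/-- Both sides are the value of one covector on one tangent vector. The relation `p'(DF u) = p(u)`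
determines `p'` without inverting the Jacobian. -/
lemma pair_trans (hφ : φ ∈ IsManifold.maximalAtlas (𝓡 n) ∞ M)
    (hψ : ψ ∈ IsManifold.maximalAtlas (𝓡 n) ∞ M) {P : TStar n M} (hP : P.proj ∈ φ.source)
    (hP' : P.proj ∈ ψ.source) (u : Coord n) :
    pair (cotChart ψ P).2 (fderiv ℝ (trans φ ψ) (φ P.proj) u) = pair (cotChart φ P).2 u := by
  have h1 := dchartSymm_fderiv_trans hφ hψ (mem_overlap hP hP') u
  have h2 : trans φ ψ (φ P.proj) = ψ P.proj := by simp [trans, φ.left_inv hP]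
  rw [← snd_dchartSymm, ← h2, h1, snd_dchartSymm]

end Transition

/-! ### Vector fields on the cotangent bundle in induced coordinates -/

section Lift

variable {n : ℕ} {M : Type*} [TopologicalSpace M] [ChartedSpace (Coord n) M]
  [IsManifold (𝓡 n) ∞ M] {φ ψ : LocalChart n M} {P : TStar n M}

lemma eventually_proj_mem (hP : P.proj ∈ φ.source) :
    ∀ᶠ Q : TStar n M in 𝓝 P, Q.proj ∈ φ.source :=
  (FiberBundle.continuous_proj (Coord n →L[ℝ] ℝ)
    (fun x : M => TangentSpace (𝓡 n) x →L[ℝ] ℝ)).continuousAt.eventually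
      (φ.open_source.mem_nhds hP)

lemma mdifferentiableAt_cotChart (hφ : φ ∈ IsManifold.maximalAtlas (𝓡 n) ∞ M)
    (hP : P.proj ∈ φ.source) : MDifferentiableAt (TI n) 𝓘(ℝ, Coord n × Coord n) (cotChart φ) P :=
  (contMDiffAt_cotChart hφ hP).mdifferentiableAt (by simp)

lemma mdifferentiableAt_cotChartInv (hφ : φ ∈ IsManifold.maximalAtlas (𝓡 n) ∞ M)
    {z : Coord n × Coord n} (hz : z.1 ∈ φ.target) :
    MDifferentiableAt 𝓘(ℝ, Coord n × Coord n) (TI n) (cotChartInv φ) z :=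
  (contMDiffAt_cotChartInv hφ hz).mdifferentiableAt (by simp)

/-- The differential of the induced chart as a map between model spaces. -/
noncomputable def dcot (φ : LocalChart n M) (P : TStar n M) :
    Coord n × (Coord n →L[ℝ] ℝ) →L[ℝ] Coord n × Coord n :=
  mvfderiv (TI n) (cotChart φ) P

/-- The vector field on `π⁻¹(U)` with components `V` in the induced chart. -/
noncomputable def liftField (φ : LocalChart n M) (V : Coord n × Coord n → Coord n × Coord n)
    (P : TStar n M) : TangentSpace (TI n) P :=
  mfderiv 𝓘(ℝ, Coord n × Coord n) (TI n) (cotChartInv φ) (cotChart φ P) (V (cotChart φ P))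

lemma mvfderiv_cotChart_liftField (hφ : φ ∈ IsManifold.maximalAtlas (𝓡 n) ∞ M)
    (hP : P.proj ∈ φ.source) (V : Coord n × Coord n → Coord n × Coord n) :
    mvfderiv (TI n) (cotChart φ) P (liftField φ V P) = V (cotChart φ P) := by
  have hz : (cotChart φ P).1 ∈ φ.target := φ.map_source hP
  have hI := cotChartInv_cotChart hφ hP
  have h := mfderiv_comp_of_eq (x := cotChart φ P) (mdifferentiableAt_cotChart hφ hP)
    (mdifferentiableAt_cotChartInv hφ hz) hI
  have h2 : mfderiv 𝓘(ℝ, Coord n × Coord n) 𝓘(ℝ, Coord n × Coord n)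
      (cotChart φ ∘ cotChartInv φ) (cotChart φ P) =
      mfderiv 𝓘(ℝ, Coord n × Coord n) 𝓘(ℝ, Coord n × Coord n) id (cotChart φ P) := by
    apply Filter.EventuallyEq.mfderiv_eq
    filter_upwards [continuousAt_fst.eventually (φ.open_target.mem_nhds hz)] with w hw
      using cotChart_cotChartInv hφ hw
  rw [h2, mfderiv_id] at h
  have h3 : dcot φ (cotChartInv φ (cotChart φ P)) (liftField φ V P) = V (cotChart φ P) :=
    (congrArg (fun L => L (V (cotChart φ P))) h).symm
  rw [hI] at h3
  exact h3

lemma mfderiv_cotChartInv_mvfderiv (hφ : φ ∈ IsManifold.maximalAtlas (𝓡 n) ∞ M)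
    (hP : P.proj ∈ φ.source) (X : TangentSpace (TI n) P) :
    (mfderiv 𝓘(ℝ, Coord n × Coord n) (TI n) (cotChartInv φ) (cotChart φ P)
      (mvfderiv (TI n) (cotChart φ) P X) : Coord n × (Coord n →L[ℝ] ℝ)) = X := by
  have hz : (cotChart φ P).1 ∈ φ.target := φ.map_source hP
  have h := mfderiv_comp P (mdifferentiableAt_cotChartInv hφ hz) (mdifferentiableAt_cotChart hφ hP)
  have h2 : mfderiv (TI n) (TI n) (cotChartInv φ ∘ cotChart φ) P = mfderiv (TI n) (TI n) id P := by
    apply Filter.EventuallyEq.mfderiv_eq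
    filter_upwards [eventually_proj_mem hP] with Q hQ using cotChartInv_cotChart hφ hQ
  rw [h2, mfderiv_id] at h
  exact (congrArg (fun L => L X) h).symm

lemma mvfderiv_cotChart_injective (hφ : φ ∈ IsManifold.maximalAtlas (𝓡 n) ∞ M)
    (hP : P.proj ∈ φ.source) : Function.Injective (mvfderiv (TI n) (cotChart φ) P) := by
  intro X Y h
  have h1 := mfderiv_cotChartInv_mvfderiv hφ hP X
  have h2 := mfderiv_cotChartInv_mvfderiv hφ hP Y
  rw [h] at h1
  exact h1.symm.trans h2

/-- The differential of the induced chart as a continuous linear equivalence. -/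
noncomputable def dcotEquiv (hφ : φ ∈ IsManifold.maximalAtlas (𝓡 n) ∞ M)
    (hP : P.proj ∈ φ.source) : TangentSpace (TI n) P ≃L[ℝ] Coord n × Coord n :=
  ContinuousLinearEquiv.equivOfInverse (mvfderiv (TI n) (cotChart φ) P)
    (show Coord n × Coord n →L[ℝ] Coord n × (Coord n →L[ℝ] ℝ) from
      mfderiv 𝓘(ℝ, Coord n × Coord n) (TI n) (cotChartInv φ) (cotChart φ P))
    (fun X => mfderiv_cotChartInv_mvfderiv hφ hP X)
    (fun v => mvfderiv_cotChart_liftField hφ hP fun _ => v)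

/-- A field given by its components is the pullback of these components by the induced chart.
Naturality of the Lie bracket under pullback then reduces brackets on the cotangent bundle to `ℝⁿ ×
ℝⁿ`. -/
lemma mpullback_cotChart (hφ : φ ∈ IsManifold.maximalAtlas (𝓡 n) ∞ M)
    (hP : P.proj ∈ φ.source) (V : Coord n × Coord n → Coord n × Coord n) :
    VectorField.mpullback (TI n) 𝓘(ℝ, Coord n × Coord n) (cotChart φ) V P = liftField φ V P := by
  -- `mpullback` is defined through `ContinuousLinearMap.inverse`, which is the true inverse because
  -- the differential is an equivalence.
  exact congrArg (fun L => L (V (cotChart φ P)))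
    (ContinuousLinearMap.inverse_equiv (dcotEquiv hφ hP))

lemma eventuallyEq_mpullback_cotChart (hφ : φ ∈ IsManifold.maximalAtlas (𝓡 n) ∞ M)
    (hP : P.proj ∈ φ.source) (V : Coord n × Coord n → Coord n × Coord n) :
    liftField φ V =ᶠ[𝓝 P]
      VectorField.mpullback (TI n) 𝓘(ℝ, Coord n × Coord n) (cotChart φ) V := by
  filter_upwards [eventually_proj_mem hP] with Q hQ using (mpullback_cotChart hφ hQ V).symm

lemma mdifferentiableAt_of_vectorField {E : Type*} [NormedAddCommGroup E] [NormedSpace ℝ E]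
    {V : E → E} {z : E} (hV : ContDiffAt ℝ ∞ V z) :
    MDifferentiableAt 𝓘(ℝ, E) 𝓘(ℝ, E).tangent
      (fun w => (⟨w, V w⟩ : TangentBundle 𝓘(ℝ, E) E)) z :=
  (contMDiffAt_vectorSpace_iff_contDiffAt.2 hV).mdifferentiableAt (by simp)

lemma vfDiffAt_liftField (hφ : φ ∈ IsManifold.maximalAtlas (𝓡 n) ∞ M)
    (hP : P.proj ∈ φ.source) {V : Coord n × Coord n → Coord n × Coord n}
    (hV : ContDiffAt ℝ ∞ V (cotChart φ P)) : VFDiffAt (liftField φ V) P := by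
  have h1 := MDifferentiableAt.mpullback_vectorField (I := TI n) (x₀ := P)
    (mdifferentiableAt_of_vectorField hV) (contMDiffAt_cotChart hφ hP)
    ⟨dcotEquiv hφ hP, rfl⟩ (by simpa using (WithTop.coe_le_coe.2 le_top : ((2 : ℕ∞) : ℕ∞ω) ≤ ∞))
  refine h1.congr_of_eventuallyEq ?_
  filter_upwards [eventuallyEq_mpullback_cotChart hφ hP V] with Q hQ
  rw [hQ]

lemma mlieBracket_eq_lieBracket {E : Type*} [NormedAddCommGroup E] [NormedSpace ℝ E]
    (V W : Π x : E, TangentSpace 𝓘(ℝ, E) x) :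
    VectorField.mlieBracket 𝓘(ℝ, E) V W = VectorField.lieBracket ℝ V W := by
  rw [← VectorField.mlieBracketWithin_univ, VectorField.mlieBracketWithin_eq_lieBracketWithin]
  exact VectorField.lieBracketWithin_univ

lemma mlieBracket_liftField (hφ : φ ∈ IsManifold.maximalAtlas (𝓡 n) ∞ M)
    (hP : P.proj ∈ φ.source) {V W : Coord n × Coord n → Coord n × Coord n}
    (hV : ContDiffAt ℝ ∞ V (cotChart φ P)) (hW : ContDiffAt ℝ ∞ W (cotChart φ P)) :
    VectorField.mlieBracket (TI n) (liftField φ V) (liftField φ W) P =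
      liftField φ (VectorField.lieBracket ℝ V W) P := by
  rw [(eventuallyEq_mpullback_cotChart hφ hP V).mlieBracket_vectorField_eq
    (eventuallyEq_mpullback_cotChart hφ hP W)]
  rw [← VectorField.mpullback_mlieBracket (n := ∞)
    (mdifferentiableAt_of_vectorField hV)
    (mdifferentiableAt_of_vectorField hW) (contMDiffAt_cotChart hφ hP)
    (by simpa using (WithTop.coe_le_coe.2 le_top : ((2 : ℕ∞) : ℕ∞ω) ≤ ∞))]
  have h := mlieBracket_eq_lieBracket (E := Coord n × Coord n) V W
  have h1 : ∀ Z, Z = VectorField.lieBracket ℝ V W → VectorField.mpullback (TI n)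
      𝓘(ℝ, Coord n × Coord n) (cotChart φ) Z P = liftField φ (VectorField.lieBracket ℝ V W) P := by
    rintro _ rfl
    exact mpullback_cotChart hφ hP _
  exact h1 _ h

lemma mvfderiv_liftField (hφ : φ ∈ IsManifold.maximalAtlas (𝓡 n) ∞ M)
    (hP : P.proj ∈ φ.source) {F : TStar n M → ℝ} {f : Coord n × Coord n → ℝ}
    (hF : F =ᶠ[𝓝 P] f ∘ cotChart φ) (hf : DifferentiableAt ℝ f (cotChart φ P))
    (V : Coord n × Coord n → Coord n × Coord n) :
    mvfderiv (TI n) F P (liftField φ V P) = fderiv ℝ f (cotChart φ P) (V (cotChart φ P)) := by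
  have h1 : mfderiv (TI n) 𝓘(ℝ, ℝ) F P = mfderiv (TI n) 𝓘(ℝ, ℝ) (f ∘ cotChart φ) P :=
    hF.mfderiv_eq
  have h2 := mfderiv_comp P hf.mdifferentiableAt (mdifferentiableAt_cotChart hφ hP)
  have h3 := mvfderiv_cotChart_liftField hφ hP V
  have h4 : mvfderiv (TI n) F P (liftField φ V P) =
      mfderiv (TI n) 𝓘(ℝ, ℝ) F P (liftField φ V P) := rfl
  rw [h4, h1, h2, mfderiv_eq_fderiv, ← h3]
  rfl

end Lift

/-! ### The natural metric and the adapted frame -/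

section Frame

variable {n : ℕ} {M : Type*} [TopologicalSpace M] [ChartedSpace (Coord n) M]
  [IsManifold (𝓡 n) ∞ M] {φ ψ : LocalChart n M} {P : TStar n M} (g : RMetric n M)

lemma trans_proj (hP : P.proj ∈ φ.source) : trans φ ψ (φ P.proj) = ψ P.proj := by
  simp [trans, φ.left_inv hP]

/-- The vector obtained by raising the index of a covector. -/
noncomputable def sharp (φ : LocalChart n M) (y : Coord n) (α : Coord n) : Coord n :=
  WithLp.toLp 2 fun i => ∑ j, gUp g φ y i j * α j

lemma sharp_apply (φ : LocalChart n M) (y α : Coord n) (i : Fin n) :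
    sharp g φ y α i = ∑ j, gUp g φ y i j * α j := rfl

/-- With nondegeneracy this characterizes `sharp` without reference to the inverse matrix; the
transformation law and the derivative of raised covectors both follow from it. -/
lemma gForm_sharp (hφ : φ ∈ IsManifold.maximalAtlas (𝓡 n) ∞ M) {y : Coord n}
    (hy : y ∈ φ.target) (α u : Coord n) : gForm g φ y (sharp g φ y α) u = pair α u := by
  rw [gForm_symm, gForm_apply, pair_apply, Finset.sum_comm]
  simp only [sharp_apply, Finset.mul_sum]
  have h1 : ∀ i k, ∑ j, gLow g φ y i j * gUp g φ y j k = kron i k := fun i k => by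
    have := congrFun (congrFun (gMat_mul_gInv g hφ hy) i) k
    simpa [Matrix.mul_apply, Matrix.one_apply, kron] using this
  calc _ = ∑ j, ∑ i, ∑ k, gLow g φ y i j * gUp g φ y j k * (u i * α k) :=
        Finset.sum_congr rfl fun j _ => Finset.sum_congr rfl fun i _ =>
          Finset.sum_congr rfl fun k _ => by ring
    _ = ∑ i, ∑ k, ∑ j, gLow g φ y i j * gUp g φ y j k * (u i * α k) := by
        rw [Finset.sum_comm]
        exact Finset.sum_congr rfl fun i _ => Finset.sum_comm
    _ = _ := by
        simp only [← Finset.sum_mul, h1]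
        simp [kron, mul_comm]

lemma pair_sharp (φ : LocalChart n M) (y α β : Coord n) :
    pair α (sharp g φ y β) = ∑ i, ∑ j, gUp g φ y i j * α i * β j := by
  simp only [pair_apply, sharp_apply, Finset.mul_sum]
  exact Finset.sum_congr rfl fun i _ => Finset.sum_congr rfl fun j _ => by ring

lemma g0_eq (φ : LocalChart n M) (y p : Coord n) (i : Fin n) :
    g0 g φ y p i = sharp g φ y p i := by
  simp only [g0, sharp_apply]
  exact Finset.sum_congr rfl fun j _ => by rw [gUp_symm]; ring

lemma energy_eq (φ : LocalChart n M) (y p : Coord n) :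
    energy g φ y p = (1 / 2) * pair p (sharp g φ y p) := by
  rw [pair_sharp]; rfl

/-- The coefficients of the metric are controlled only on `[0, ∞)`; this places every value of `t`
there. -/
lemma energy_nonneg (hφ : φ ∈ IsManifold.maximalAtlas (𝓡 n) ∞ M) {y : Coord n}
    (hy : y ∈ φ.target) (p : Coord n) : 0 ≤ energy g φ y p := by
  rw [energy_eq, ← gForm_sharp g hφ hy]
  by_cases h : sharp g φ y p = 0
  · simp [h]
  · have := gForm_pos g hφ hy h
    positivity

lemma sharp_trans (hφ : φ ∈ IsManifold.maximalAtlas (𝓡 n) ∞ M)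
    (hψ : ψ ∈ IsManifold.maximalAtlas (𝓡 n) ∞ M) {y : Coord n} (hy : y ∈ overlap φ ψ)
    {α α' : Coord n} (h : ∀ u, pair α' (fderiv ℝ (trans φ ψ) y u) = pair α u) :
    sharp g ψ (trans φ ψ y) α' = fderiv ℝ (trans φ ψ) y (sharp g φ y α) := by
  refine (isCoordMetric g hψ).ext (mapsTo_trans φ ψ hy) fun w => ?_
  obtain ⟨u, rfl⟩ := surjective_fderiv_trans hφ hψ hy w
  rw [gForm_sharp g hψ (mapsTo_trans φ ψ hy), ← gForm_trans g hφ hψ hy, gForm_sharp g hφ hy.1, h]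

lemma energy_trans (hφ : φ ∈ IsManifold.maximalAtlas (𝓡 n) ∞ M)
    (hψ : ψ ∈ IsManifold.maximalAtlas (𝓡 n) ∞ M) (hP : P.proj ∈ φ.source)
    (hP' : P.proj ∈ ψ.source) :
    energy g ψ (cotChart ψ P).1 (cotChart ψ P).2 = energy g φ (cotChart φ P).1 (cotChart φ P).2 := by
  have h := sharp_trans g hφ hψ (mem_overlap hP hP') (pair_trans hφ hψ hP hP')
  rw [trans_proj hP] at h
  change energy g ψ (ψ P.proj) _ = energy g φ (φ P.proj) _
  rw [energy_eq, energy_eq, h, pair_trans hφ hψ hP hP']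

lemma Gam0_eq (φ : LocalChart n M) (y p : Coord n) (i j : Fin n) :
    Gam0 g φ y p i j = pair p (gamForm g φ y (stdVec i) (stdVec j)) := by
  simp [Gam0, pair_apply, gamForm_std]

/-- The components of the tangent vector `X` in the induced chart. -/
noncomputable abbrev comp (φ : LocalChart n M) (P : TStar n M) (X : TangentSpace (TI n) P) :
    Coord n × Coord n := mvfderiv (TI n) (cotChart φ) P X

/-- The covector with components `Dp_i(X)`. -/
noncomputable def vertForm (φ : LocalChart n M) (P : TStar n M) (X : TangentSpace (TI n) P) :
    Coord n := WithLp.toLp 2 fun i => formDp g φ i P X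

lemma pair_vertForm (φ : LocalChart n M) (P : TStar n M) (X : TangentSpace (TI n) P)
    (u : Coord n) : pair (vertForm g φ P X) u = pair (comp φ P X).2 u -
      pair (cotChart φ P).2 (gamForm g φ (φ P.proj) u (comp φ P X).1) := by
  have h1 : ∀ i, formDp g φ i P X = pair (comp φ P X).2 (stdVec i) -
      pair (cotChart φ P).2 (gamForm g φ (φ P.proj) (stdVec i) (comp φ P X).1) := by
    intro i
    rw [pair_std]
    conv_rhs => rw [← sum_smul_stdVec (comp φ P X).1]
    simp only [map_sum, map_smul, smul_eq_mul]
    change _ - _ = _ - _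
    congr 1
    exact Finset.sum_congr rfl fun j _ => by rw [Gam0_eq, mul_comm]; rfl
  conv_rhs => rw [← sum_smul_stdVec u]
  rw [pair_apply]
  simp only [map_sum, map_smul, smul_eq_mul, sum_apply, smul_apply, ← Finset.sum_sub_distrib,
    ← mul_sub, ← h1]
  exact Finset.sum_congr rfl fun i _ => mul_comm _ _

lemma differentiableAt_cotChart_cotChartInv (hφ : φ ∈ IsManifold.maximalAtlas (𝓡 n) ∞ M)
    (hψ : ψ ∈ IsManifold.maximalAtlas (𝓡 n) ∞ M) (hP : P.proj ∈ φ.source)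
    (hP' : P.proj ∈ ψ.source) :
    DifferentiableAt ℝ (cotChart ψ ∘ cotChartInv φ) (cotChart φ P) := by
  have hI := cotChartInv_cotChart hφ hP
  have h1 := mdifferentiableAt_cotChartInv (z := cotChart φ P) hφ (φ.map_source hP)
  exact (MDifferentiableAt.comp_of_eq (x := cotChart φ P) (mdifferentiableAt_cotChart hψ hP')
    h1 hI).differentiableAt

lemma fderiv_cotChart_cotChartInv (hφ : φ ∈ IsManifold.maximalAtlas (𝓡 n) ∞ M)
    (hψ : ψ ∈ IsManifold.maximalAtlas (𝓡 n) ∞ M) (hP : P.proj ∈ φ.source)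
    (hP' : P.proj ∈ ψ.source) (X : TangentSpace (TI n) P) :
    fderiv ℝ (cotChart ψ ∘ cotChartInv φ) (cotChart φ P) (comp φ P X) = comp ψ P X := by
  have h := mfderiv_comp P
    (differentiableAt_cotChart_cotChartInv hφ hψ hP hP').mdifferentiableAt
    (mdifferentiableAt_cotChart hφ hP)
  have h2 : mfderiv (TI n) 𝓘(ℝ, Coord n × Coord n) ((cotChart ψ ∘ cotChartInv φ) ∘ cotChart φ) P =
      mfderiv (TI n) 𝓘(ℝ, Coord n × Coord n) (cotChart ψ) P := by
    apply Filter.EventuallyEq.mfderiv_eq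
    filter_upwards [eventually_proj_mem hP] with Q hQ
    simp only [Function.comp, cotChartInv_cotChart hφ hQ]
  rw [h2, mfderiv_eq_fderiv] at h
  exact (congrArg (fun L => L X) h).symm

/-- The momentum part differentiates the implicit relation `p'(DF(q) u) = p(u)`, so that only `F`,
and not its inverse, is differentiated. -/
lemma comp_trans (hφ : φ ∈ IsManifold.maximalAtlas (𝓡 n) ∞ M)
    (hψ : ψ ∈ IsManifold.maximalAtlas (𝓡 n) ∞ M) (hP : P.proj ∈ φ.source)
    (hP' : P.proj ∈ ψ.source) (X : TangentSpace (TI n) P) :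
    (comp ψ P X).1 = fderiv ℝ (trans φ ψ) (φ P.proj) (comp φ P X).1 ∧
    ∀ u, pair (comp φ P X).2 u =
      pair (comp ψ P X).2 (fderiv ℝ (trans φ ψ) (φ P.proj) u) +
      pair (cotChart ψ P).2 (fderiv ℝ (fderiv ℝ (trans φ ψ)) (φ P.proj) (comp φ P X).1 u) := by
  have hΘ := (differentiableAt_cotChart_cotChartInv hφ hψ hP hP').hasFDerivAt
  have hX := fderiv_cotChart_cotChartInv hφ hψ hP hP' X
  have hov := mem_overlap hP hP'
  have hF := contDiffOn_trans hφ hψ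
  have hFd := (differentiableAt_of_smooth hF (isOpen_overlap φ ψ) hov).hasFDerivAt
  have hdF := (differentiableAt_of_smooth (contDiffOn_fderiv_of_smooth hF (isOpen_overlap φ ψ))
    (isOpen_overlap φ ψ) hov).hasFDerivAt
  have ev : ∀ᶠ z : Coord n × Coord n in 𝓝 (cotChart φ P), z.1 ∈ overlap φ ψ :=
    continuousAt_fst.eventually ((isOpen_overlap φ ψ).mem_nhds hov)
  have hI := cotChartInv_cotChart hφ hP
  constructor
  · have a1 := HasFDerivAt.comp (g := trans φ ψ) (f := Prod.fst) (cotChart φ P) hFd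
      hasFDerivAt_fst
    have a2 := hasFDerivAt_fst.comp (cotChart φ P) hΘ
    have a3 := congrArg (fun L => L (comp φ P X)) (a2.unique (a1.congr_of_eventuallyEq
      
      (Eventually.of_forall fun z => rfl)))
    simpa [hX] using a3
  · intro u
    -- The derivative of the left side `p'(DF(q) u)` along the transition of induced charts; `b2` is
    -- that of the right side `p(u)`.
    have b1 := (pair.hasFDerivAt.comp (cotChart φ P) (hasFDerivAt_snd.comp _ hΘ)).clm_apply
      (HasFDerivAt.comp (g := fun q => fderiv ℝ (trans φ ψ) q u) (cotChart φ P)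
        (hdF.clm_apply (hasFDerivAt_const u _)) hasFDerivAt_fst)
    have b2 := (pair.hasFDerivAt.comp (cotChart φ P)
      (hasFDerivAt_snd (𝕜 := ℝ) (E := Coord n))).clm_apply (hasFDerivAt_const u _)
    have b3 := congrArg (fun L => L (comp φ P X)) (b2.unique (b1.congr_of_eventuallyEq (by
      filter_upwards [ev] with z hz
      have h := pair_trans (P := cotChartInv φ z) hφ hψ (φ.map_target hz.1) hz.2 u
      rw [cotChart_cotChartInv hφ hz.1] at h
      have h1 : φ (cotChartInv φ z).proj = z.1 := φ.right_inv hz.1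
      rw [h1] at h
      exact h.symm)))
    simp [hX, hI] at b3
    rw [b3, add_comm]
    rfl

/-- `Dp` transforms as a covector: the Hessian of the transition map coming from `dp` equals the one
in the law for Γ, and the two cancel. -/
lemma pair_vertForm_trans (hφ : φ ∈ IsManifold.maximalAtlas (𝓡 n) ∞ M)
    (hψ : ψ ∈ IsManifold.maximalAtlas (𝓡 n) ∞ M) (hP : P.proj ∈ φ.source)
    (hP' : P.proj ∈ ψ.source) (X : TangentSpace (TI n) P) (u : Coord n) :
    pair (vertForm g ψ P X) (fderiv ℝ (trans φ ψ) (φ P.proj) u) = pair (vertForm g φ P X) u := by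
  obtain ⟨h1, h2⟩ := comp_trans hφ hψ hP hP' X
  have hov := mem_overlap hP hP'
  have h3 := gamForm_trans g hφ hψ hov u (comp φ P X).1
  have h4 := fderiv_fderiv_symm_of_smooth (contDiffOn_trans hφ hψ) (isOpen_overlap φ ψ) hov
    (comp φ P X).1 u
  rw [pair_vertForm, pair_vertForm, h2, ← pair_trans hφ hψ hP hP', h3, h1, h4, trans_proj hP,
    map_add]
  ring

variable (C : DiagCoeffs)

/-- In this form each of the four summands is a product of quantities already known to be
independent of the chart. -/
lemma metricInChart_eq (φ : LocalChart n M) (P : TStar n M) (X Y : TangentSpace (TI n) P) :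
    metricInChart g C φ P X Y =
      C.c₁ (energy g φ (cotChart φ P).1 (cotChart φ P).2) *
        gForm g φ (φ P.proj) (comp φ P X).1 (comp φ P Y).1 +
      C.d₁ (energy g φ (cotChart φ P).1 (cotChart φ P).2) *
        (pair (cotChart φ P).2 (comp φ P X).1 * pair (cotChart φ P).2 (comp φ P Y).1) +
      C.c₂ (energy g φ (cotChart φ P).1 (cotChart φ P).2) *
        pair (vertForm g φ P X) (sharp g φ (φ P.proj) (vertForm g φ P Y)) +
      C.d₂ (energy g φ (cotChart φ P).1 (cotChart φ P).2) *
        (pair (vertForm g φ P X) (sharp g φ (φ P.proj) (cotChart φ P).2) *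
          pair (vertForm g φ P Y) (sharp g φ (φ P.proj) (cotChart φ P).2)) := by
  rw [pair_sharp, gForm_apply]
  simp only [pair_apply, ← g0_eq, metricInChart, G1, G2, Finset.sum_mul_sum]
  simp only [Finset.mul_sum, ← Finset.sum_add_distrib]
  refine Finset.sum_congr rfl fun i _ => Finset.sum_congr rfl fun j _ => ?_
  simp only [vertForm, formdq]
  change _ = C.c₁ _ * (gLow g φ (cotChart φ P).1 i j * _ * _) + _ +
    C.c₂ _ * (gUp g φ (cotChart φ P).1 i j * _ * _) + C.d₂ _ * (_ * g0 g φ (cotChart φ P).1 _ _ *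
      (_ * g0 g φ (cotChart φ P).1 _ _))
  ring

lemma metricInChart_trans (hφ : φ ∈ IsManifold.maximalAtlas (𝓡 n) ∞ M)
    (hψ : ψ ∈ IsManifold.maximalAtlas (𝓡 n) ∞ M) (hP : P.proj ∈ φ.source)
    (hP' : P.proj ∈ ψ.source) (X Y : TangentSpace (TI n) P) :
    metricInChart g C ψ P X Y = metricInChart g C φ P X Y := by
  have hov := mem_overlap hP hP'
  have s := fun {α α' : Coord n}
    (h : ∀ u, pair α' (fderiv ℝ (trans φ ψ) (φ P.proj) u) = pair α u) => sharp_trans g hφ hψ hov h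
  rw [trans_proj hP] at s
  rw [metricInChart_eq, metricInChart_eq, energy_trans g hφ hψ hP hP',
    (comp_trans hφ hψ hP hP' X).1, (comp_trans hφ hψ hP hP' Y).1, pair_trans hφ hψ hP hP',
    pair_trans hφ hψ hP hP', s (pair_trans hφ hψ hP hP'),
    s (pair_vertForm_trans g hφ hψ hP hP' Y), pair_vertForm_trans g hφ hψ hP hP',
    pair_vertForm_trans g hφ hψ hP hP', pair_vertForm_trans g hφ hψ hP hP',
    ← trans_proj (ψ := ψ) hP, ← gForm_trans g hφ hψ hov]

lemma naturalMetric_eq (hφ : φ ∈ IsManifold.maximalAtlas (𝓡 n) ∞ M) (hP : P.proj ∈ φ.source)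
    (X Y : TangentSpace (TI n) P) : naturalMetric g C P X Y = metricInChart g C φ P X Y :=
  metricInChart_trans g C hφ (IsManifold.chart_mem_maximalAtlas P.proj) hP
    (mem_chart_source _ _) X Y

end Frame

/-! ### Calculus on the cotangent bundle in induced coordinates -/

section Calculus

variable {n : ℕ} {M : Type*} [TopologicalSpace M] [ChartedSpace (Coord n) M]
  [IsManifold (𝓡 n) ∞ M] {φ : LocalChart n M} (g : RMetric n M)

/-- The domain of the induced coordinates. -/
def cotDomain (φ : LocalChart n M) : Set (Coord n × Coord n) := φ.target ×ˢ univ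

lemma isOpen_cotDomain (φ : LocalChart n M) : IsOpen (cotDomain φ) :=
  φ.open_target.prod isOpen_univ

lemma mem_cotDomain {z : Coord n × Coord n} : z ∈ cotDomain φ ↔ z.1 ∈ φ.target := by
  simp [cotDomain]

lemma contDiffOn_comp_fst {F : Type*} [NormedAddCommGroup F] [NormedSpace ℝ F] {f : Coord n → F}
    (hf : ContDiffOn ℝ ∞ f φ.target) :
    ContDiffOn ℝ ∞ (fun z : Coord n × Coord n => f z.1) (cotDomain φ) :=
  hf.comp contDiff_fst.contDiffOn fun _ hz => mem_cotDomain.1 hz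

lemma contDiffOn_momentum (i : Fin n) :
    ContDiffOn ℝ ∞ (fun z : Coord n × Coord n => z.2 i) (cotDomain φ) := by
  fun_prop

lemma contDiffOn_sharp (hφ : φ ∈ IsManifold.maximalAtlas (𝓡 n) ∞ M)
    {α : Coord n × Coord n → Coord n} (hα : ContDiffOn ℝ ∞ α (cotDomain φ)) :
    ContDiffOn ℝ ∞ (fun z => sharp g φ z.1 (α z)) (cotDomain φ) := by
  rw [contDiffOn_euclidean]
  intro i
  simp only [sharp_apply]
  exact ContDiffOn.sum fun j _ => (contDiffOn_comp_fst (contDiffOn_gUp g hφ i j)).mul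
    (contDiffOn_euclidean.1 hα j)

lemma contDiffOn_g0 (hφ : φ ∈ IsManifold.maximalAtlas (𝓡 n) ∞ M) (i : Fin n) :
    ContDiffOn ℝ ∞ (fun z : Coord n × Coord n => g0 g φ z.1 z.2 i) (cotDomain φ) := by
  simp only [g0_eq]
  exact contDiffOn_euclidean.1 (contDiffOn_sharp g hφ contDiff_snd.contDiffOn) i

lemma contDiffOn_energy (hφ : φ ∈ IsManifold.maximalAtlas (𝓡 n) ∞ M) :
    ContDiffOn ℝ ∞ (fun z : Coord n × Coord n => energy g φ z.1 z.2) (cotDomain φ) := by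
  refine contDiffOn_const.mul (ContDiffOn.sum fun i _ => ContDiffOn.sum fun j _ => ?_)
  exact ((contDiffOn_comp_fst (contDiffOn_gUp g hφ i j)).mul (contDiffOn_momentum i)).mul
    (contDiffOn_momentum j)

lemma mapsTo_energy (hφ : φ ∈ IsManifold.maximalAtlas (𝓡 n) ∞ M) :
    MapsTo (fun z : Coord n × Coord n => energy g φ z.1 z.2) (cotDomain φ) (Ici 0) :=
  fun _ hz => energy_nonneg g hφ (mem_cotDomain.1 hz) _

/-- Smoothness holds across the zero section too, where `t` meets the boundary of `[0, ∞)`: `t` is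
smooth and never leaves that half-line. -/
lemma contDiffOn_comp_energy (hφ : φ ∈ IsManifold.maximalAtlas (𝓡 n) ∞ M) {c : ℝ → ℝ}
    (hc : ContDiffOn ℝ ∞ c (Ici 0)) :
    ContDiffOn ℝ ∞ (fun z : Coord n × Coord n => c (energy g φ z.1 z.2)) (cotDomain φ) :=
  hc.comp (contDiffOn_energy g hφ) (mapsTo_energy g hφ)

lemma contDiffOn_deriv0 {c : ℝ → ℝ} (hc : ContDiffOn ℝ ∞ c (Ici 0)) :
    ContDiffOn ℝ ∞ (deriv0 c) (Ici 0) :=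
  hc.derivWithin (uniqueDiffOn_Ici 0) (by simp)

/-- A one-sided derivative of `c` at `0` suffices since `t` has values in `[0, ∞)`; the resulting
derivative within the domain is a full one because the domain is open. -/
lemma hasFDerivAt_comp_energy (hφ : φ ∈ IsManifold.maximalAtlas (𝓡 n) ∞ M) {c : ℝ → ℝ}
    (hc : ContDiffOn ℝ ∞ c (Ici 0)) {z : Coord n × Coord n} (hz : z ∈ cotDomain φ) :
    HasFDerivAt (fun z : Coord n × Coord n => c (energy g φ z.1 z.2))
      (deriv0 c (energy g φ z.1 z.2) •
        fderiv ℝ (fun z : Coord n × Coord n => energy g φ z.1 z.2) z) z := by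
  have h1 : HasDerivWithinAt c (deriv0 c (energy g φ z.1 z.2)) (Ici 0) (energy g φ z.1 z.2) :=
    (hc.differentiableOn (by simp) _ (mapsTo_energy g hφ hz)).hasDerivWithinAt
  have h2 := (differentiableAt_of_smooth (contDiffOn_energy g hφ) (isOpen_cotDomain φ)
    hz).hasFDerivAt.hasFDerivWithinAt (s := cotDomain φ)
  exact (h1.comp_hasFDerivWithinAt z h2 (mapsTo_energy g hφ)).hasFDerivAt
    ((isOpen_cotDomain φ).mem_nhds hz)

lemma fderiv_vert {f : Coord n → Coord n → ℝ} {z : Coord n × Coord n}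
    (hf : DifferentiableAt ℝ (fun w : Coord n × Coord n => f w.1 w.2) z) (i : Fin n) :
    fderiv ℝ (fun w : Coord n × Coord n => f w.1 w.2) z (0, stdVec i) = vderiv i f z.1 z.2 := by
  have h := HasFDerivAt.comp (g := fun w : Coord n × Coord n => f w.1 w.2) (f := fun p => (z.1, p))
    z.2 hf.hasFDerivAt (hasFDerivAt_prodMk_right z.1 z.2)
  exact (congrArg (fun L => L (stdVec i)) h.fderiv).symm

/-! Contractions of the metric with the momentum. -/

lemma sum_gUp_mul_momentum (φ : LocalChart n M) (y p : Coord n) (i : Fin n) :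
    ∑ k, gUp g φ y i k * p k = g0 g φ y p i := by
  rw [g0_eq, sharp_apply]

lemma sum_gLow_mul_g0 (hφ : φ ∈ IsManifold.maximalAtlas (𝓡 n) ∞ M) {y : Coord n}
    (hy : y ∈ φ.target) (p : Coord n) (i : Fin n) :
    ∑ k, gLow g φ y i k * g0 g φ y p k = p i := by
  have h := gForm_sharp g hφ hy p (stdVec i)
  rw [pair_std, gForm_symm, gForm_apply] at h
  rw [← h]
  simp [stdVec_apply, g0_eq]

lemma sum_momentum_mul_g0 (φ : LocalChart n M) (y p : Coord n) :
    ∑ k, p k * g0 g φ y p k = 2 * energy g φ y p := by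
  simp only [energy_eq, g0_eq, pair_apply]
  ring

lemma sum_gLow_mul_gUp (hφ : φ ∈ IsManifold.maximalAtlas (𝓡 n) ∞ M) {y : Coord n}
    (hy : y ∈ φ.target) (i j : Fin n) : ∑ k, gLow g φ y i k * gUp g φ y k j = kron i j := by
  have := congrFun (congrFun (gMat_mul_gInv g hφ hy) i) j
  simpa [Matrix.mul_apply, Matrix.one_apply, kron] using this

/-! The coefficients of the metric. -/

variable {C : DiagCoeffs} (hC : C.Admissible)
include hC

lemma contDiffOn_G1 (hφ : φ ∈ IsManifold.maximalAtlas (𝓡 n) ∞ M) (i j : Fin n) :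
    ContDiffOn ℝ ∞ (fun z : Coord n × Coord n => G1 g C φ z.1 z.2 i j) (cotDomain φ) :=
  ((contDiffOn_comp_energy g hφ hC.smooth_c₁).mul (contDiffOn_comp_fst
    (contDiffOn_gLow g hφ i j))).add (((contDiffOn_comp_energy g hφ hC.smooth_d₁).mul
    (contDiffOn_momentum i)).mul (contDiffOn_momentum j))

lemma contDiffOn_G2 (hφ : φ ∈ IsManifold.maximalAtlas (𝓡 n) ∞ M) (i j : Fin n) :
    ContDiffOn ℝ ∞ (fun z : Coord n × Coord n => G2 g C φ z.1 z.2 i j) (cotDomain φ) :=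
  ((contDiffOn_comp_energy g hφ hC.smooth_c₂).mul (contDiffOn_comp_fst
    (contDiffOn_gUp g hφ i j))).add (((contDiffOn_comp_energy g hφ hC.smooth_d₂).mul
    (contDiffOn_g0 g hφ i)).mul (contDiffOn_g0 g hφ j))

/-- Sherman–Morrison for the rank-one perturbation `c₁ g + d₁ p ⊗ p`, using that `p` has squared
length `2t`. -/
lemma sum_H1_mul_G1 (hφ : φ ∈ IsManifold.maximalAtlas (𝓡 n) ∞ M) {y : Coord n}
    (hy : y ∈ φ.target) (p : Coord n) (h i : Fin n) :
    ∑ k, H1 g C φ y p h k * G1 g C φ y p k i = kron h i := by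
  have ht := energy_nonneg g hφ hy p
  have hc := hC.pos_c₁ _ ht
  have hd := (hC.pos_d₁ _ ht).ne'
  have e1 := sum_gUp_mul_gLow g hφ hy h i
  have e2 := sum_gUp_mul_momentum g φ y p h
  have e3 := sum_gLow_mul_g0 g hφ hy p i
  have e4 := sum_momentum_mul_g0 g φ y p
  simp only [H1, G1]
  set t := energy g φ y p
  have key : ∀ k, (1 / C.c₁ t * gUp g φ y h k - C.d₁ t / (C.c₁ t * (C.c₁ t + 2 * t * C.d₁ t)) *
      g0 g φ y p h * g0 g φ y p k) * (C.c₁ t * gLow g φ y k i + C.d₁ t * p k * p i) =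
      gUp g φ y h k * gLow g φ y k i + C.d₁ t / C.c₁ t * p i * (gUp g φ y h k * p k)
      - C.d₁ t / (C.c₁ t + 2 * t * C.d₁ t) * g0 g φ y p h * (gLow g φ y i k * g0 g φ y p k)
      - C.d₁ t / (C.c₁ t * (C.c₁ t + 2 * t * C.d₁ t)) * C.d₁ t * g0 g φ y p h * p i *
        (p k * g0 g φ y p k) := fun k => by
    rw [gLow_symm g φ y i k]
    field_simp
    ring
  simp only [key, Finset.sum_add_distrib, Finset.sum_sub_distrib, ← Finset.mul_sum, e1, e2, e3, e4]
  -- The denominator becomes an atom, and the only relation needed about it is `d₁ · 2t = K - c₁`.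
  obtain ⟨K, hK⟩ : ∃ K, K = C.c₁ t + 2 * t * C.d₁ t := ⟨_, rfl⟩
  rw [← hK] at hd ⊢
  have h2 : C.d₁ t * (2 * t) = K - C.c₁ t := by rw [hK]; ring
  have h3 : C.d₁ t / C.c₁ t - C.d₁ t / K - C.d₁ t / (C.c₁ t * K) * (C.d₁ t * (2 * t)) = 0 := by
    rw [h2]
    field_simp
    ring
  linear_combination (g0 g φ y p h * p i) * h3

lemma sum_H2_mul_G2 (hφ : φ ∈ IsManifold.maximalAtlas (𝓡 n) ∞ M) {y : Coord n}
    (hy : y ∈ φ.target) (p : Coord n) (h i : Fin n) :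
    ∑ k, H2 g C φ y p h k * G2 g C φ y p k i = kron h i := by
  have ht := energy_nonneg g hφ hy p
  have hc := hC.pos_c₂ _ ht
  have hd := (hC.pos_d₂ _ ht).ne'
  have e1 := sum_gLow_mul_gUp g hφ hy h i
  have e2 := sum_gLow_mul_g0 g hφ hy p h
  have e3 := sum_gUp_mul_momentum g φ y p i
  have e4 := sum_momentum_mul_g0 g φ y p
  simp only [H2, G2]
  set t := energy g φ y p
  have key : ∀ k, (1 / C.c₂ t * gLow g φ y h k - C.d₂ t / (C.c₂ t * (C.c₂ t + 2 * t * C.d₂ t)) *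
      p h * p k) * (C.c₂ t * gUp g φ y k i + C.d₂ t * g0 g φ y p k * g0 g φ y p i) =
      gLow g φ y h k * gUp g φ y k i + C.d₂ t / C.c₂ t * g0 g φ y p i *
        (gLow g φ y h k * g0 g φ y p k)
      - C.d₂ t / (C.c₂ t + 2 * t * C.d₂ t) * p h * (gUp g φ y i k * p k)
      - C.d₂ t / (C.c₂ t * (C.c₂ t + 2 * t * C.d₂ t)) * C.d₂ t * p h * g0 g φ y p i *
        (p k * g0 g φ y p k) := fun k => by
    rw [gUp_symm g φ y i k]
    field_simp
    ring
  simp only [key, Finset.sum_add_distrib, Finset.sum_sub_distrib, ← Finset.mul_sum, e1, e2, e3, e4]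
  obtain ⟨K, hK⟩ : ∃ K, K = C.c₂ t + 2 * t * C.d₂ t := ⟨_, rfl⟩
  rw [← hK] at hd ⊢
  have h2 : C.d₂ t * (2 * t) = K - C.c₂ t := by rw [hK]; ring
  have h3 : C.d₂ t / C.c₂ t - C.d₂ t / K - C.d₂ t / (C.c₂ t * K) * (C.d₂ t * (2 * t)) = 0 := by
    rw [h2]
    field_simp
    ring
  linear_combination (p h * g0 g φ y p i) * h3

end Calculus

/-! ### Horizontal derivatives -/

section Horizontal

variable {n : ℕ} {M : Type*} [TopologicalSpace M] [ChartedSpace (Coord n) M]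
  [IsManifold (𝓡 n) ∞ M] {φ : LocalChart n M} (g : RMetric n M)

/-- The components of `∂/∂p_i`. -/
noncomputable def vertVec (i : Fin n) (_ : Coord n × Coord n) : Coord n × Coord n := (0, stdVec i)

/-- The transpose of the Christoffel endomorphism `Γ(∂_k, ·)` applied to a covector. -/
noncomputable def gamTranspose (φ : LocalChart n M) (y : Coord n) (k : Fin n) (α : Coord n) :
    Coord n := WithLp.toLp 2 fun i => pair α (gamForm g φ y (stdVec k) (stdVec i))

lemma pair_gamTranspose (φ : LocalChart n M) (y : Coord n) (k : Fin n) (α u : Coord n) :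
    pair (gamTranspose g φ y k α) u = pair α (gamForm g φ y (stdVec k) u) := by
  conv_rhs => rw [← sum_smul_stdVec u]
  rw [pair_apply]
  simp only [map_sum, map_smul, smul_eq_mul]
  exact Finset.sum_congr rfl fun i _ => mul_comm _ _

/-- The components of `δ/δqᵏ`. -/
noncomputable def horVec (φ : LocalChart n M) (k : Fin n) (z : Coord n × Coord n) :
    Coord n × Coord n := (stdVec k, gamTranspose g φ z.1 k z.2)

lemma gamTranspose_apply (φ : LocalChart n M) (y p : Coord n) (k i : Fin n) :
    gamTranspose g φ y k p i = Gam0 g φ y p k i := by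
  rw [Gam0_eq]; rfl

lemma contDiffOn_horVec (hφ : φ ∈ IsManifold.maximalAtlas (𝓡 n) ∞ M) (k : Fin n) :
    ContDiffOn ℝ ∞ (horVec g φ k) (cotDomain φ) := by
  refine contDiffOn_const.prodMk (contDiffOn_euclidean.2 fun i => ?_)
  simp only [gamTranspose_apply, Gam0]
  exact ContDiffOn.sum fun j _ => (contDiffOn_momentum j).mul
    (contDiffOn_comp_fst (contDiffOn_Gam g hφ j k i))

/-- Horizontal covariant differentiation commutes with raising an index: differentiate `g(α♯, u) =
α(u)` along `δ/δqᵏ` and use `∇g = 0`. -/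
lemma fderiv_sharp_horVec (hφ : φ ∈ IsManifold.maximalAtlas (𝓡 n) ∞ M) {z : Coord n × Coord n}
    (hz : z ∈ cotDomain φ) {α : Coord n × Coord n → Coord n}
    (hα : ContDiffOn ℝ ∞ α (cotDomain φ)) (k : Fin n) :
    fderiv ℝ (fun w => sharp g φ w.1 (α w)) z (horVec g φ k z) =
      sharp g φ z.1 (fderiv ℝ α z (horVec g φ k z) - gamTranspose g φ z.1 k (α z))
        - gamForm g φ z.1 (stdVec k) (sharp g φ z.1 (α z)) := by
  have hy := mem_cotDomain.1 hz
  have hm := isCoordMetric g hφ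
  refine hm.ext hy fun u => ?_
  have h1 := (HasFDerivAt.comp (g := gForm g φ) (f := Prod.fst) z
    (differentiableAt_of_smooth hm.smooth hm.isOpen hy).hasFDerivAt hasFDerivAt_fst).clm_apply
    (differentiableAt_of_smooth (contDiffOn_sharp g hφ hα) (isOpen_cotDomain φ) hz).hasFDerivAt
  have h2 := h1.clm_apply (hasFDerivAt_const u z)
  have h3 := (pair.hasFDerivAt.comp z (differentiableAt_of_smooth hα (isOpen_cotDomain φ)
    hz).hasFDerivAt).clm_apply (hasFDerivAt_const u z)
  have h4 : (fun w : Coord n × Coord n => gForm g φ w.1 (sharp g φ w.1 (α w)) u) =ᶠ[𝓝 z]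
      fun w => pair (α w) u := by
    filter_upwards [(isOpen_cotDomain φ).mem_nhds hz] with w hw
      using gForm_sharp g hφ (mem_cotDomain.1 hw) _ _
  have h5 := congrArg (fun L => L (horVec g φ k z)) (h2.unique (h3.congr_of_eventuallyEq h4))
  simp at h5
  have h6 := hm.compat hy (stdVec k) (sharp g φ z.1 (α z)) u
  have h7 : (horVec g φ k z).1 = stdVec k := rfl
  rw [h7, h6, gForm_sharp g hφ hy] at h5
  simp only [map_sub, sub_apply, gForm_sharp g hφ hy, pair_gamTranspose]
  linarith

lemma fderiv_momentum (z v : Coord n × Coord n) :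
    fderiv ℝ (fun w : Coord n × Coord n => w.2) z v = v.2 := by
  rw [fderiv_snd]; rfl

/-- The momentum component of `δ/δqᵏ` is exactly the Christoffel term, so the momentum is parallel
along horizontal directions and only the Christoffel term of the raised vector survives. -/
lemma fderiv_sharp_momentum (hφ : φ ∈ IsManifold.maximalAtlas (𝓡 n) ∞ M) {z : Coord n × Coord n}
    (hz : z ∈ cotDomain φ) (k : Fin n) :
    fderiv ℝ (fun w : Coord n × Coord n => sharp g φ w.1 w.2) z (horVec g φ k z) =
      - gamForm g φ z.1 (stdVec k) (sharp g φ z.1 z.2) := by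
  rw [fderiv_sharp_horVec g hφ hz (α := fun w => w.2) contDiff_snd.contDiffOn, fderiv_momentum]
  have h : sharp g φ z.1 ((horVec g φ k z).2 - gamTranspose g φ z.1 k z.2) = 0 := by
    ext i
    simp [horVec, sharp_apply]
  rw [h, zero_sub]

/-- Parallel transport preserves length: the variations of `p` and of `p♯` contribute opposite
terms. -/
lemma fderiv_energy_horVec (hφ : φ ∈ IsManifold.maximalAtlas (𝓡 n) ∞ M) {z : Coord n × Coord n}
    (hz : z ∈ cotDomain φ) (k : Fin n) :
    fderiv ℝ (fun z : Coord n × Coord n => energy g φ z.1 z.2) z (horVec g φ k z) = 0 := by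
  have h1 := ((pair.hasFDerivAt.comp z (hasFDerivAt_snd (𝕜 := ℝ) (E := Coord n))).clm_apply
    (differentiableAt_of_smooth (contDiffOn_sharp g hφ contDiff_snd.contDiffOn)
      (isOpen_cotDomain φ) hz).hasFDerivAt).const_mul (1 / 2)
  have h2 := congrArg (fun L => L (horVec g φ k z)) h1.fderiv
  have h3 := gForm_sharp g hφ (mem_cotDomain.1 hz) z.2
  have h4 : pair (horVec g φ k z).2 (sharp g φ z.1 z.2) =
      pair z.2 (gamForm g φ z.1 (stdVec k) (sharp g φ z.1 z.2)) := pair_gamTranspose g φ _ _ _ _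
  simp only [energy_eq]
  refine h2.trans ?_
  simp [fderiv_sharp_momentum g hφ hz, h4]

variable {C : DiagCoeffs} (hC : C.Admissible)
include hC

omit hC in
lemma fderiv_gLow_horVec (hφ : φ ∈ IsManifold.maximalAtlas (𝓡 n) ∞ M) {z : Coord n × Coord n}
    (hz : z ∈ cotDomain φ) (k i j : Fin n) :
    HasFDerivAt (fun z : Coord n × Coord n => gLow g φ z.1 i j)
      (fderiv ℝ (fun z : Coord n × Coord n => gLow g φ z.1 i j) z) z ∧
    fderiv ℝ (fun z : Coord n × Coord n => gLow g φ z.1 i j) z (horVec g φ k z) =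
      ∑ l, (Gam g φ z.1 l k i * gLow g φ z.1 l j + Gam g φ z.1 l k j * gLow g φ z.1 i l) := by
  have hy := mem_cotDomain.1 hz
  have h0 := contDiffOn_gLow g hφ i j
  refine ⟨(differentiableAt_of_smooth (contDiffOn_comp_fst h0) (isOpen_cotDomain φ)
    hz).hasFDerivAt, ?_⟩
  have h1 := HasFDerivAt.comp (g := fun y => gLow g φ y i j) (f := Prod.fst) z
    (differentiableAt_of_smooth h0 φ.open_target hy).hasFDerivAt hasFDerivAt_fst
  have h2 := congrArg (fun L => L (horVec g φ k z)) h1.fderiv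
  refine h2.trans ?_
  have h3 := pderiv_gLow g hφ hy k i j
  rw [(isCoordMetric g hφ).compat hy, gForm_apply, gForm_apply] at h3
  simp only [gamForm_std, stdVec_apply, mul_ite, mul_one, mul_zero, ite_mul, zero_mul,
    Finset.sum_ite_eq', Finset.sum_ite_irrel, Finset.mem_univ, if_true, Finset.sum_const_zero] at h3
  rw [Finset.sum_add_distrib]
  simp only [mul_comm (Gam g φ z.1 _ _ _)]
  exact h3

omit hC in
-- The column `g^{·j}` is `dxʲ` with its index raised, so `fderiv_sharp_horVec` applies to a
-- constant covector.
lemma fderiv_gUp_horVec (hφ : φ ∈ IsManifold.maximalAtlas (𝓡 n) ∞ M) {z : Coord n × Coord n}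
    (hz : z ∈ cotDomain φ) (k i j : Fin n) :
    fderiv ℝ (fun z : Coord n × Coord n => gUp g φ z.1 i j) z (horVec g φ k z) =
      - ∑ l, (Gam g φ z.1 i k l * gUp g φ z.1 l j + Gam g φ z.1 j k l * gUp g φ z.1 i l) := by
  have h1 := fderiv_sharp_horVec g hφ hz (α := fun _ => stdVec j) contDiffOn_const k
  have hs : ∀ w : Coord n × Coord n, ∀ i, gUp g φ w.1 i j = sharp g φ w.1 (stdVec j) i := by
    simp [sharp_apply, stdVec_apply]
  have h2 := (EuclideanSpace.proj i : Coord n →L[ℝ] ℝ).hasFDerivAt.comp z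
    (differentiableAt_of_smooth (contDiffOn_sharp g hφ (α := fun _ => stdVec j) contDiffOn_const)
      (isOpen_cotDomain φ) hz).hasFDerivAt
  have h3 := congrArg (fun L => L (horVec g φ k z)) h2.fderiv
  simp only [hs]
  refine h3.trans ?_
  change (fderiv ℝ (fun w : Coord n × Coord n => sharp g φ w.1 (stdVec j)) z (horVec g φ k z)) i = _
  rw [h1]
  simp only [PiLp.sub_apply, gamForm_apply, sharp_apply, fderiv_fun_const]
  simp [stdVec_apply, gamTranspose, pair_apply, gamForm_std, Finset.sum_add_distrib]
  simp only [mul_comm]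
  ring

omit hC in
lemma fderiv_g0_horVec (hφ : φ ∈ IsManifold.maximalAtlas (𝓡 n) ∞ M) {z : Coord n × Coord n}
    (hz : z ∈ cotDomain φ) (k i : Fin n) :
    fderiv ℝ (fun z : Coord n × Coord n => g0 g φ z.1 z.2 i) z (horVec g φ k z) =
      - ∑ l, Gam g φ z.1 i k l * g0 g φ z.1 z.2 l := by
  have h2 := (EuclideanSpace.proj i : Coord n →L[ℝ] ℝ).hasFDerivAt.comp z
    (differentiableAt_of_smooth (contDiffOn_sharp g hφ (α := fun w => w.2) contDiff_snd.contDiffOn)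
      (isOpen_cotDomain φ) hz).hasFDerivAt
  have h3 := congrArg (fun L => L (horVec g φ k z)) h2.fderiv
  simp only [g0_eq]
  refine h3.trans ?_
  change (fderiv ℝ (fun w : Coord n × Coord n => sharp g φ w.1 w.2) z (horVec g φ k z)) i = _
  rw [fderiv_sharp_momentum g hφ hz]
  simp [gamForm_apply, stdVec_apply]

/-- Functions of `t` are horizontally constant, while `g` and `p` are horizontally parallel; hence
`G1` varies as a parallel tensor with two lower indices. -/
lemma fderiv_G1_horVec (hφ : φ ∈ IsManifold.maximalAtlas (𝓡 n) ∞ M) {z : Coord n × Coord n}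
    (hz : z ∈ cotDomain φ) (k i j : Fin n) :
    fderiv ℝ (fun z : Coord n × Coord n => G1 g C φ z.1 z.2 i j) z (horVec g φ k z) =
      ∑ l, (Gam g φ z.1 l k i * G1 g C φ z.1 z.2 l j +
        Gam g φ z.1 l k j * G1 g C φ z.1 z.2 i l) := by
  have ho := isOpen_cotDomain φ
  have hc := hasFDerivAt_comp_energy g hφ hC.smooth_c₁ hz
  have hd := hasFDerivAt_comp_energy g hφ hC.smooth_d₁ hz
  have hp : ∀ i, HasFDerivAt (fun z : Coord n × Coord n => z.2 i)
      ((EuclideanSpace.proj i : Coord n →L[ℝ] ℝ).comp (ContinuousLinearMap.snd ℝ _ _)) z :=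
    fun i => (EuclideanSpace.proj i : Coord n →L[ℝ] ℝ).hasFDerivAt.comp z hasFDerivAt_snd
  have hg := fderiv_gLow_horVec g hφ hz k i j
  have h := (hc.mul hg.1).add ((hd.mul (hp i)).mul (hp j))
  refine (congrArg (fun L => L (horVec g φ k z)) h.fderiv).trans ?_
  have hk : ∀ i, (horVec g φ k z).2 i = ∑ l, z.2 l * Gam g φ z.1 l k i := fun i =>
    gamTranspose_apply g φ z.1 z.2 k i
  have hproj : ∀ i (v : Coord n), (EuclideanSpace.proj i : Coord n →L[ℝ] ℝ) v = v i :=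
    fun _ _ => rfl
  simp only [add_apply, smul_apply, hg.2, fderiv_energy_horVec g hφ hz, Pi.mul_apply,
    ContinuousLinearMap.comp_apply, ContinuousLinearMap.coe_snd', hproj, hk, G1, smul_eq_mul, mul_zero, add_zero]
  simp only [Finset.mul_sum, ← Finset.sum_add_distrib]
  exact Finset.sum_congr rfl fun l _ => by ring

lemma fderiv_G2_horVec (hφ : φ ∈ IsManifold.maximalAtlas (𝓡 n) ∞ M) {z : Coord n × Coord n}
    (hz : z ∈ cotDomain φ) (k i j : Fin n) :
    fderiv ℝ (fun z : Coord n × Coord n => G2 g C φ z.1 z.2 i j) z (horVec g φ k z) =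
      - ∑ l, (Gam g φ z.1 i k l * G2 g C φ z.1 z.2 l j +
        Gam g φ z.1 j k l * G2 g C φ z.1 z.2 i l) := by
  have ho := isOpen_cotDomain φ
  have hc := hasFDerivAt_comp_energy g hφ hC.smooth_c₂ hz
  have hd := hasFDerivAt_comp_energy g hφ hC.smooth_d₂ hz
  have hp := fun i => (differentiableAt_of_smooth (contDiffOn_g0 g hφ i) ho hz).hasFDerivAt
  have hg := (differentiableAt_of_smooth (contDiffOn_comp_fst (contDiffOn_gUp g hφ i j)) ho
    hz).hasFDerivAt
  have h := (hc.mul hg).add ((hd.mul (hp i)).mul (hp j))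
  refine (congrArg (fun L => L (horVec g φ k z)) h.fderiv).trans ?_
  simp only [add_apply, smul_apply, fderiv_gUp_horVec g hφ hz, fderiv_energy_horVec g hφ hz,
    fderiv_g0_horVec g hφ hz, G2, Pi.mul_apply, smul_eq_mul, mul_zero, add_zero]
  simp only [mul_neg, Finset.mul_sum, ← Finset.sum_add_distrib, ← Finset.sum_neg_distrib]
  exact Finset.sum_congr rfl fun l _ => by ring

end Horizontal

/-! ### The adapted frame -/

section AdaptedFrame

variable {n : ℕ} {M : Type*} [TopologicalSpace M] [ChartedSpace (Coord n) M]
  [IsManifold (𝓡 n) ∞ M] {φ : LocalChart n M} (g : RMetric n M) {P : TStar n M}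

lemma dp_eq (i : Fin n) : dp φ i = liftField (M := M) φ (vertVec i) := rfl

lemma comp_dp (hφ : φ ∈ IsManifold.maximalAtlas (𝓡 n) ∞ M) (hP : P.proj ∈ φ.source) (i : Fin n) :
    comp φ P (dp φ i P) = (0, stdVec i) := by
  rw [dp_eq]; exact mvfderiv_cotChart_liftField hφ hP _

lemma comp_deltaq (hφ : φ ∈ IsManifold.maximalAtlas (𝓡 n) ∞ M) (hP : P.proj ∈ φ.source)
    (i : Fin n) : comp φ P (deltaq g φ i P) = horVec g φ i (cotChart φ P) := by
  have h1 : comp φ P (dq φ i P) = (stdVec i, 0) :=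
    mvfderiv_cotChart_liftField hφ hP fun _ => (stdVec i, 0)
  simp only [comp] at h1
  simp only [comp, deltaq, map_add, map_sum, map_smul, h1, comp_dp hφ hP, Prod.smul_mk, smul_zero]
  refine Prod.ext ?_ ?_
  · simp [horVec, Prod.fst_sum]
  · simp only [Prod.snd_add, Prod.snd_sum, zero_add, horVec]
    conv_rhs => rw [← sum_smul_stdVec (gamTranspose g φ (cotChart φ P).1 i (cotChart φ P).2)]
    simp only [gamTranspose_apply]

lemma formdq_dp (hφ : φ ∈ IsManifold.maximalAtlas (𝓡 n) ∞ M) (hP : P.proj ∈ φ.source)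
    (i j : Fin n) : formdq φ i P (dp φ j P) = 0 := by
  have := congrArg (fun v => v.1 i) (comp_dp hφ hP j)
  simpa [formdq] using this

lemma formdq_deltaq (hφ : φ ∈ IsManifold.maximalAtlas (𝓡 n) ∞ M) (hP : P.proj ∈ φ.source)
    (i j : Fin n) : formdq φ i P (deltaq g φ j P) = kron i j := by
  have := congrArg (fun v => v.1 i) (comp_deltaq g hφ hP j)
  simpa [formdq, horVec, stdVec_apply, kron] using this

lemma formDp_dp (hφ : φ ∈ IsManifold.maximalAtlas (𝓡 n) ∞ M) (hP : P.proj ∈ φ.source)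
    (i j : Fin n) : formDp g φ i P (dp φ j P) = kron i j := by
  have := congrArg (fun v => v.2 i) (comp_dp hφ hP j)
  simpa [formDp, formdq_dp hφ hP, stdVec_apply, kron] using this

lemma Gam_symm (hφ : φ ∈ IsManifold.maximalAtlas (𝓡 n) ∞ M) {y : Coord n} (hy : y ∈ φ.target)
    (k i j : Fin n) : Gam g φ y k i j = Gam g φ y k j i := by
  rw [← gamForm_std, ← gamForm_std, (isCoordMetric g hφ).christoffel_symm hy]

lemma Gam0_symm (hφ : φ ∈ IsManifold.maximalAtlas (𝓡 n) ∞ M) {y : Coord n} (hy : y ∈ φ.target)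
    (p : Coord n) (i j : Fin n) : Gam0 g φ y p i j = Gam0 g φ y p j i :=
  Finset.sum_congr rfl fun k _ => by rw [Gam_symm g hφ hy]

lemma formDp_deltaq (hφ : φ ∈ IsManifold.maximalAtlas (𝓡 n) ∞ M) (hP : P.proj ∈ φ.source)
    (i j : Fin n) : formDp g φ i P (deltaq g φ j P) = 0 := by
  have h := congrArg (fun v => v.2 i) (comp_deltaq g hφ hP j)
  have h' : (mvfderiv (TI n) (cotChart φ) P (deltaq g φ j P)).2 i =
    Gam0 g φ (cotChart φ P).1 (cotChart φ P).2 j i := h.trans (gamTranspose_apply g φ _ _ _ _)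
  rw [formDp, h']
  simp only [formdq_deltaq g hφ hP, kron, mul_ite, mul_one, mul_zero, Finset.sum_ite_eq',
    Finset.mem_univ, if_true]
  rw [Gam0_symm g hφ (show (cotChart φ P).1 ∈ φ.target from φ.map_source hP), sub_self]

lemma deltaq_eq (i : Fin n) : deltaq g φ i = liftField (M := M) φ (horVec g φ i) := by
  funext Q
  have h : horVec g φ i (cotChart φ Q) = (stdVec i, 0) +
      ∑ h, Gam0 g φ (cotChart φ Q).1 (cotChart φ Q).2 i h • ((0, stdVec h) : Coord n × Coord n) := by
    refine Prod.ext ?_ ?_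
    · simp [horVec, Prod.fst_sum]
    · simp only [Prod.snd_add, Prod.snd_sum, zero_add, horVec, Prod.smul_snd]
      rw [← sum_smul_stdVec (gamTranspose g φ (cotChart φ Q).1 i (cotChart φ Q).2)]
      simp only [gamTranspose_apply]
  have h2 : ∀ L : Coord n × Coord n →L[ℝ] Coord n × (Coord n →L[ℝ] ℝ),
      L (horVec g φ i (cotChart φ Q)) = L (stdVec i, 0) +
        ∑ h, Gam0 g φ (cotChart φ Q).1 (cotChart φ Q).2 i h • L (0, stdVec h) := fun L => by
    rw [h, map_add, map_sum]
    simp only [map_smul]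
  exact (h2 (mfderiv 𝓘(ℝ, Coord n × Coord n) (TI n) (cotChartInv φ) (cotChart φ Q))).symm

lemma formdq_add (i : Fin n) (X Y : TangentSpace (TI n) P) :
    formdq φ i P (X + Y) = formdq φ i P X + formdq φ i P Y := by
  simp [formdq]

lemma formdq_smul (i : Fin n) (r : ℝ) (X : TangentSpace (TI n) P) :
    formdq φ i P (r • X) = r * formdq φ i P X := by
  simp [formdq]

lemma formDp_add (i : Fin n) (X Y : TangentSpace (TI n) P) :
    formDp g φ i P (X + Y) = formDp g φ i P X + formDp g φ i P Y := by
  simp only [formDp, formdq_add, map_add, Prod.snd_add, PiLp.add_apply, mul_add,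
    Finset.sum_add_distrib]
  ring

lemma formDp_smul (i : Fin n) (r : ℝ) (X : TangentSpace (TI n) P) :
    formDp g φ i P (r • X) = r * formDp g φ i P X := by
  simp only [formDp, formdq_smul, map_smul, Prod.smul_snd, PiLp.smul_apply, smul_eq_mul, mul_sub,
    Finset.mul_sum]
  congr 1
  exact Finset.sum_congr rfl fun _ _ => by ring

lemma formdq_sum (i : Fin n) (X : Fin n → TangentSpace (TI n) P) :
    formdq φ i P (∑ k, X k) = ∑ k, formdq φ i P (X k) :=
  map_sum (AddMonoidHom.mk' (formdq φ i P) (formdq_add i)) X _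

lemma formDp_sum (i : Fin n) (X : Fin n → TangentSpace (TI n) P) :
    formDp g φ i P (∑ k, X k) = ∑ k, formDp g φ i P (X k) :=
  map_sum (AddMonoidHom.mk' (formDp g φ i P) (formDp_add g i)) X _

lemma eq_of_adapted_forms (hφ : φ ∈ IsManifold.maximalAtlas (𝓡 n) ∞ M) (hP : P.proj ∈ φ.source)
    {X Y : TangentSpace (TI n) P} (h1 : ∀ i, formdq φ i P X = formdq φ i P Y)
    (h2 : ∀ i, formDp g φ i P X = formDp g φ i P Y) : X = Y := by
  refine mvfderiv_cotChart_injective hφ hP (Prod.ext (PiLp.ext h1) (PiLp.ext fun i => ?_))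
  have := h2 i
  simp only [formDp, h1] at this
  exact sub_left_injective this

lemma eq_sum_adaptedFrame (hφ : φ ∈ IsManifold.maximalAtlas (𝓡 n) ∞ M) (hP : P.proj ∈ φ.source)
    (X : TangentSpace (TI n) P) :
    X = ∑ h, formdq φ h P X • deltaq g φ h P + ∑ h, formDp g φ h P X • dp φ h P := by
  refine eq_of_adapted_forms g hφ hP (fun i => ?_) (fun i => ?_)
  · simp [formdq_add, formdq_sum, formdq_smul, formdq_deltaq g hφ hP, formdq_dp hφ hP, kron]
  · simp [formDp_add, formDp_sum, formDp_smul, formDp_deltaq g hφ hP, formDp_dp g hφ hP, kron]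

lemma liftField_vertical (hφ : φ ∈ IsManifold.maximalAtlas (𝓡 n) ∞ M) (hP : P.proj ∈ φ.source)
    {V : Coord n × Coord n → Coord n × Coord n} (hV : (V (cotChart φ P)).1 = 0) :
    liftField φ V P = ∑ h, (V (cotChart φ P)).2 h • dp φ h P := by
  refine mvfderiv_cotChart_injective hφ hP ?_
  have h1 := fun h => comp_dp hφ hP h
  simp only [comp] at h1
  rw [mvfderiv_cotChart_liftField hφ hP, map_sum]
  simp only [map_smul, h1]
  refine Prod.ext ?_ ?_
  · simp [hV, Prod.fst_sum]
  · simp only [Prod.snd_sum, Prod.smul_snd, sum_smul_stdVec]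

variable (C : DiagCoeffs)

lemma metricInChart_deltaq (hφ : φ ∈ IsManifold.maximalAtlas (𝓡 n) ∞ M) (hP : P.proj ∈ φ.source)
    (X : TangentSpace (TI n) P) (k : Fin n) : metricInChart g C φ P X (deltaq g φ k P) =
      ∑ i, G1 g C φ (cotChart φ P).1 (cotChart φ P).2 i k * formdq φ i P X := by
  simp [metricInChart, formdq_deltaq g hφ hP, formDp_deltaq g hφ hP, kron]

lemma metricInChart_dp (hφ : φ ∈ IsManifold.maximalAtlas (𝓡 n) ∞ M) (hP : P.proj ∈ φ.source)
    (X : TangentSpace (TI n) P) (k : Fin n) : metricInChart g C φ P X (dp φ k P) =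
      ∑ i, G2 g C φ (cotChart φ P).1 (cotChart φ P).2 i k * formDp g φ i P X := by
  simp [metricInChart, formdq_dp hφ hP, formDp_dp g hφ hP, kron]

lemma G1_symm (φ : LocalChart n M) (y p : Coord n) (i j : Fin n) :
    G1 g C φ y p i j = G1 g C φ y p j i := by
  simp only [G1, gLow_symm g φ y i j]; ring

lemma G2_symm (φ : LocalChart n M) (y p : Coord n) (i j : Fin n) :
    G2 g C φ y p i j = G2 g C φ y p j i := by
  simp only [G2, gUp_symm g φ y i j]; ring

lemma metricInChart_comm (φ : LocalChart n M) (P : TStar n M) (X Y : TangentSpace (TI n) P) :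
    metricInChart g C φ P X Y = metricInChart g C φ P Y X := by
  rw [metricInChart, metricInChart, Finset.sum_comm]
  refine Finset.sum_congr rfl fun i _ => Finset.sum_congr rfl fun j _ => ?_
  rw [G1_symm g C φ _ _ j i, G2_symm g C φ _ _ j i]
  ring

lemma metricInChart_add_left (φ : LocalChart n M) (P : TStar n M) (X Y Z : TangentSpace (TI n) P) :
    metricInChart g C φ P (X + Y) Z = metricInChart g C φ P X Z + metricInChart g C φ P Y Z := by
  simp only [metricInChart, formdq_add, formDp_add, ← Finset.sum_add_distrib]
  exact Finset.sum_congr rfl fun i _ => Finset.sum_congr rfl fun j _ => by ring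

variable {C} (hC : C.Admissible)
include hC

lemma formdq_eq_sum (hφ : φ ∈ IsManifold.maximalAtlas (𝓡 n) ∞ M) (hP : P.proj ∈ φ.source)
    (X : TangentSpace (TI n) P) (h : Fin n) :
    formdq φ h P X = ∑ k, H1 g C φ (cotChart φ P).1 (cotChart φ P).2 h k *
      metricInChart g C φ P X (deltaq g φ k P) := by
  simp only [metricInChart_deltaq g C hφ hP, Finset.mul_sum]
  rw [Finset.sum_comm]
  simp only [← mul_assoc, ← Finset.sum_mul]
  have e : ∀ i, ∑ k, H1 g C φ (cotChart φ P).1 (cotChart φ P).2 h k *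
      G1 g C φ (cotChart φ P).1 (cotChart φ P).2 i k = kron h i := fun i => by
    simp only [G1_symm g C φ _ _ i]
    exact sum_H1_mul_G1 g hC hφ (φ.map_source hP) _ h i
  simp [e, kron]

lemma formDp_eq_sum (hφ : φ ∈ IsManifold.maximalAtlas (𝓡 n) ∞ M) (hP : P.proj ∈ φ.source)
    (X : TangentSpace (TI n) P) (h : Fin n) :
    formDp g φ h P X = ∑ k, H2 g C φ (cotChart φ P).1 (cotChart φ P).2 h k *
      metricInChart g C φ P X (dp φ k P) := by
  simp only [metricInChart_dp g C hφ hP, Finset.mul_sum]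
  rw [Finset.sum_comm]
  simp only [← mul_assoc, ← Finset.sum_mul]
  have e : ∀ i, ∑ k, H2 g C φ (cotChart φ P).1 (cotChart φ P).2 h k *
      G2 g C φ (cotChart φ P).1 (cotChart φ P).2 i k = kron h i := fun i => by
    simp only [G2_symm g C φ _ _ i]
    exact sum_H2_mul_G2 g hC hφ (φ.map_source hP) _ h i
  simp [e, kron]

end AdaptedFrame

/-! ### Brackets of the adapted frame -/

section Brackets

variable {n : ℕ} {M : Type*} [TopologicalSpace M] [ChartedSpace (Coord n) M]
  [IsManifold (𝓡 n) ∞ M] {φ : LocalChart n M} (g : RMetric n M) {P : TStar n M}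

lemma contDiffAt_horVec (hφ : φ ∈ IsManifold.maximalAtlas (𝓡 n) ∞ M) (hP : P.proj ∈ φ.source)
    (i : Fin n) : ContDiffAt ℝ ∞ (horVec g φ i) (cotChart φ P) :=
  (contDiffOn_horVec g hφ i).contDiffAt
    ((isOpen_cotDomain φ).mem_nhds (mem_cotDomain.2 (φ.map_source hP)))

lemma contDiffAt_vertVec (i : Fin n) (z : Coord n × Coord n) : ContDiffAt ℝ ∞ (vertVec i) z :=
  contDiffAt_const

lemma fderiv_vertVec (i : Fin n) (z : Coord n × Coord n) : fderiv ℝ (vertVec i) z = 0 := by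
  unfold vertVec; exact fderiv_const_apply _

lemma cotChart_mem (hP : P.proj ∈ φ.source) : cotChart φ P ∈ cotDomain φ :=
  mem_cotDomain.2 (φ.map_source hP)

lemma vfDiffAt_dp (hφ : φ ∈ IsManifold.maximalAtlas (𝓡 n) ∞ M) (hP : P.proj ∈ φ.source)
    (i : Fin n) : VFDiffAt (dp φ i) P :=
  vfDiffAt_liftField hφ hP (contDiffAt_vertVec i _)

lemma vfDiffAt_deltaq (hφ : φ ∈ IsManifold.maximalAtlas (𝓡 n) ∞ M) (hP : P.proj ∈ φ.source)
    (i : Fin n) : VFDiffAt (deltaq g φ i) P := by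
  rw [deltaq_eq]
  exact vfDiffAt_liftField hφ hP (contDiffAt_horVec g hφ hP i)

lemma mlieBracket_dp_dp (hφ : φ ∈ IsManifold.maximalAtlas (𝓡 n) ∞ M) (hP : P.proj ∈ φ.source)
    (i j : Fin n) : VectorField.mlieBracket (TI n) (dp φ i) (dp φ j) P = 0 := by
  rw [dp_eq, dp_eq, mlieBracket_liftField hφ hP (contDiffAt_vertVec i _) (contDiffAt_vertVec j _),
    liftField_vertical hφ hP]
  · simp [VectorField.lieBracket, fderiv_vertVec]
  · simp [VectorField.lieBracket, fderiv_vertVec]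

lemma fderiv_horVec (hφ : φ ∈ IsManifold.maximalAtlas (𝓡 n) ∞ M) {z : Coord n × Coord n}
    (hz : z ∈ cotDomain φ) (i : Fin n) (v : Coord n × Coord n) :
    (fderiv ℝ (horVec g φ i) z v).1 = 0 ∧ ∀ h, (fderiv ℝ (horVec g φ i) z v).2 h =
      ∑ k, (v.2 k * Gam g φ z.1 k i h +
        z.2 k * fderiv ℝ (fun y => Gam g φ y k i h) z.1 v.1) := by
  have hd := differentiableAt_of_smooth (contDiffOn_horVec g hφ i) (isOpen_cotDomain φ) hz
  have hv : ∀ L : Coord n × Coord n →L[ℝ] Coord n, L.comp (fderiv ℝ (horVec g φ i) z) =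
      fderiv ℝ (fun w => L (horVec g φ i w)) z := fun L =>
    (L.hasFDerivAt.comp z hd.hasFDerivAt).fderiv.symm
  constructor
  · refine (congrArg (fun L => L v) (hv (ContinuousLinearMap.fst ℝ _ _))).trans ?_
    have : (fun w => ContinuousLinearMap.fst ℝ (Coord n) (Coord n) (horVec g φ i w)) =
      fun _ => stdVec i := rfl
    rw [this]
    simp
  · intro h
    have h1 := (((EuclideanSpace.proj h : Coord n →L[ℝ] ℝ).comp
      (ContinuousLinearMap.snd ℝ (Coord n) (Coord n))).hasFDerivAt.comp z hd.hasFDerivAt)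
    have h2 : (fun w : Coord n × Coord n => ((EuclideanSpace.proj h : Coord n →L[ℝ] ℝ).comp
      (ContinuousLinearMap.snd ℝ (Coord n) (Coord n))) (horVec g φ i w)) =
        fun w => ∑ k, w.2 k * Gam g φ w.1 k i h :=
      funext fun w => gamTranspose_apply g φ w.1 w.2 i h
    have h3 : HasFDerivAt (fun w : Coord n × Coord n => ∑ k, w.2 k * Gam g φ w.1 k i h) _ z :=
      HasFDerivAt.fun_sum fun k _ =>
        ((EuclideanSpace.proj k : Coord n →L[ℝ] ℝ).hasFDerivAt.comp z hasFDerivAt_snd).mul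
        (HasFDerivAt.comp (g := fun y => Gam g φ y k i h) (f := Prod.fst) z
          (differentiableAt_of_smooth (contDiffOn_Gam g hφ k i h) φ.open_target
            (mem_cotDomain.1 hz)).hasFDerivAt hasFDerivAt_fst)
    rw [← h2] at h3
    refine (congrArg (fun L => L v) (h1.unique h3)).trans ?_
    rw [sum_apply]
    refine Finset.sum_congr rfl fun k _ => ?_
    change z.2 k * fderiv ℝ (fun y => Gam g φ y k i h) z.1 v.1 + Gam g φ z.1 k i h * v.2 k = _
    ring

/-- Only the derivative of `Γ⁰` in the momentum direction contributes, and `Γ⁰` is linear in `p`. -/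
lemma mlieBracket_dp_deltaq (hφ : φ ∈ IsManifold.maximalAtlas (𝓡 n) ∞ M)
    (hP : P.proj ∈ φ.source) (i j : Fin n) :
    VectorField.mlieBracket (TI n) (dp φ i) (deltaq g φ j) P =
      ∑ h, Gam g φ (cotChart φ P).1 i j h • dp φ h P := by
  have h0 := fderiv_horVec g hφ (cotChart_mem hP) j
  rw [dp_eq, deltaq_eq, mlieBracket_liftField hφ hP (contDiffAt_vertVec i _)
    (contDiffAt_horVec g hφ hP j), liftField_vertical hφ hP]
  · refine Finset.sum_congr rfl fun h _ => ?_
    congr 1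
    simp [VectorField.lieBracket, fderiv_vertVec, (h0 _).2, vertVec, stdVec_apply]
  · simp [VectorField.lieBracket, fderiv_vertVec, (h0 _).1]

/-- The base derivatives of `Γ⁰` give the `∂Γ` terms of the curvature, its momentum derivatives the
`ΓΓ` terms. -/
lemma mlieBracket_deltaq_deltaq (hφ : φ ∈ IsManifold.maximalAtlas (𝓡 n) ∞ M)
    (hP : P.proj ∈ φ.source) (i j : Fin n) :
    VectorField.mlieBracket (TI n) (deltaq g φ i) (deltaq g φ j) P =
      ∑ h, Riem0 g φ (cotChart φ P).1 (cotChart φ P).2 h i j • dp φ h P := by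
  have h0 := fderiv_horVec g hφ (cotChart_mem hP)
  rw [deltaq_eq, deltaq_eq, mlieBracket_liftField hφ hP (contDiffAt_horVec g hφ hP i)
    (contDiffAt_horVec g hφ hP j), liftField_vertical hφ hP]
  · refine Finset.sum_congr rfl fun h _ => ?_
    congr 1
    simp only [VectorField.lieBracket, Prod.snd_sub, PiLp.sub_apply, (h0 _ _).2]
    simp only [horVec, gamTranspose_apply, Riem0, Riem, pderiv, Gam0, Finset.sum_add_distrib,
      Finset.sum_sub_distrib, mul_add, mul_sub, Finset.mul_sum, Finset.sum_mul, mul_assoc]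
    -- Interchanging sums matches the quadratic terms: on the left the outer index is the contracted
    -- one, in `Riem0` it is the index of the momentum.
    rw [Finset.sum_comm]
    conv_lhs => enter [2, 1]; rw [Finset.sum_comm]
    ring
  · simp [VectorField.lieBracket, (h0 _ _).1]

end Brackets

/-! ### The Levi-Civita connection in the adapted frame -/

section LeviCivita

variable {n : ℕ} {M : Type*} [TopologicalSpace M] [ChartedSpace (Coord n) M]
  [IsManifold (𝓡 n) ∞ M] {φ : LocalChart n M} (g : RMetric n M) {P : TStar n M} {C : DiagCoeffs}
  {cov : TStarConnection n M}

lemma naturalMetric_sub_left (U V W : TangentSpace (TI n) P) : naturalMetric g C P (U - V) W =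
    naturalMetric g C P U W - naturalMetric g C P V W := by
  have := metricInChart_add_left g C (chartAt (Coord n) P.proj) P (U - V) V W
  rw [sub_add_cancel] at this
  exact eq_sub_of_add_eq this.symm

/-- The Koszul formula. -/
lemma IsLeviCivita.koszul (h : IsLeviCivita (naturalMetric g C) cov)
    (X Y Z : ∀ P : TStar n M, TangentSpace (TI n) P)
    (hX : VFDiffAt X P) (hY : VFDiffAt Y P) (hZ : VFDiffAt Z P) :
    2 * naturalMetric g C P (cov Y P (X P)) (Z P) =
      mvfderiv (TI n) (fun P' => naturalMetric g C P' (Y P') (Z P')) P (X P)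
      + mvfderiv (TI n) (fun P' => naturalMetric g C P' (X P') (Z P')) P (Y P)
      - mvfderiv (TI n) (fun P' => naturalMetric g C P' (X P') (Y P')) P (Z P)
      + naturalMetric g C P (VectorField.mlieBracket (TI n) X Y P) (Z P)
      - naturalMetric g C P (VectorField.mlieBracket (TI n) X Z P) (Y P)
      - naturalMetric g C P (VectorField.mlieBracket (TI n) Y Z P) (X P) := by
  have hs : ∀ U V : TangentSpace (TI n) P, naturalMetric g C P U V = naturalMetric g C P V U :=
    fun U V => metricInChart_comm g C _ P U V
  -- Derivatives are expanded by `∇G = 0` and brackets by vanishing torsion; everything cancels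
  -- except two copies of `G(∇_X Y, Z)`.
  rw [h.metric X Y Z P hY hZ, h.metric Y X Z P hX hZ, h.metric Z X Y P hX hY,
    ← h.torsion_free X Y P hX hY, ← h.torsion_free X Z P hX hZ, ← h.torsion_free Y Z P hY hZ]
  simp only [naturalMetric_sub_left]
  rw [hs (Y P), hs (X P), hs (X P)]
  ring

/-! Derivatives of the metric coefficients along the adapted frame. -/

lemma naturalMetric_dp_dp (hφ : φ ∈ IsManifold.maximalAtlas (𝓡 n) ∞ M) (hP : P.proj ∈ φ.source)
    (i j : Fin n) : naturalMetric g C P (dp φ i P) (dp φ j P) =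
      G2 g C φ (cotChart φ P).1 (cotChart φ P).2 i j := by
  simp [naturalMetric_eq g C hφ hP, metricInChart_dp g C hφ hP, formDp_dp g hφ hP, kron]

lemma naturalMetric_deltaq_dp (hφ : φ ∈ IsManifold.maximalAtlas (𝓡 n) ∞ M)
    (hP : P.proj ∈ φ.source) (i j : Fin n) :
    naturalMetric g C P (deltaq g φ i P) (dp φ j P) = 0 := by
  simp [naturalMetric_eq g C hφ hP, metricInChart_dp g C hφ hP, formDp_deltaq g hφ hP]

lemma naturalMetric_dp_deltaq (hφ : φ ∈ IsManifold.maximalAtlas (𝓡 n) ∞ M)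
    (hP : P.proj ∈ φ.source) (i j : Fin n) :
    naturalMetric g C P (dp φ i P) (deltaq g φ j P) = 0 := by
  simp [naturalMetric_eq g C hφ hP, metricInChart_deltaq g C hφ hP, formdq_dp hφ hP]

lemma naturalMetric_deltaq_deltaq (hφ : φ ∈ IsManifold.maximalAtlas (𝓡 n) ∞ M)
    (hP : P.proj ∈ φ.source) (i j : Fin n) :
    naturalMetric g C P (deltaq g φ i P) (deltaq g φ j P) =
      G1 g C φ (cotChart φ P).1 (cotChart φ P).2 i j := by
  simp [naturalMetric_eq g C hφ hP, metricInChart_deltaq g C hφ hP, formdq_deltaq g hφ hP, kron]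

lemma naturalMetric_sum_dp_dp (hφ : φ ∈ IsManifold.maximalAtlas (𝓡 n) ∞ M)
    (hP : P.proj ∈ φ.source) (a : Fin n → ℝ) (k : Fin n) :
    naturalMetric g C P (∑ h, a h • dp φ h P) (dp φ k P) =
      ∑ h, G2 g C φ (cotChart φ P).1 (cotChart φ P).2 h k * a h := by
  simp [naturalMetric_eq g C hφ hP, metricInChart_dp g C hφ hP, formDp_sum, formDp_smul,
    formDp_dp g hφ hP, kron]

lemma naturalMetric_sum_dp_deltaq (hφ : φ ∈ IsManifold.maximalAtlas (𝓡 n) ∞ M)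
    (hP : P.proj ∈ φ.source) (a : Fin n → ℝ) (k : Fin n) :
    naturalMetric g C P (∑ h, a h • dp φ h P) (deltaq g φ k P) = 0 := by
  simp [naturalMetric_eq g C hφ hP, metricInChart_deltaq g C hφ hP, formdq_sum, formdq_smul,
    formdq_dp hφ hP]

lemma naturalMetric_zero_left (X : TangentSpace (TI n) P) : naturalMetric g C P 0 X = 0 := by
  have h := metricInChart_add_left g C (chartAt (Coord n) P.proj) P 0 0 X
  rw [add_zero] at h
  exact left_eq_add.1 h

lemma naturalMetric_neg_left (U W : TangentSpace (TI n) P) : naturalMetric g C P (-U) W =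
    -naturalMetric g C P U W := by
  rw [← zero_sub, naturalMetric_sub_left, naturalMetric_zero_left, zero_sub]

lemma mvfderiv_naturalMetric_mixed (hφ : φ ∈ IsManifold.maximalAtlas (𝓡 n) ∞ M)
    (hP : P.proj ∈ φ.source) (i j : Fin n) (X : TangentSpace (TI n) P) :
    mvfderiv (TI n) (fun P' => naturalMetric g C P' (deltaq g φ i P') (dp φ j P')) P X = 0 ∧
    mvfderiv (TI n) (fun P' => naturalMetric g C P' (dp φ i P') (deltaq g φ j P')) P X = 0 := by
  have h : ∀ F : TStar n M → ℝ, F =ᶠ[𝓝 P] (fun _ => 0) → mvfderiv (TI n) F P X = 0 := fun F hF => by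
    have h1 : mfderiv (TI n) 𝓘(ℝ, ℝ) F P = mfderiv (TI n) 𝓘(ℝ, ℝ) (fun _ => (0 : ℝ)) P :=
      hF.mfderiv_eq
    rw [mfderiv_const] at h1
    exact congrArg (fun L => L X) h1
  constructor
  · refine h _ ?_
    filter_upwards [eventually_proj_mem hP] with Q hQ using naturalMetric_deltaq_dp g hφ hQ i j
  · refine h _ ?_
    filter_upwards [eventually_proj_mem hP] with Q hQ using naturalMetric_dp_deltaq g hφ hQ i j

/-! ### Covariant derivatives of the adapted frame from the Koszul formula. -/

section

variable (hC : C.Admissible)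
include hC

lemma mvfderiv_G2 (hφ : φ ∈ IsManifold.maximalAtlas (𝓡 n) ∞ M)
    (hP : P.proj ∈ φ.source) (i j k : Fin n) :
    mvfderiv (TI n) (fun P' => naturalMetric g C P' (dp φ i P') (dp φ j P')) P (dp φ k P) =
      vderiv k (fun y p => G2 g C φ y p i j) (cotChart φ P).1 (cotChart φ P).2 ∧
    mvfderiv (TI n) (fun P' => naturalMetric g C P' (dp φ i P') (dp φ j P')) P (deltaq g φ k P) =
      - ∑ l, (Gam g φ (cotChart φ P).1 i k l * G2 g C φ (cotChart φ P).1 (cotChart φ P).2 l j +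
        Gam g φ (cotChart φ P).1 j k l * G2 g C φ (cotChart φ P).1 (cotChart φ P).2 i l) := by
  have hd := differentiableAt_of_smooth (contDiffOn_G2 g hC hφ i j) (isOpen_cotDomain φ)
    (cotChart_mem hP)
  have hF : (fun P' => naturalMetric g C P' (dp φ i P') (dp φ j P')) =ᶠ[𝓝 P]
      (fun z : Coord n × Coord n => G2 g C φ z.1 z.2 i j) ∘ cotChart φ := by
    filter_upwards [eventually_proj_mem hP] with Q hQ using naturalMetric_dp_dp g hφ hQ i j
  constructor
  · rw [dp_eq k, mvfderiv_liftField hφ hP hF hd]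
    exact fderiv_vert (f := fun y p => G2 g C φ y p i j) hd k
  · rw [deltaq_eq, mvfderiv_liftField hφ hP hF hd]
    exact fderiv_G2_horVec g hC hφ (cotChart_mem hP) k i j

lemma mvfderiv_G1 (hφ : φ ∈ IsManifold.maximalAtlas (𝓡 n) ∞ M)
    (hP : P.proj ∈ φ.source) (i j k : Fin n) :
    mvfderiv (TI n) (fun P' => naturalMetric g C P' (deltaq g φ i P') (deltaq g φ j P')) P
        (dp φ k P) =
      vderiv k (fun y p => G1 g C φ y p i j) (cotChart φ P).1 (cotChart φ P).2 ∧
    mvfderiv (TI n) (fun P' => naturalMetric g C P' (deltaq g φ i P') (deltaq g φ j P')) P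
        (deltaq g φ k P) =
      ∑ l, (Gam g φ (cotChart φ P).1 l k i * G1 g C φ (cotChart φ P).1 (cotChart φ P).2 l j +
        Gam g φ (cotChart φ P).1 l k j * G1 g C φ (cotChart φ P).1 (cotChart φ P).2 i l) := by
  have hd := differentiableAt_of_smooth (contDiffOn_G1 g hC hφ i j) (isOpen_cotDomain φ)
    (cotChart_mem hP)
  have hF : (fun P' => naturalMetric g C P' (deltaq g φ i P') (deltaq g φ j P')) =ᶠ[𝓝 P]
      (fun z : Coord n × Coord n => G1 g C φ z.1 z.2 i j) ∘ cotChart φ := by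
    filter_upwards [eventually_proj_mem hP] with Q hQ using naturalMetric_deltaq_deltaq g hφ hQ i j
  constructor
  · rw [dp_eq k, mvfderiv_liftField hφ hP hF hd]
    exact fderiv_vert (f := fun y p => G1 g C φ y p i j) hd k
  · rw [deltaq_eq g k, mvfderiv_liftField hφ hP hF hd]
    exact fderiv_G1_horVec g hC hφ (cotChart_mem hP) k i j

/-- A tangent vector is determined by its products with the adapted frame. -/
lemma eq_of_naturalMetric (hφ : φ ∈ IsManifold.maximalAtlas (𝓡 n) ∞ M) (hP : P.proj ∈ φ.source)
    {X : TangentSpace (TI n) P} {a b α β : Fin n → ℝ}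
    (h1 : ∀ k, 2 * naturalMetric g C P X (deltaq g φ k P) = α k)
    (h2 : ∀ k, 2 * naturalMetric g C P X (dp φ k P) = β k)
    (ha : ∀ h, a h = (1 / 2) * ∑ k, H1 g C φ (cotChart φ P).1 (cotChart φ P).2 h k * α k)
    (hb : ∀ h, b h = (1 / 2) * ∑ k, H2 g C φ (cotChart φ P).1 (cotChart φ P).2 h k * β k) :
    X = ∑ h, a h • deltaq g φ h P + ∑ h, b h • dp φ h P := by
  have e1 : ∀ h, formdq φ h P X = a h := fun h => by
    rw [formdq_eq_sum g hC hφ hP, ha, Finset.mul_sum]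
    refine Finset.sum_congr rfl fun k _ => ?_
    rw [← h1, naturalMetric_eq g C hφ hP]; ring
  have e2 : ∀ h, formDp g φ h P X = b h := fun h => by
    rw [formDp_eq_sum g hC hφ hP, hb, Finset.mul_sum]
    refine Finset.sum_congr rfl fun k _ => ?_
    rw [← h2, naturalMetric_eq g C hφ hP]; ring
  conv_lhs => rw [eq_sum_adaptedFrame g hφ hP X]
  simp only [e1, e2]

omit hC in
lemma sum_mul_sum_kron {H G : Fin n → Fin n → ℝ} (hHG : ∀ h i, ∑ k, H h k * G k i = kron h i)
    (hG : ∀ i j, G i j = G j i) (a : Fin n → ℝ) (h : Fin n) :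
    ∑ k, H h k * ∑ l, G l k * a l = a h := by
  simp only [Finset.mul_sum]
  rw [Finset.sum_comm]
  simp only [← mul_assoc, ← Finset.sum_mul]
  have : ∀ l, ∑ k, H h k * G l k = kron h l := fun l => by
    rw [← hHG]; exact Finset.sum_congr rfl fun k _ => by rw [hG]
  simp [this, kron]

variable (hcov : IsLeviCivita (naturalMetric g C) cov)
include hcov

/-- Against `δ/δqᵏ` the horizontal derivative of `G2` cancels the two bracket terms, so the result
is vertical. Against `∂/∂p_k` there are no brackets, which leaves the Christoffel symbols of `G2`
along the fibre. -/
lemma cov_dp_dp (hφ : φ ∈ IsManifold.maximalAtlas (𝓡 n) ∞ M) (hP : P.proj ∈ φ.source)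
    (i j : Fin n) : cov (dp φ j) P (dp φ i P) =
      ∑ h, coefQ g C φ (cotChart φ P).1 (cotChart φ P).2 h i j • dp φ h P := by
  have K := fun Z hZ => hcov.koszul g (dp φ i) (dp φ j) Z (vfDiffAt_dp hφ hP i)
    (vfDiffAt_dp hφ hP j) hZ
  have hsub := eq_of_naturalMetric g hC hφ hP (X := cov (dp φ j) P (dp φ i P)) (a := fun _ => 0)
    (b := fun h => coefQ g C φ (cotChart φ P).1 (cotChart φ P).2 h i j)
    (α := fun _ => 0) (fun k => ?_) (fun k => K _ (vfDiffAt_dp hφ hP k)) (by simp) (fun h => ?_)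
  · simpa using hsub
  · rw [K _ (vfDiffAt_deltaq g hφ hP k)]
    simp only [(mvfderiv_naturalMetric_mixed g hφ hP _ _ _).2, (mvfderiv_G2 g hC hφ hP _ _ _).2,
      mlieBracket_dp_dp hφ hP, mlieBracket_dp_deltaq g hφ hP, naturalMetric_zero_left,
      naturalMetric_sum_dp_dp g hφ hP]
    simp only [Finset.sum_add_distrib, fun l => G2_symm g C φ (cotChart φ P).1 (cotChart φ P).2 i l,
      mul_comm (Gam g φ _ _ _ _)]
    ring
  · rw [coefQ]
    simp only [(mvfderiv_G2 g hC hφ hP _ _ _).1, mlieBracket_dp_dp hφ hP, naturalMetric_zero_left,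
      add_zero, sub_zero]

/-- Against `∂/∂p_k` the Christoffel terms with upper index `k` cancel and those with upper index
`j` double, which gives `-Γ`. Against `δ/δqᵏ` there remain a vertical derivative of `G1` and the
curvature from the horizontal bracket, which form `P`. -/
lemma cov_dp_deltaq (hφ : φ ∈ IsManifold.maximalAtlas (𝓡 n) ∞ M) (hP : P.proj ∈ φ.source)
    (i j : Fin n) : cov (dp φ j) P (deltaq g φ i P) =
      -(∑ h, Gam g φ (cotChart φ P).1 j i h • dp φ h P) +
        ∑ h, coefP g C φ (cotChart φ P).1 (cotChart φ P).2 i h j • deltaq g φ h P := by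
  have K := fun Z hZ => hcov.koszul g (deltaq g φ i) (dp φ j) Z (vfDiffAt_deltaq g hφ hP i)
    (vfDiffAt_dp hφ hP j) hZ
  have hb : ∀ k l, VectorField.mlieBracket (TI n) (deltaq g φ k) (dp φ l) P =
    -∑ h, Gam g φ (cotChart φ P).1 l k h • dp φ h P := fun k l => by
      rw [VectorField.mlieBracket_swap_apply, mlieBracket_dp_deltaq g hφ hP]
  have hsub := eq_of_naturalMetric g hC hφ hP (X := cov (dp φ j) P (deltaq g φ i P))
    (a := fun h => coefP g C φ (cotChart φ P).1 (cotChart φ P).2 i h j)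
    (b := fun h => -Gam g φ (cotChart φ P).1 j i h)
    -- Here `α` is left to unification and becomes the right side of the Koszul formula; `β` is
    -- chosen so that contraction with `H2` returns `-Γ`.
    (fun k => K _ (vfDiffAt_deltaq g hφ hP k))
    (β := fun k => 2 * ∑ l, G2 g C φ (cotChart φ P).1 (cotChart φ P).2 l k *
      -Gam g φ (cotChart φ P).1 j i l)
    (fun k => ?_) (fun h => ?_) (fun h => ?_)
  · rw [hsub, add_comm]
    simp [neg_smul]
  · rw [K _ (vfDiffAt_dp hφ hP k)]
    simp only [(mvfderiv_naturalMetric_mixed g hφ hP _ _ _).1, (mvfderiv_G2 g hC hφ hP _ _ _).2,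
      mlieBracket_dp_dp hφ hP, hb, naturalMetric_zero_left, naturalMetric_neg_left,
      naturalMetric_sum_dp_dp g hφ hP]
    simp only [Finset.sum_add_distrib, fun l => G2_symm g C φ (cotChart φ P).1 (cotChart φ P).2 j l,
      mul_neg, Finset.sum_neg_distrib, mul_comm (Gam g φ _ _ _ _)]
    ring
  · rw [coefP]
    simp only [(mvfderiv_naturalMetric_mixed g hφ hP _ _ _).2, (mvfderiv_G1 g hC hφ hP _ _ _).1,
      (mvfderiv_naturalMetric_mixed g hφ hP _ _ _).1, hb, mlieBracket_deltaq_deltaq g hφ hP,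
      mlieBracket_dp_deltaq g hφ hP, naturalMetric_neg_left, naturalMetric_sum_dp_deltaq g hφ hP,
      naturalMetric_sum_dp_dp g hφ hP, zero_add, sub_zero, neg_zero, add_zero,
      fun l => G2_symm g C φ (cotChart φ P).1 (cotChart φ P).2 j l]
  · have := sum_mul_sum_kron (sum_H2_mul_G2 g hC hφ (cotChart_mem hP).1 (cotChart φ P).2)
      (G2_symm g C φ _ _) (fun l => -Gam g φ (cotChart φ P).1 j i l) h
    rw [← this, Finset.mul_sum]
    exact Finset.sum_congr rfl fun k _ => by ring

/-- The horizontal part is the Koszul computation for the parallel tensor `G1` and returns Γ. The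
vertical part collects minus the vertical derivative of `G1` and the curvature of the bracket
`[δ/δqⁱ, δ/δqʲ]`. -/
lemma cov_deltaq_deltaq (hφ : φ ∈ IsManifold.maximalAtlas (𝓡 n) ∞ M) (hP : P.proj ∈ φ.source)
    (i j : Fin n) : cov (deltaq g φ j) P (deltaq g φ i P) =
      ∑ h, Gam g φ (cotChart φ P).1 h i j • deltaq g φ h P +
        ∑ h, coefS g C φ (cotChart φ P).1 (cotChart φ P).2 h i j • dp φ h P := by
  have K := fun Z hZ => hcov.koszul g (deltaq g φ i) (deltaq g φ j) Z (vfDiffAt_deltaq g hφ hP i)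
    (vfDiffAt_deltaq g hφ hP j) hZ
  have hb : ∀ k l, VectorField.mlieBracket (TI n) (deltaq g φ k) (dp φ l) P =
    -∑ h, Gam g φ (cotChart φ P).1 l k h • dp φ h P := fun k l => by
      rw [VectorField.mlieBracket_swap_apply, mlieBracket_dp_deltaq g hφ hP]
  refine eq_of_naturalMetric g hC hφ hP
    (α := fun k => 2 * ∑ l, G1 g C φ (cotChart φ P).1 (cotChart φ P).2 l k *
      Gam g φ (cotChart φ P).1 l i j)
    (β := fun k => - vderiv k (fun y p => G1 g C φ y p i j) (cotChart φ P).1 (cotChart φ P).2 +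
      ∑ l, G2 g C φ (cotChart φ P).1 (cotChart φ P).2 l k *
        Riem0 g φ (cotChart φ P).1 (cotChart φ P).2 l i j)
    (fun k => ?_) (fun k => ?_) (fun h => ?_) (fun h => ?_)
  · rw [K _ (vfDiffAt_deltaq g hφ hP k)]
    simp only [(mvfderiv_G1 g hC hφ hP _ _ _).2, mlieBracket_deltaq_deltaq g hφ hP,
      naturalMetric_sum_dp_deltaq g hφ hP, Finset.sum_add_distrib]
    have s := fun l a b => Gam_symm g hφ (cotChart_mem hP).1 l a b
    simp only [fun l => G1_symm g C φ (cotChart φ P).1 (cotChart φ P).2 j l,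
      fun l => G1_symm g C φ (cotChart φ P).1 (cotChart φ P).2 i l, fun l => s l k i,
      fun l => s l k j, fun l => s l j i, mul_comm (Gam g φ _ _ _ _)]
    ring
  · rw [K _ (vfDiffAt_dp hφ hP k)]
    simp only [(mvfderiv_naturalMetric_mixed g hφ hP _ _ _).1, (mvfderiv_G1 g hC hφ hP _ _ _).1,
      mlieBracket_deltaq_deltaq g hφ hP, hb, naturalMetric_neg_left,
      naturalMetric_sum_dp_deltaq g hφ hP, naturalMetric_sum_dp_dp g hφ hP]
    ring
  · have := sum_mul_sum_kron (sum_H1_mul_G1 g hC hφ (cotChart_mem hP).1 (cotChart φ P).2)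
      (G1_symm g C φ _ _) (fun l => Gam g φ (cotChart φ P).1 l i j) h
    rw [← this, Finset.mul_sum]
    exact Finset.sum_congr rfl fun k _ => by ring
  · have := sum_mul_sum_kron (sum_H2_mul_G2 g hC hφ (cotChart_mem hP).1 (cotChart φ P).2)
      (G2_symm g C φ _ _) (fun l => Riem0 g φ (cotChart φ P).1 (cotChart φ P).2 l i j) h
    simp only [mul_add, mul_neg, Finset.sum_add_distrib, Finset.sum_neg_distrib, this, coefS]

lemma IsLeviCivita.hasAdaptedForm (hφ : φ ∈ IsManifold.maximalAtlas (𝓡 n) ∞ M) :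
    HasAdaptedForm g cov φ (coefQ g C φ) (coefP g C φ) (coefS g C φ) := by
  intro P hP i j
  refine ⟨cov_dp_dp g hC hcov hφ hP i j, cov_dp_deltaq g hC hcov hφ hP i j, ?_,
    cov_deltaq_deltaq g hC hcov hφ hP i j⟩
  -- The remaining mixed derivative differs from the one already found by a bracket, which removes
  -- exactly the Γ-term.
  have h := hcov.torsion_free (dp φ i) (deltaq g φ j) P (vfDiffAt_dp hφ hP i)
    (vfDiffAt_deltaq g hφ hP j)
  rw [mlieBracket_dp_deltaq g hφ hP, cov_dp_deltaq g hC hcov hφ hP, sub_eq_iff_eq_add] at h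
  rw [h]
  abel

end

end LeviCivita

/-! ### Vertical derivatives and explicit formulas for the connection coefficients -/

section Explicit

variable {n : ℕ} {M : Type*} [TopologicalSpace M] [ChartedSpace (Coord n) M]
  [IsManifold (𝓡 n) ∞ M] {φ : LocalChart n M} (g : RMetric n M)

lemma sharp_add (φ : LocalChart n M) (y α β : Coord n) :
    sharp g φ y (α + β) = sharp g φ y α + sharp g φ y β := by
  ext i; simp [sharp_apply, mul_add, Finset.sum_add_distrib]

lemma sharp_smul (φ : LocalChart n M) (y : Coord n) (r : ℝ) (α : Coord n) :
    sharp g φ y (r • α) = r • sharp g φ y α := by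
  ext i; simp [sharp_apply, Finset.mul_sum, mul_left_comm]

/-- Raising an index as a continuous linear map. -/
noncomputable def sharpL (φ : LocalChart n M) (y : Coord n) : Coord n →L[ℝ] Coord n :=
  LinearMap.toContinuousLinearMap
    { toFun := sharp g φ y
      map_add' := sharp_add g φ y
      map_smul' := sharp_smul g φ y }

lemma pair_comm (α β : Coord n) : pair α β = pair β α := by
  simp only [pair_apply, mul_comm]

lemma pair_sharp_comm (φ : LocalChart n M) (y α β : Coord n) :
    pair α (sharp g φ y β) = pair β (sharp g φ y α) := by
  rw [pair_sharp, pair_sharp, Finset.sum_comm]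
  exact Finset.sum_congr rfl fun i _ => Finset.sum_congr rfl fun j _ => by
    rw [gUp_symm g φ y j i]; ring

lemma pair_std_left (i : Fin n) (u : Coord n) : pair (stdVec i) u = u i := by
  rw [pair_comm, pair_std]

lemma sharp_std (φ : LocalChart n M) (y : Coord n) (i j : Fin n) :
    sharp g φ y (stdVec j) i = gUp g φ y i j := by
  simp [sharp_apply, stdVec_apply]

lemma pair_sharp_std (φ : LocalChart n M) (y p : Coord n) (i : Fin n) :
    pair p (sharp g φ y (stdVec i)) = g0 g φ y p i := by
  rw [pair_sharp_comm, pair_std_left, g0_eq]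

lemma vderiv_energy (φ : LocalChart n M) (y p : Coord n) (k : Fin n) :
    vderiv k (energy g φ) y p = g0 g φ y p k := by
  have h := (((pair (n := n)).hasFDerivAt (x := p)).clm_apply
    ((sharpL g φ y).hasFDerivAt (x := p))).const_mul (1 / 2)
  have h1 : energy g φ y = fun p => (1 / 2) * pair p (sharpL g φ y p) :=
    funext fun p => energy_eq g φ y p
  rw [vderiv, pderiv, h1]
  refine (congrArg (fun L => L (stdVec k)) h.fderiv).trans ?_
  change (1 / 2) * (pair p (sharp g φ y (stdVec k)) + pair (stdVec k) (sharp g φ y p)) = _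
  rw [pair_sharp_std, pair_std_left, g0_eq]
  ring

lemma vderiv_g0 (φ : LocalChart n M) (y p : Coord n) (k i : Fin n) :
    vderiv k (fun y p => g0 g φ y p i) y p = gUp g φ y i k := by
  have h := ((EuclideanSpace.proj i : Coord n →L[ℝ] ℝ).comp (sharpL g φ y)).hasFDerivAt (x := p)
  have h1 : (fun p => g0 g φ y p i) =
      ((EuclideanSpace.proj i : Coord n →L[ℝ] ℝ).comp (sharpL g φ y)) :=
    funext fun p => g0_eq g φ y p i
  rw [vderiv, pderiv, h1]
  exact (congrArg (fun L => L (stdVec k)) h.fderiv).trans (sharp_std g φ y i k)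

lemma fderiv_momentum_vert (z : Coord n × Coord n) (k i : Fin n) :
    HasFDerivAt (fun z : Coord n × Coord n => z.2 i)
      ((EuclideanSpace.proj i : Coord n →L[ℝ] ℝ).comp (ContinuousLinearMap.snd ℝ _ _)) z ∧
    ((EuclideanSpace.proj i : Coord n →L[ℝ] ℝ).comp (ContinuousLinearMap.snd ℝ (Coord n) _))
      (0, stdVec k) = kron i k := by
  refine ⟨(EuclideanSpace.proj i : Coord n →L[ℝ] ℝ).hasFDerivAt.comp z hasFDerivAt_snd, ?_⟩
  change stdVec k i = _
  simp [stdVec_apply, kron]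

lemma fderiv_comp_fst_vert {f : Coord n → ℝ} {z : Coord n × Coord n}
    (hf : DifferentiableAt ℝ f z.1) (v : Coord n) :
    fderiv ℝ (fun z : Coord n × Coord n => f z.1) z (0, v) = 0 := by
  have h := HasFDerivAt.comp (g := f) (f := Prod.fst) z hf.hasFDerivAt hasFDerivAt_fst
  refine (congrArg (fun L => L (0, v)) h.fderiv).trans ?_
  exact map_zero (fderiv ℝ f z.1)

variable {C : DiagCoeffs} (hC : C.Admissible)
include hC

lemma vderiv_G1 (hφ : φ ∈ IsManifold.maximalAtlas (𝓡 n) ∞ M) {y : Coord n} (hy : y ∈ φ.target)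
    (p : Coord n) (k i j : Fin n) : vderiv k (fun y p => G1 g C φ y p i j) y p =
      g0 g φ y p k * (deriv0 C.c₁ (energy g φ y p) * gLow g φ y i j +
        deriv0 C.d₁ (energy g φ y p) * p i * p j) +
      C.d₁ (energy g φ y p) * (kron i k * p j + p i * kron j k) := by
  have ho := isOpen_cotDomain φ
  have hz : (y, p) ∈ cotDomain φ := mem_cotDomain.2 hy
  have hc := hasFDerivAt_comp_energy g hφ hC.smooth_c₁ hz
  have hd := hasFDerivAt_comp_energy g hφ hC.smooth_d₁ hz
  have hp := fun i => (fderiv_momentum_vert (y, p) k i).1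
  have hg := (differentiableAt_of_smooth (contDiffOn_comp_fst (contDiffOn_gLow g hφ i j)) ho
    hz).hasFDerivAt
  have h := (hc.mul hg).add ((hd.mul (hp i)).mul (hp j))
  have e1 := fderiv_vert (f := fun y p => G1 g C φ y p i j) (z := (y, p))
    (differentiableAt_of_smooth (contDiffOn_G1 g hC hφ i j) ho hz) k
  have e2 := fderiv_vert (f := energy g φ) (z := (y, p))
    (differentiableAt_of_smooth (contDiffOn_energy g hφ) ho hz) k
  rw [vderiv_energy] at e2
  rw [← e1]
  refine (congrArg (fun L => L ((0, stdVec k) : Coord n × Coord n)) h.fderiv).trans ?_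
  simp only [add_apply, smul_apply, Pi.mul_apply, (fderiv_momentum_vert (y, p) k _).2, e2,
    fderiv_comp_fst_vert (z := (y, p))
      (differentiableAt_of_smooth (contDiffOn_gLow g hφ i j) φ.open_target hy), smul_eq_mul]
  ring

lemma vderiv_G2 (hφ : φ ∈ IsManifold.maximalAtlas (𝓡 n) ∞ M) {y : Coord n} (hy : y ∈ φ.target)
    (p : Coord n) (k i j : Fin n) : vderiv k (fun y p => G2 g C φ y p i j) y p =
      g0 g φ y p k * (deriv0 C.c₂ (energy g φ y p) * gUp g φ y i j +
        deriv0 C.d₂ (energy g φ y p) * g0 g φ y p i * g0 g φ y p j) +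
      C.d₂ (energy g φ y p) * (gUp g φ y i k * g0 g φ y p j + g0 g φ y p i * gUp g φ y j k) := by
  have ho := isOpen_cotDomain φ
  have hz : (y, p) ∈ cotDomain φ := mem_cotDomain.2 hy
  have hc := hasFDerivAt_comp_energy g hφ hC.smooth_c₂ hz
  have hd := hasFDerivAt_comp_energy g hφ hC.smooth_d₂ hz
  have hp := fun i => (differentiableAt_of_smooth (contDiffOn_g0 g hφ i) ho hz).hasFDerivAt
  have hg := (differentiableAt_of_smooth (contDiffOn_comp_fst (contDiffOn_gUp g hφ i j)) ho
    hz).hasFDerivAt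
  have h := (hc.mul hg).add ((hd.mul (hp i)).mul (hp j))
  have e1 := fderiv_vert (f := fun y p => G2 g C φ y p i j) (z := (y, p))
    (differentiableAt_of_smooth (contDiffOn_G2 g hC hφ i j) ho hz) k
  have e2 := fderiv_vert (f := energy g φ) (z := (y, p))
    (differentiableAt_of_smooth (contDiffOn_energy g hφ) ho hz) k
  have e3 : ∀ i, fderiv ℝ (fun z : Coord n × Coord n => g0 g φ z.1 z.2 i) (y, p) (0, stdVec k) =
      gUp g φ y i k := fun i => by
    rw [← vderiv_g0 g φ y p k i]
    exact fderiv_vert (f := fun y p => g0 g φ y p i) (z := (y, p))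
      (differentiableAt_of_smooth (contDiffOn_g0 g hφ i) ho hz) k
  rw [vderiv_energy] at e2
  rw [← e1]
  refine (congrArg (fun L => L ((0, stdVec k) : Coord n × Coord n)) h.fderiv).trans ?_
  simp only [add_apply, smul_apply, Pi.mul_apply, e2, e3,
    fderiv_comp_fst_vert (z := (y, p))
      (differentiableAt_of_smooth (contDiffOn_gUp g hφ i j) φ.open_target hy), smul_eq_mul]
  ring

/-! Contractions with the inverse matrices. -/

/-- `G_{(2)}` sends `p` to `(c₂ + 2t d₂) p♯`, so its inverse sends `p♯` to `p` divided by that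
factor. -/
lemma sum_H2_mul_g0 (hφ : φ ∈ IsManifold.maximalAtlas (𝓡 n) ∞ M) {y : Coord n}
    (hy : y ∈ φ.target) (p : Coord n) (h : Fin n) :
    ∑ k, H2 g C φ y p h k * g0 g φ y p k =
      p h / (C.c₂ (energy g φ y p) + 2 * energy g φ y p * C.d₂ (energy g φ y p)) := by
  have ht := energy_nonneg g hφ hy p
  have hc := (hC.pos_c₂ _ ht).ne'
  have hd := (hC.pos_d₂ _ ht).ne'
  have e2 := sum_gLow_mul_g0 g hφ hy p h
  have e4 := sum_momentum_mul_g0 g φ y p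
  simp only [H2, sub_mul, Finset.sum_sub_distrib, mul_assoc, ← Finset.mul_sum, e2, e4]
  set t := energy g φ y p
  obtain ⟨K, hK⟩ : ∃ K, K = C.c₂ t + 2 * t * C.d₂ t := ⟨_, rfl⟩
  have hK' : C.c₂ t + 2 * (t * C.d₂ t) = K := by rw [hK]; ring
  have h2 : C.d₂ t * (2 * t) = K - C.c₂ t := by rw [hK]; ring
  rw [← hK] at hd
  rw [hK']
  have : C.d₂ t / (C.c₂ t * K) * (p h * (2 * t)) = (C.d₂ t * (2 * t)) / (C.c₂ t * K) * p h := by ring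
  rw [this, h2]
  field_simp
  ring

lemma sum_H2_mul_gUp (hφ : φ ∈ IsManifold.maximalAtlas (𝓡 n) ∞ M) {y : Coord n}
    (hy : y ∈ φ.target) (p : Coord n) (h j : Fin n) :
    ∑ k, H2 g C φ y p h k * gUp g φ y j k = kron j h / C.c₂ (energy g φ y p) -
      C.d₂ (energy g φ y p) / (C.c₂ (energy g φ y p) *
        (C.c₂ (energy g φ y p) + 2 * energy g φ y p * C.d₂ (energy g φ y p))) *
        p h * g0 g φ y p j := by
  have e1 := sum_gLow_mul_gUp g hφ hy h j
  have e3 := sum_gUp_mul_momentum g φ y p j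
  have e5 : (kron h j : ℝ) = kron j h := by simp [kron, eq_comm]
  simp only [H2, sub_mul, Finset.sum_sub_distrib, mul_assoc, ← Finset.mul_sum]
  simp only [gUp_symm g φ y j, e1, mul_comm (p _)]
  simp only [gUp_symm g φ y _ j, e3, e5]
  ring

lemma sum_H1_mul_momentum (hφ : φ ∈ IsManifold.maximalAtlas (𝓡 n) ∞ M) {y : Coord n}
    (hy : y ∈ φ.target) (p : Coord n) (h : Fin n) :
    ∑ k, H1 g C φ y p h k * p k =
      g0 g φ y p h / (C.c₁ (energy g φ y p) + 2 * energy g φ y p * C.d₁ (energy g φ y p)) := by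
  have ht := energy_nonneg g hφ hy p
  have hc := (hC.pos_c₁ _ ht).ne'
  have hd := (hC.pos_d₁ _ ht).ne'
  have e2 := sum_gUp_mul_momentum g φ y p h
  have e4 : ∑ k, g0 g φ y p k * p k = 2 * energy g φ y p := by
    rw [← sum_momentum_mul_g0]; exact Finset.sum_congr rfl fun _ _ => mul_comm _ _
  simp only [H1, sub_mul, Finset.sum_sub_distrib, mul_assoc, ← Finset.mul_sum, e2, e4]
  set t := energy g φ y p
  obtain ⟨K, hK⟩ : ∃ K, K = C.c₁ t + 2 * t * C.d₁ t := ⟨_, rfl⟩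
  have hK' : C.c₁ t + 2 * (t * C.d₁ t) = K := by rw [hK]; ring
  have h2 : C.d₁ t * (2 * t) = K - C.c₁ t := by rw [hK]; ring
  rw [← hK] at hd
  rw [hK']
  have : C.d₁ t / (C.c₁ t * K) * (g0 g φ y p h * (2 * t)) =
    (C.d₁ t * (2 * t)) / (C.c₁ t * K) * g0 g φ y p h := by ring
  rw [this, h2]
  field_simp
  ring

lemma sum_H1_mul_gLow (hφ : φ ∈ IsManifold.maximalAtlas (𝓡 n) ∞ M) {y : Coord n}
    (hy : y ∈ φ.target) (p : Coord n) (h j : Fin n) :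
    ∑ k, H1 g C φ y p h k * gLow g φ y j k = kron h j / C.c₁ (energy g φ y p) -
      C.d₁ (energy g φ y p) / (C.c₁ (energy g φ y p) *
        (C.c₁ (energy g φ y p) + 2 * energy g φ y p * C.d₁ (energy g φ y p))) *
        g0 g φ y p h * p j := by
  have e1 := sum_gUp_mul_gLow g hφ hy h j
  have e3 := sum_gLow_mul_g0 g hφ hy p j
  simp only [H1, sub_mul, Finset.sum_sub_distrib, mul_assoc, ← Finset.mul_sum]
  simp only [gLow_symm g φ y j, e1, mul_comm (g0 g φ y p _)]
  simp only [gLow_symm g φ y _ j, e3]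
  ring

/-- In the Christoffel combination all terms with factor `d₂` cancel except `2 d₂ g^{ij} g^{0k}`,
and `d₂'` survives only once; the rest is contraction with `H2`. -/
lemma coefQ_eq (hφ : φ ∈ IsManifold.maximalAtlas (𝓡 n) ∞ M) {y : Coord n}
    (hy : y ∈ φ.target) (p : Coord n) (h i j : Fin n) :
    coefQ g C φ y p h i j =
      let t := energy g φ y p
      let K := C.c₂ t + 2 * t * C.d₂ t
      (1 / 2) * (deriv0 C.c₂ t *
        (g0 g φ y p i * (kron j h / C.c₂ t - C.d₂ t / (C.c₂ t * K) * p h * g0 g φ y p j) +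
          g0 g φ y p j * (kron i h / C.c₂ t - C.d₂ t / (C.c₂ t * K) * p h * g0 g φ y p i)) +
        ((2 * C.d₂ t - deriv0 C.c₂ t) * gUp g φ y i j +
          deriv0 C.d₂ t * g0 g φ y p i * g0 g φ y p j) * (p h / K)) := by
  simp only [coefQ, vderiv_G2 g hC hφ hy]
  rw [← sum_H2_mul_g0 g hC hφ hy p h, ← sum_H2_mul_gUp g hC hφ hy p h j,
    ← sum_H2_mul_gUp g hC hφ hy p h i]
  simp only [Finset.mul_sum, ← Finset.sum_add_distrib]
  refine Finset.sum_congr rfl fun k _ => ?_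
  rw [gUp_symm g φ y j i, gUp_symm g φ y k i, gUp_symm g φ y k j]
  ring

lemma coefS_eq (hφ : φ ∈ IsManifold.maximalAtlas (𝓡 n) ∞ M) {y : Coord n}
    (hy : y ∈ φ.target) (p : Coord n) (h i j : Fin n) :
    coefS g C φ y p h i j =
      let t := energy g φ y p
      (1 / 2) * (Riem0 g φ y p h i j -
        ((deriv0 C.c₁ t * gLow g φ y i j + deriv0 C.d₁ t * p i * p j) *
          (p h / (C.c₂ t + 2 * t * C.d₂ t)) +
        C.d₁ t * (H2 g C φ y p h i * p j + p i * H2 g C φ y p h j))) := by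
  have e : ∀ i, H2 g C φ y p h i = ∑ k, H2 g C φ y p h k * kron i k := by simp [kron]
  simp only [coefS, vderiv_G1 g hC hφ hy]
  rw [← sum_H2_mul_g0 g hC hφ hy p h, e i, e j]
  have e2 : ∀ a b c d r : ℝ, a = b * c + d → -(1 / 2 * a) + 1 / 2 * r =
      1 / 2 * (r - (b * c + d)) := fun a b c d r hh => by rw [hh]; ring
  refine e2 _ _ _ _ _ ?_
  simp only [Finset.mul_sum, Finset.sum_mul, ← Finset.sum_add_distrib]
  exact Finset.sum_congr rfl fun k _ => by ring

lemma coefP_eq (hφ : φ ∈ IsManifold.maximalAtlas (𝓡 n) ∞ M) {y : Coord n}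
    (hy : y ∈ φ.target) (p : Coord n) (h i j : Fin n) :
    coefP g C φ y p j h i =
      let t := energy g φ y p
      let K := C.c₁ t + 2 * t * C.d₁ t
      (1 / 2) * (deriv0 C.c₁ t * g0 g φ y p i *
          (kron h j / C.c₁ t - C.d₁ t / (C.c₁ t * K) * g0 g φ y p h * p j) +
        (deriv0 C.d₁ t * g0 g φ y p i * p j + C.d₁ t * kron j i) * (g0 g φ y p h / K) +
        C.d₁ t * p j * H1 g C φ y p h i -
        ∑ k, H1 g C φ y p h k * ∑ l, G2 g C φ y p i l * Riem0 g φ y p l j k) := by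
  have e : H1 g C φ y p h i = ∑ k, H1 g C φ y p h k * kron k i := by simp [kron]
  simp only [coefP, vderiv_G1 g hC hφ hy]
  rw [← sum_H1_mul_momentum g hC hφ hy p h, ← sum_H1_mul_gLow g hC hφ hy p h j, e]
  simp only [mul_sub, Finset.sum_sub_distrib]
  congr 1
  simp only [Finset.mul_sum, ← Finset.sum_add_distrib]
  exact Finset.sum_congr rfl fun k _ => by ring

end Explicit

/-! ### Smoothness of the connection coefficients -/

section Smooth

variable {n : ℕ} {M : Type*} [TopologicalSpace M] [ChartedSpace (Coord n) M]
  [IsManifold (𝓡 n) ∞ M] {φ : LocalChart n M} (g : RMetric n M)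

lemma contDiffOn_vderiv {f : Coord n → Coord n → ℝ}
    (hf : ContDiffOn ℝ ∞ (fun z : Coord n × Coord n => f z.1 z.2) (cotDomain φ)) (k : Fin n) :
    ContDiffOn ℝ ∞ (fun z : Coord n × Coord n => vderiv k f z.1 z.2) (cotDomain φ) :=
  ((contDiffOn_fderiv_of_smooth hf (isOpen_cotDomain φ)).clm_apply
    (contDiffOn_const (c := ((0, stdVec k) : Coord n × Coord n)))).congr fun _ hz =>
      (fderiv_vert (differentiableAt_of_smooth hf (isOpen_cotDomain φ) hz) k).symm

lemma contDiffOn_Riem0 (hφ : φ ∈ IsManifold.maximalAtlas (𝓡 n) ∞ M) (k i j : Fin n) :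
    ContDiffOn ℝ ∞ (fun z : Coord n × Coord n => Riem0 g φ z.1 z.2 k i j) (cotDomain φ) :=
  ContDiffOn.sum fun h _ => (contDiffOn_momentum h).mul
    (contDiffOn_comp_fst (contDiffOn_Riem g hφ h k i j))

variable {C : DiagCoeffs} (hC : C.Admissible)
include hC

lemma contDiffOn_H1 (hφ : φ ∈ IsManifold.maximalAtlas (𝓡 n) ∞ M) (i j : Fin n) :
    ContDiffOn ℝ ∞ (fun z : Coord n × Coord n => H1 g C φ z.1 z.2 i j) (cotDomain φ) := by
  have hc := contDiffOn_comp_energy g hφ hC.smooth_c₁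
  have hd := contDiffOn_comp_energy g hφ hC.smooth_d₁
  have hK := hc.add ((contDiffOn_const (c := (2 : ℝ))).mul (contDiffOn_energy g hφ) |>.mul hd)
  have h0 := fun (z : Coord n × Coord n) (hz : z ∈ cotDomain φ) => (hC.pos_c₁ _ (mapsTo_energy g hφ hz : (0 : ℝ) ≤ _)).ne'
  have h1 := fun (z : Coord n × Coord n) (hz : z ∈ cotDomain φ) => (hC.pos_d₁ _ (mapsTo_energy g hφ hz : (0 : ℝ) ≤ _)).ne'
  exact ((contDiffOn_const.div hc h0).mul (contDiffOn_comp_fst (contDiffOn_gUp g hφ i j))).sub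
    (((hd.div (hc.mul hK) fun z hz => mul_ne_zero (h0 z hz) (h1 z hz)).mul
      (contDiffOn_g0 g hφ i)).mul (contDiffOn_g0 g hφ j))

lemma contDiffOn_H2 (hφ : φ ∈ IsManifold.maximalAtlas (𝓡 n) ∞ M) (i j : Fin n) :
    ContDiffOn ℝ ∞ (fun z : Coord n × Coord n => H2 g C φ z.1 z.2 i j) (cotDomain φ) := by
  have hc := contDiffOn_comp_energy g hφ hC.smooth_c₂
  have hd := contDiffOn_comp_energy g hφ hC.smooth_d₂
  have hK := hc.add ((contDiffOn_const (c := (2 : ℝ))).mul (contDiffOn_energy g hφ) |>.mul hd)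
  have h0 := fun (z : Coord n × Coord n) (hz : z ∈ cotDomain φ) => (hC.pos_c₂ _ (mapsTo_energy g hφ hz : (0 : ℝ) ≤ _)).ne'
  have h1 := fun (z : Coord n × Coord n) (hz : z ∈ cotDomain φ) => (hC.pos_d₂ _ (mapsTo_energy g hφ hz : (0 : ℝ) ≤ _)).ne'
  exact ((contDiffOn_const.div hc h0).mul (contDiffOn_comp_fst (contDiffOn_gLow g hφ i j))).sub
    (((hd.div (hc.mul hK) fun z hz => mul_ne_zero (h0 z hz) (h1 z hz)).mul
      (contDiffOn_momentum i)).mul (contDiffOn_momentum j))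

lemma contDiffOn_coefQ (hφ : φ ∈ IsManifold.maximalAtlas (𝓡 n) ∞ M) (h i j : Fin n) :
    ContDiffOn ℝ ∞ (fun z : Coord n × Coord n => coefQ g C φ z.1 z.2 h i j) (cotDomain φ) :=
  contDiffOn_const.mul <| ContDiffOn.sum fun k _ => (contDiffOn_H2 g hC hφ h k).mul <|
    ((contDiffOn_vderiv (contDiffOn_G2 g hC hφ j k) i).add
      (contDiffOn_vderiv (contDiffOn_G2 g hC hφ i k) j)).sub
      (contDiffOn_vderiv (contDiffOn_G2 g hC hφ i j) k)

lemma contDiffOn_coefP (hφ : φ ∈ IsManifold.maximalAtlas (𝓡 n) ∞ M) (j h i : Fin n) :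
    ContDiffOn ℝ ∞ (fun z : Coord n × Coord n => coefP g C φ z.1 z.2 j h i) (cotDomain φ) :=
  contDiffOn_const.mul <| ContDiffOn.sum fun k _ => (contDiffOn_H1 g hC hφ h k).mul <|
    (contDiffOn_vderiv (contDiffOn_G1 g hC hφ j k) i).sub <| ContDiffOn.sum fun l _ =>
      (contDiffOn_G2 g hC hφ i l).mul (contDiffOn_Riem0 g hφ l j k)

lemma contDiffOn_coefS (hφ : φ ∈ IsManifold.maximalAtlas (𝓡 n) ∞ M) (h i j : Fin n) :
    ContDiffOn ℝ ∞ (fun z : Coord n × Coord n => coefS g C φ z.1 z.2 h i j) (cotDomain φ) :=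
  (contDiffOn_const.mul <| ContDiffOn.sum fun k _ => (contDiffOn_H2 g hC hφ h k).mul <|
    contDiffOn_vderiv (contDiffOn_G1 g hC hφ i j) k).neg.add
    (contDiffOn_const.mul (contDiffOn_Riem0 g hφ h i j))

end Smooth

/-! ### Index-free forms of the connection coefficients -/

section IndexFree

variable {n : ℕ} {M : Type*} [TopologicalSpace M] [ChartedSpace (Coord n) M]
  [IsManifold (𝓡 n) ∞ M] {φ ψ : LocalChart n M} (g : RMetric n M) (C : DiagCoeffs)

/-- Real-valued functions of three vectors which are linear in each of them. -/
structure IsTrilinear (F : Coord n → Coord n → Coord n → ℝ) : Prop where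
  fst : ∀ v w, IsLinearMap ℝ fun u => F u v w
  snd : ∀ u w, IsLinearMap ℝ fun v => F u v w
  trd : ∀ u v, IsLinearMap ℝ fun w => F u v w

lemma IsLinearMap.eq_sum_stdVec {f : Coord n → ℝ} (hf : IsLinearMap ℝ f) (u : Coord n) :
    f u = ∑ i, u i * f (stdVec i) := by
  conv_lhs => rw [← sum_smul_stdVec u]
  refine (map_sum (IsLinearMap.mk' f hf) _ _).trans (Finset.sum_congr rfl fun i _ => ?_)
  exact hf.map_smul _ _

lemma IsTrilinear.eq_sum {F : Coord n → Coord n → Coord n → ℝ} (hF : IsTrilinear F)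
    (u v w : Coord n) :
    F u v w = ∑ i, ∑ j, ∑ k, u i * v j * w k * F (stdVec i) (stdVec j) (stdVec k) := by
  rw [IsLinearMap.eq_sum_stdVec (hF.fst v w)]
  refine Finset.sum_congr rfl fun i _ => ?_
  rw [IsLinearMap.eq_sum_stdVec (hF.snd _ w), Finset.mul_sum]
  refine Finset.sum_congr rfl fun j _ => ?_
  rw [IsLinearMap.eq_sum_stdVec (hF.trd _ _), Finset.mul_sum, Finset.mul_sum]
  exact Finset.sum_congr rfl fun k _ => by ring

/-- The coefficient `Q` contracted with two covectors and a vector. -/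
noncomputable def formQ (φ : LocalChart n M) (y p α β u : Coord n) : ℝ :=
  let t := energy g φ y p
  let K := C.c₂ t + 2 * t * C.d₂ t
  (1 / 2) * (deriv0 C.c₂ t *
    (pair p (sharp g φ y α) * (pair β u / C.c₂ t -
        C.d₂ t / (C.c₂ t * K) * pair p u * pair p (sharp g φ y β)) +
      pair p (sharp g φ y β) * (pair α u / C.c₂ t -
        C.d₂ t / (C.c₂ t * K) * pair p u * pair p (sharp g φ y α))) +
    ((2 * C.d₂ t - deriv0 C.c₂ t) * pair α (sharp g φ y β) +
      deriv0 C.d₂ t * pair p (sharp g φ y α) * pair p (sharp g φ y β)) * (pair p u / K))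

/-- Raising an index with `H_{(1)}`. -/
noncomputable def sharpH1 (φ : LocalChart n M) (y p α : Coord n) : Coord n :=
  let t := energy g φ y p
  (1 / C.c₁ t) • sharp g φ y α - (C.d₁ t / (C.c₁ t * (C.c₁ t + 2 * t * C.d₁ t)) *
    pair p (sharp g φ y α)) • sharp g φ y p

/-- Raising an index with `G_{(2)}`. -/
noncomputable def sharpG2 (φ : LocalChart n M) (y p α : Coord n) : Coord n :=
  let t := energy g φ y p
  C.c₂ t • sharp g φ y α + (C.d₂ t * pair p (sharp g φ y α)) • sharp g φ y p

/-- The coefficient `P` contracted with two covectors and a vector. -/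
noncomputable def formP (φ : LocalChart n M) (y p α β u : Coord n) : ℝ :=
  let t := energy g φ y p
  let K := C.c₁ t + 2 * t * C.d₁ t
  (1 / 2) * (deriv0 C.c₁ t * pair p (sharp g φ y β) *
      (pair α u / C.c₁ t - C.d₁ t / (C.c₁ t * K) * pair p (sharp g φ y α) * pair p u) +
    (deriv0 C.d₁ t * pair p (sharp g φ y β) * pair p u + C.d₁ t * pair β u) *
      (pair p (sharp g φ y α) / K) +
    C.d₁ t * pair p u * pair β (sharpH1 g C φ y p α) -
    pair p (curvForm (gamForm g φ) y u (sharpH1 g C φ y p α) (sharpG2 g C φ y p β)))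

/-- The bilinear form with matrix `H^{(2)}`. -/
noncomputable def formH2 (φ : LocalChart n M) (y p u v : Coord n) : ℝ :=
  let t := energy g φ y p
  1 / C.c₂ t * gForm g φ y u v
    - C.d₂ t / (C.c₂ t * (C.c₂ t + 2 * t * C.d₂ t)) * pair p u * pair p v

/-- The coefficient `S` contracted with three vectors. -/
noncomputable def formS (φ : LocalChart n M) (y p u v w : Coord n) : ℝ :=
  let t := energy g φ y p
  (1 / 2) * (pair p (curvForm (gamForm g φ) y v w u) -
    ((deriv0 C.c₁ t * gForm g φ y v w + deriv0 C.d₁ t * pair p v * pair p w) *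
        (pair p u / (C.c₂ t + 2 * t * C.d₂ t)) +
      C.d₁ t * (formH2 g C φ y p u v * pair p w + pair p v * formH2 g C φ y p u w)))

lemma isTrilinear_formQ (φ : LocalChart n M) (y p : Coord n) :
    IsTrilinear (formQ g C φ y p) := by
  refine ⟨fun v w => ⟨fun a b => ?_, fun r a => ?_⟩, fun v w => ⟨fun a b => ?_, fun r a => ?_⟩,
    fun v w => ⟨fun a b => ?_, fun r a => ?_⟩⟩ <;>
  · simp only [formQ, sharp_add, sharp_smul, map_add, map_smul, add_apply, smul_apply, smul_eq_mul]
    ring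

lemma sharpH1_add (φ : LocalChart n M) (y p α β : Coord n) :
    sharpH1 g C φ y p (α + β) = sharpH1 g C φ y p α + sharpH1 g C φ y p β := by
  simp only [sharpH1, sharp_add, map_add, mul_add, add_smul, smul_add]
  abel

lemma sharpH1_smul (φ : LocalChart n M) (y p : Coord n) (r : ℝ) (α : Coord n) :
    sharpH1 g C φ y p (r • α) = r • sharpH1 g C φ y p α := by
  simp only [sharpH1, sharp_smul, map_smul, smul_eq_mul, smul_sub, smul_smul]
  congr 2 <;> ring

lemma sharpG2_add (φ : LocalChart n M) (y p α β : Coord n) :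
    sharpG2 g C φ y p (α + β) = sharpG2 g C φ y p α + sharpG2 g C φ y p β := by
  simp only [sharpG2, sharp_add, map_add, mul_add, add_smul, smul_add]
  abel

lemma sharpG2_smul (φ : LocalChart n M) (y p : Coord n) (r : ℝ) (α : Coord n) :
    sharpG2 g C φ y p (r • α) = r • sharpG2 g C φ y p α := by
  simp only [sharpG2, sharp_smul, map_smul, smul_eq_mul, smul_add, smul_smul]
  congr 2 <;> ring

lemma curvForm_linear (φ : LocalChart n M) (y : Coord n) (r : ℝ) (u v w u' : Coord n) :
    (curvForm (gamForm g φ) y (u + u') v w =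
      curvForm (gamForm g φ) y u v w + curvForm (gamForm g φ) y u' v w ∧
    curvForm (gamForm g φ) y v (u + u') w =
      curvForm (gamForm g φ) y v u w + curvForm (gamForm g φ) y v u' w ∧
    curvForm (gamForm g φ) y v w (u + u') =
      curvForm (gamForm g φ) y v w u + curvForm (gamForm g φ) y v w u') ∧
    (curvForm (gamForm g φ) y (r • u) v w = r • curvForm (gamForm g φ) y u v w ∧
    curvForm (gamForm g φ) y v (r • u) w = r • curvForm (gamForm g φ) y v u w ∧
    curvForm (gamForm g φ) y v w (r • u) = r • curvForm (gamForm g φ) y v w u) := by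
  refine ⟨⟨?_, ?_, ?_⟩, ?_, ?_, ?_⟩ <;>
  · simp only [curvForm, map_add, map_smul, add_apply, smul_apply]
    module

lemma isTrilinear_formP (φ : LocalChart n M) (y p : Coord n) :
    IsTrilinear (formP g C φ y p) := by
  have l := fun r u v w u' => curvForm_linear g φ y r u v w u'
  refine ⟨fun v w => ⟨fun a b => ?_, fun r a => ?_⟩, fun v w => ⟨fun a b => ?_, fun r a => ?_⟩,
    fun v w => ⟨fun a b => ?_, fun r a => ?_⟩⟩ <;>
  · simp only [formP, sharp_add, sharp_smul, sharpH1_add, sharpH1_smul, sharpG2_add, sharpG2_smul,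
      -- `curvForm_linear` bundles additivity and homogeneity; the scalar, respectively the extra
      -- vector, not occurring in the chosen identity is set to `0`.
      (l 0 _ _ _ _).1.1, (l 0 _ _ _ _).1.2.1, (l 0 _ _ _ _).1.2.2,
      (l _ _ _ _ 0).2.1, (l _ _ _ _ 0).2.2.1, (l _ _ _ _ 0).2.2.2,
      map_add, map_smul, add_apply, smul_apply, smul_eq_mul]
    ring

lemma isTrilinear_formS (φ : LocalChart n M) (y p : Coord n) :
    IsTrilinear (formS g C φ y p) := by
  have l := fun r u v w u' => curvForm_linear g φ y r u v w u'
  refine ⟨fun v w => ⟨fun a b => ?_, fun r a => ?_⟩, fun v w => ⟨fun a b => ?_, fun r a => ?_⟩,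
    fun v w => ⟨fun a b => ?_, fun r a => ?_⟩⟩ <;>
  · simp only [formS, formH2,
      (l 0 _ _ _ _).1.1, (l 0 _ _ _ _).1.2.1, (l 0 _ _ _ _).1.2.2,
      (l _ _ _ _ 0).2.1, (l _ _ _ _ 0).2.2.1, (l _ _ _ _ 0).2.2.2,
      map_add, map_smul, add_apply, smul_apply, smul_eq_mul]
    ring

/-! Values on the standard basis. -/

lemma gForm_std (φ : LocalChart n M) (y : Coord n) (i j : Fin n) :
    gForm g φ y (stdVec i) (stdVec j) = gLow g φ y i j := (gLow_eq g φ y i j).symm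

lemma stdVec_eq_kron (i j : Fin n) : stdVec i j = kron i j := by
  rw [stdVec_apply]; simp [kron, eq_comm]

lemma g0_std (φ : LocalChart n M) (y : Coord n) (i j : Fin n) :
    g0 g φ y (stdVec i) j = gUp g φ y i j := by
  rw [g0_eq, sharp_std, gUp_symm]

lemma Riem0_eq (hφ : φ ∈ IsManifold.maximalAtlas (𝓡 n) ∞ M) {y : Coord n} (hy : y ∈ φ.target)
    (p : Coord n) (k i j : Fin n) : Riem0 g φ y p k i j =
      pair p (curvForm (gamForm g φ) y (stdVec i) (stdVec j) (stdVec k)) := by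
  simp only [Riem0, pair_apply, curvForm_std g hφ hy]

lemma sharpH1_std (φ : LocalChart n M) (y p : Coord n) (h k : Fin n) :
    sharpH1 g C φ y p (stdVec h) k = H1 g C φ y p h k := by
  simp only [sharpH1, H1, pair_sharp_std, PiLp.sub_apply, PiLp.smul_apply, smul_eq_mul,
    ← g0_eq, g0_std]

lemma sharpG2_std (φ : LocalChart n M) (y p : Coord n) (h k : Fin n) :
    sharpG2 g C φ y p (stdVec h) k = G2 g C φ y p h k := by
  simp only [sharpG2, G2, pair_sharp_std, PiLp.add_apply, PiLp.smul_apply, smul_eq_mul,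
    ← g0_eq, g0_std]

lemma sum_curv (hφ : φ ∈ IsManifold.maximalAtlas (𝓡 n) ∞ M) {y : Coord n} (hy : y ∈ φ.target)
    (p a b : Coord n) (j : Fin n) :
    ∑ k, a k * ∑ l, b l * Riem0 g φ y p l j k =
      pair p (curvForm (gamForm g φ) y (stdVec j) a b) := by
  have hl := fun r u v w u' => curvForm_linear g φ y r u v w u'
  have h1 : ∀ k, IsLinearMap ℝ
      fun b => pair p (curvForm (gamForm g φ) y (stdVec j) (stdVec k) b) := fun k =>
    ⟨fun u v => by rw [(hl 0 _ _ _ _).1.2.2, map_add],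
      fun r u => by rw [(hl _ _ _ _ 0).2.2.2, map_smul]⟩
  have h2 : IsLinearMap ℝ fun a => pair p (curvForm (gamForm g φ) y (stdVec j) a b) :=
    ⟨fun u v => by rw [(hl 0 _ _ _ _).1.2.1, map_add],
      fun r u => by rw [(hl _ _ _ _ 0).2.2.1, map_smul]⟩
  rw [IsLinearMap.eq_sum_stdVec h2]
  refine Finset.sum_congr rfl fun k _ => ?_
  rw [IsLinearMap.eq_sum_stdVec (h1 k)]
  simp only [Riem0_eq g hφ hy]

variable {C} (hC : C.Admissible)
include hC

lemma coefQ_eq_formQ (hφ : φ ∈ IsManifold.maximalAtlas (𝓡 n) ∞ M) {y : Coord n}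
    (hy : y ∈ φ.target) (p : Coord n) (h i j : Fin n) :
    coefQ g C φ y p h i j = formQ g C φ y p (stdVec i) (stdVec j) (stdVec h) := by
  rw [coefQ_eq g hC hφ hy]
  simp only [formQ, pair_sharp_std, pair_std, g0_std, stdVec_eq_kron]

lemma coefP_eq_formP (hφ : φ ∈ IsManifold.maximalAtlas (𝓡 n) ∞ M) {y : Coord n}
    (hy : y ∈ φ.target) (p : Coord n) (h i j : Fin n) :
    coefP g C φ y p j h i = formP g C φ y p (stdVec h) (stdVec i) (stdVec j) := by
  rw [coefP_eq g hC hφ hy]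
  simp only [formP, pair_sharp_std, pair_std, ← sum_curv g hφ hy, sharpG2_std]
  have e : (kron i j : ℝ) = kron j i := by simp [kron, eq_comm]
  simp only [pair_std_left, sharpH1_std, stdVec_eq_kron, e]

lemma coefS_eq_formS (hφ : φ ∈ IsManifold.maximalAtlas (𝓡 n) ∞ M) {y : Coord n}
    (hy : y ∈ φ.target) (p : Coord n) (h i j : Fin n) :
    coefS g C φ y p h i j = formS g C φ y p (stdVec h) (stdVec i) (stdVec j) := by
  rw [coefS_eq g hC hφ hy]
  simp only [formS, formH2, H2, gForm_std, pair_std, Riem0_eq g hφ hy]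

end IndexFree

/-! ### The connection coefficients are M-tensor fields -/

section MTensorFields

variable {n : ℕ} {M : Type*} [TopologicalSpace M] [ChartedSpace (Coord n) M]
  [IsManifold (𝓡 n) ∞ M] {φ ψ : LocalChart n M} (g : RMetric n M) (C : DiagCoeffs) {P : TStar n M}

/-- Peels one index off a multi-index, turning the sums in `IsMTensorField` into iterated sums. -/
lemma sum_fin_succ_arrow {ι : Type*} [Fintype ι] {r : ℕ} (f : (Fin (r + 1) → ι) → ℝ) :
    ∑ v, f v = ∑ i, ∑ v : Fin r → ι, f (Matrix.vecCons i v) := by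
  classical
  rw [← (Fin.consEquiv fun _ => ι).sum_comp, Fintype.sum_prod_type]
  rfl

lemma sum_fin_zero_arrow {ι : Type*} [Fintype ι] (f : (Fin 0 → ι) → ℝ) :
    ∑ v, f v = f ![] := by
  classical
  simp [Subsingleton.elim _ ![]]

/-- `α'` are the components in the chart `ψ` of the covector at `π(P)` with components `α` in the
chart `φ`. -/
def SameCovector (φ ψ : LocalChart n M) (P : TStar n M) (α α' : Coord n) : Prop :=
  ∀ u, pair α' (fderiv ℝ (trans φ ψ) (φ P.proj) u) = pair α u

section Invariance

variable (hφ : φ ∈ IsManifold.maximalAtlas (𝓡 n) ∞ M) (hψ : ψ ∈ IsManifold.maximalAtlas (𝓡 n) ∞ M)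
  (hP : P.proj ∈ φ.source) (hP' : P.proj ∈ ψ.source)
include hφ hψ hP hP'

lemma sharp_of_sameCovector {α α' : Coord n} (h : SameCovector φ ψ P α α') :
    sharp g ψ (cotChart ψ P).1 α' =
      fderiv ℝ (trans φ ψ) (φ P.proj) (sharp g φ (cotChart φ P).1 α) := by
  have := sharp_trans g hφ hψ (mem_overlap hP hP') h
  rw [trans_proj hP] at this
  exact this

/-- Every ingredient is intrinsic: the energy, pairings of covectors with vectors, and raised
covectors. -/
lemma formQ_trans {α α' β β' : Coord n} (hα : SameCovector φ ψ P α α')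
    (hβ : SameCovector φ ψ P β β') (u : Coord n) :
    formQ g C ψ (cotChart ψ P).1 (cotChart ψ P).2 α' β'
      (fderiv ℝ (trans φ ψ) (φ P.proj) u) =
    formQ g C φ (cotChart φ P).1 (cotChart φ P).2 α β u := by
  simp only [formQ, sharp_of_sameCovector g hφ hψ hP hP' hα,
    sharp_of_sameCovector g hφ hψ hP hP' hβ, energy_trans g hφ hψ hP hP',
    pair_trans hφ hψ hP hP', hα _, hβ _]

lemma sharpH1_trans {α α' : Coord n} (hα : SameCovector φ ψ P α α') :
    sharpH1 g C ψ (cotChart ψ P).1 (cotChart ψ P).2 α' = fderiv ℝ (trans φ ψ) (φ P.proj)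
      (sharpH1 g C φ (cotChart φ P).1 (cotChart φ P).2 α) := by
  simp only [sharpH1, sharp_of_sameCovector g hφ hψ hP hP' hα,
    sharp_of_sameCovector g hφ hψ hP hP' (pair_trans hφ hψ hP hP'),
    energy_trans g hφ hψ hP hP', pair_trans hφ hψ hP hP', map_sub, map_smul]

lemma sharpG2_trans {α α' : Coord n} (hα : SameCovector φ ψ P α α') :
    sharpG2 g C ψ (cotChart ψ P).1 (cotChart ψ P).2 α' = fderiv ℝ (trans φ ψ) (φ P.proj)
      (sharpG2 g C φ (cotChart φ P).1 (cotChart φ P).2 α) := by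
  simp only [sharpG2, sharp_of_sameCovector g hφ hψ hP hP' hα,
    sharp_of_sameCovector g hφ hψ hP hP' (pair_trans hφ hψ hP hP'),
    energy_trans g hφ hψ hP hP', pair_trans hφ hψ hP hP', map_add, map_smul]

lemma curvForm_cotChart_trans (u v w : Coord n) :
    curvForm (gamForm g ψ) (cotChart ψ P).1 (fderiv ℝ (trans φ ψ) (φ P.proj) u)
        (fderiv ℝ (trans φ ψ) (φ P.proj) v) (fderiv ℝ (trans φ ψ) (φ P.proj) w) =
      fderiv ℝ (trans φ ψ) (φ P.proj) (curvForm (gamForm g φ) (cotChart φ P).1 u v w) := by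
  have := curvForm_trans g hφ hψ (mem_overlap hP hP') u v w
  rw [trans_proj hP] at this
  exact this.symm

lemma formP_trans {α α' β β' : Coord n} (hα : SameCovector φ ψ P α α')
    (hβ : SameCovector φ ψ P β β') (u : Coord n) :
    formP g C ψ (cotChart ψ P).1 (cotChart ψ P).2 α' β'
      (fderiv ℝ (trans φ ψ) (φ P.proj) u) =
    formP g C φ (cotChart φ P).1 (cotChart φ P).2 α β u := by
  simp only [formP, sharp_of_sameCovector g hφ hψ hP hP' hα,
    sharp_of_sameCovector g hφ hψ hP hP' hβ, energy_trans g hφ hψ hP hP',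
    sharpH1_trans g C hφ hψ hP hP' hα, sharpG2_trans g C hφ hψ hP hP' hβ,
    curvForm_cotChart_trans g hφ hψ hP hP', pair_trans hφ hψ hP hP', hα _, hβ _]

lemma gForm_cotChart_trans (u v : Coord n) :
    gForm g ψ (cotChart ψ P).1 (fderiv ℝ (trans φ ψ) (φ P.proj) u)
      (fderiv ℝ (trans φ ψ) (φ P.proj) v) = gForm g φ (cotChart φ P).1 u v := by
  have := gForm_trans g hφ hψ (mem_overlap hP hP') u v
  rw [trans_proj hP] at this
  exact this.symm

lemma formS_trans (u v w : Coord n) :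
    formS g C ψ (cotChart ψ P).1 (cotChart ψ P).2 (fderiv ℝ (trans φ ψ) (φ P.proj) u)
      (fderiv ℝ (trans φ ψ) (φ P.proj) v) (fderiv ℝ (trans φ ψ) (φ P.proj) w) =
    formS g C φ (cotChart φ P).1 (cotChart φ P).2 u v w := by
  simp only [formS, formH2, energy_trans g hφ hψ hP hP', gForm_cotChart_trans g hφ hψ hP hP',
    curvForm_cotChart_trans g hφ hψ hP hP', pair_trans hφ hψ hP hP']

/-- The covector `dx'ᵃ` of the chart `ψ` has the `a`-th row of the Jacobian as its components in
`φ`. -/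
lemma sameCovector_stdVec (a : Fin n) :
    SameCovector φ ψ P (WithLp.toLp 2 fun i => jac φ ψ (φ P.proj) a i) (stdVec a) := fun u => by
  rw [pair_std_left, fderiv_trans_apply hφ hψ (mem_overlap hP hP'), pair_apply]

/-- Dually, the components in `φ` of the `c`-th coordinate vector of `ψ` form a column of the
inverse Jacobian. -/
lemma exists_fderiv_trans_eq_stdVec (c : Fin n) :
    fderiv ℝ (trans φ ψ) (φ P.proj) (WithLp.toLp 2 fun i => jac ψ φ (ψ P.proj) i c) =
      stdVec c := by
  have h : (WithLp.toLp 2 fun i => jac ψ φ (ψ P.proj) i c) =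
      fderiv ℝ (trans ψ φ) (ψ P.proj) (stdVec c) := by
    ext i
    exact jac_eq hψ hφ (mem_overlap hP' hP) i c
  rw [h, fderiv_trans_fderiv_trans hψ hφ hP' hP]

end Invariance

variable {C} (hC : C.Admissible)
include hC

/-- The coefficient in `ψ` is `formQ` on basis elements of `ψ`. Read in `φ`, these are rows and
columns of Jacobians, and trilinear expansion produces the transformation law. -/
theorem isMTensorField_coefQ :
    IsMTensorField n M 2 1 (fun φ y p up low => coefQ g C φ y p (low 0) (up 0) (up 1)) := by
  refine ⟨fun φ hφ up low => contDiffOn_coefQ g hC hφ _ _ _, fun φ hφ ψ hψ P hP hP' up low => ?_⟩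
  have h := formQ_trans g C hφ hψ hP hP' (sameCovector_stdVec hφ hψ hP hP' (up 0))
    (sameCovector_stdVec hφ hψ hP hP' (up 1)) (WithLp.toLp 2 fun i => jac ψ φ (ψ P.proj) i (low 0))
  rw [exists_fderiv_trans_eq_stdVec hφ hψ hP hP', (isTrilinear_formQ g C φ _ _).eq_sum] at h
  rw [coefQ_eq_formQ g hC hψ (cotChart_mem hP').1, h]
  simp only [sum_fin_succ_arrow, sum_fin_zero_arrow, Fin.prod_univ_two, Fin.prod_univ_one,
    Matrix.cons_val, coefQ_eq_formQ g hC hφ (cotChart_mem hP).1]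

theorem isMTensorField_coefP :
    IsMTensorField n M 2 1 (fun φ y p up low => coefP g C φ y p (low 0) (up 0) (up 1)) := by
  refine ⟨fun φ hφ up low => contDiffOn_coefP g hC hφ _ _ _, fun φ hφ ψ hψ P hP hP' up low => ?_⟩
  have h := formP_trans g C hφ hψ hP hP' (sameCovector_stdVec hφ hψ hP hP' (up 0))
    (sameCovector_stdVec hφ hψ hP hP' (up 1)) (WithLp.toLp 2 fun i => jac ψ φ (ψ P.proj) i (low 0))
  rw [exists_fderiv_trans_eq_stdVec hφ hψ hP hP', (isTrilinear_formP g C φ _ _).eq_sum] at h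
  rw [coefP_eq_formP g hC hψ (cotChart_mem hP').1, h]
  simp only [sum_fin_succ_arrow, sum_fin_zero_arrow, Fin.prod_univ_two, Fin.prod_univ_one,
    Matrix.cons_val, coefP_eq_formP g hC hφ (cotChart_mem hP).1]

theorem isMTensorField_coefS :
    IsMTensorField n M 0 3 (fun φ y p _ low => coefS g C φ y p (low 0) (low 1) (low 2)) := by
  refine ⟨fun φ hφ up low => contDiffOn_coefS g hC hφ _ _ _, fun φ hφ ψ hψ P hP hP' up low => ?_⟩
  have h := formS_trans g C hφ hψ hP hP' (WithLp.toLp 2 fun i => jac ψ φ (ψ P.proj) i (low 0))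
    (WithLp.toLp 2 fun i => jac ψ φ (ψ P.proj) i (low 1))
    (WithLp.toLp 2 fun i => jac ψ φ (ψ P.proj) i (low 2))
  simp only [exists_fderiv_trans_eq_stdVec hφ hψ hP hP'] at h
  rw [(isTrilinear_formS g C φ _ _).eq_sum] at h
  rw [coefS_eq_formS g hC hψ (cotChart_mem hP').1, h]
  simp only [sum_fin_succ_arrow, sum_fin_zero_arrow, Fin.prod_univ_three, Fin.prod_univ_zero,
    one_mul, Matrix.cons_val, coefS_eq_formS g hC hφ (cotChart_mem hP).1]

end MTensorFields

/-! ### Constant sectional curvature -/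

section ConstantCurvature

/-- An algebraic curvature tensor with vanishing sectional curvatures is zero. -/
lemma curvatureTensor_eq_zero {E : Type*} [AddCommGroup E] {F : E → E → E → E → ℝ}
    (hadd : ∀ u u' v w x, F (u + u') v w x = F u v w x + F u' v w x)
    (hadd' : ∀ u v w w' x, F u v (w + w') x = F u v w x + F u v w' x)
    (hswap : ∀ u v w x, F u v w x = -F v u w x) (hskew : ∀ u v w x, F u v w x = -F u v x w)
    (hbianchi : ∀ u v w x, F u v w x + F v w u x + F w u v x = 0)
    (hsec : ∀ u v, F u v v u = 0) (u v w x : E) : F u v w x = 0 := by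
  -- Pair symmetry, from the four Bianchi identities obtained by rotating the arguments.
  have hpair : ∀ u v w x, F u v w x = F w x u v := fun u v w x => by
    linarith [hbianchi u v w x, hbianchi v w x u, hbianchi w x u v, hbianchi x u v w,
      hswap u v w x, hswap v w u x, hswap w u v x, hswap v w x u, hswap w x v u, hswap x v w u,
      hswap w x u v, hswap x u w v, hswap u w x v, hswap x u v w, hswap u v x w, hswap v x u w,
      hskew u v w x, hskew v w u x, hskew w u v x, hskew w x u v, hskew x u v w, hskew v x u w,
      hskew u w x v, hskew x v w u, hskew x v u w, hskew u w v x]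
  -- Polarization of `hsec` in the first vector; pair symmetry identifies the two cross terms.
  have h1 : ∀ u v x, F u v v x = 0 := fun u v x => by
    have e := hsec (u + x) v
    rw [hadd, hskew u v v, hskew x v v, hadd', hadd'] at e
    linarith [hsec u v, hsec x v, hskew u v v u, hskew x v v x, hskew u v v x, hskew x v v u,
      hpair x v v u, hswap v u x v, hskew u v x v]
  -- Polarization in the repeated vector makes `F` alternate in the middle slots as well. It is then
  -- cyclically invariant in the first three, and the Bianchi identity reads `3F = 0`.
  have h2 : ∀ u v w x, F u v w x = -F u w v x := fun u v w x => by
    have e := h1 u (v + w) x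
    rw [hswap, hadd, hadd', hadd'] at e
    linarith [h1 u v x, h1 u w x, hswap v u v x, hswap w u w x, hswap v u w x, hswap w u v x]
  linarith [hbianchi u v w x, h2 v w u x, hswap v u w x, h2 u w v x, hswap w u v x]

variable {n : ℕ} {M : Type*} [TopologicalSpace M] [ChartedSpace (Coord n) M]
  [IsManifold (𝓡 n) ∞ M] {φ : LocalChart n M} (g : RMetric n M) {c : ℝ}

lemma gPair_eq (φ : LocalChart n M) (y u v : Coord n) : gPair g φ y u v = gForm g φ y u v :=
  (gForm_apply g φ y u v).symm

lemma curvForm_apply (hφ : φ ∈ IsManifold.maximalAtlas (𝓡 n) ∞ M) {y : Coord n}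
    (hy : y ∈ φ.target) (u v w : Coord n) (h : Fin n) :
    curvForm (gamForm g φ) y u v w h = ∑ k, ∑ i, ∑ j, Riem g φ y h k i j * u i * v j * w k := by
  have l := fun r u v w u' => curvForm_linear g φ y r u v w u'
  have e := IsTrilinear.eq_sum (F := fun w u v => curvForm (gamForm g φ) y u v w h)
    ⟨fun v w => ⟨fun a b => by simp only [(l 0 _ _ _ _).1.2.2, PiLp.add_apply],
      fun r a => by simp only [(l _ _ _ _ 0).2.2.2, PiLp.smul_apply]⟩,
    fun v w => ⟨fun a b => by simp only [(l 0 _ _ _ _).1.1, PiLp.add_apply],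
      fun r a => by simp only [(l _ _ _ _ 0).2.1, PiLp.smul_apply]⟩,
    fun v w => ⟨fun a b => by simp only [(l 0 _ _ _ _).1.2.1, PiLp.add_apply],
      fun r a => by simp only [(l _ _ _ _ 0).2.2.1, PiLp.smul_apply]⟩⟩ w u v
  refine e.trans (Finset.sum_congr rfl fun k _ => Finset.sum_congr rfl fun i _ =>
    Finset.sum_congr rfl fun j _ => ?_)
  rw [curvForm_std g hφ hy]
  ring

lemma gForm_sq_lt (hφ : φ ∈ IsManifold.maximalAtlas (𝓡 n) ∞ M) {y : Coord n} (hy : y ∈ φ.target)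
    {u v : Coord n} (h : LinearIndependent ℝ ![u, v]) :
    0 < gForm g φ y u u * gForm g φ y v v - gForm g φ y u v ^ 2 := by
  have hv : v ≠ 0 := h.ne_zero 1
  have hvv := gForm_pos g hφ hy hv
  -- Strict Cauchy–Schwarz: the square of this vector, up to scale the part of `u` orthogonal to
  -- `v`, is `g(v,v)` times the Gram determinant.
  have hw : gForm g φ y v v • u - gForm g φ y u v • v ≠ 0 := fun h0 => by
    rw [sub_eq_add_neg, ← neg_smul] at h0
    exact hvv.ne' (LinearIndependent.pair_iff.1 h _ _ h0).1
  have hww := gForm_pos g hφ hy hw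
  simp only [map_sub, map_smul, sub_apply, smul_apply, smul_eq_mul, gForm_symm g φ y v u] at hww
  refine pos_of_mul_pos_right (a := gForm g φ y v v) ?_ hvv.le
  nlinarith [hww]

/-- Clearing the denominator extends the curvature condition to dependent pairs, where both sides
vanish; only then can it be polarized. -/
lemma gForm_curvForm (hc : HasConstantCurvature g c) (hφ : φ ∈ IsManifold.maximalAtlas (𝓡 n) ∞ M)
    {y : Coord n} (hy : y ∈ φ.target) (u v : Coord n) :
    gForm g φ y (curvForm (gamForm g φ) y u v v) u =
      c * (gForm g φ y u u * gForm g φ y v v - gForm g φ y u v ^ 2) := by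
  by_cases h : LinearIndependent ℝ ![u, v]
  · have h' : LinearIndependent ℝ ![(u : Fin n → ℝ), (v : Fin n → ℝ)] := by
      rw [LinearIndependent.pair_iff] at h ⊢
      exact fun s t hst => h s t (PiLp.ext fun i => congrFun hst i)
    have e := hc φ hφ y hy u v h'
    have hn : (fun h => ∑ k, ∑ i, ∑ j, Riem g φ y h k i j * u i * v j * v k) =
        WithLp.ofLp (curvForm (gamForm g φ) y u v v) :=
      funext fun h => (curvForm_apply g hφ hy u v v h).symm
    rw [sectionalCurvature, hn, gPair_eq, gPair_eq, gPair_eq, gPair_eq,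
      div_eq_iff (gForm_sq_lt g hφ hy h).ne'] at e
    exact e
  · have hz : ∀ a, curvForm (gamForm g φ) y a a = 0 := fun a => by
      funext w; simp [curvForm]
    by_cases hu : u = 0
    · subst hu
      simp
    · rw [LinearIndependent.pair_iff' hu] at h
      push Not at h
      obtain ⟨a, rfl⟩ := h
      rw [(curvForm_linear g φ y a u u (a • u) 0).2.2.1, hz]
      simp
      right
      ring

/-- The curvature minus the model tensor has all the symmetries of a curvature tensor and zero
sectional curvature, hence vanishes by `curvatureTensor_eq_zero`. -/
lemma curvForm_of_constantCurvature (hc : HasConstantCurvature g c)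
    (hφ : φ ∈ IsManifold.maximalAtlas (𝓡 n) ∞ M) {y : Coord n} (hy : y ∈ φ.target)
    (u v w : Coord n) :
    curvForm (gamForm g φ) y u v w = c • (gForm g φ y v w • u - gForm g φ y u w • v) := by
  have hm := isCoordMetric g hφ
  have l := fun r u v w u' => curvForm_linear g φ y r u v w u'
  refine hm.ext hy fun x => ?_
  rw [← sub_eq_zero]
  simp only [map_smul, map_sub, smul_apply, sub_apply, smul_eq_mul]
  have s := gForm_symm g φ y
  refine curvatureTensor_eq_zero (F := fun u v w x =>
    gForm g φ y (curvForm (gamForm g φ) y u v w) x -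
      c * (gForm g φ y v w * gForm g φ y u x - gForm g φ y u w * gForm g φ y v x))
    (fun u u' v w x => ?_) (fun u v w w' x => ?_) (fun u v w x => ?_) (fun u v w x => ?_)
    (fun u v w x => ?_) (fun u v => ?_) u v w x
  · simp only [(l 0 _ _ _ _).1.1, map_add, add_apply]; ring
  · simp only [(l 0 _ _ _ _).1.2.2, map_add, add_apply]; ring
  · simp only [curvForm_swap _ y u v w, map_neg, neg_apply]; ring
  · simp only [hm.curv_skew hy u v w x, s w]; ring
  · have := congrArg (fun z => gForm g φ y z x) (hm.curv_bianchi hy u v w)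
    simp only [map_add, add_apply, map_zero, zero_apply] at this
    rw [s w u, s w v, s v u]
    linear_combination this
  · simp only [gForm_curvForm g hc hφ hy]
    rw [s v u]; ring

lemma Riem0_of_constantCurvature (hc : HasConstantCurvature g c)
    (hφ : φ ∈ IsManifold.maximalAtlas (𝓡 n) ∞ M) {y : Coord n} (hy : y ∈ φ.target)
    (p : Coord n) (k i j : Fin n) :
    Riem0 g φ y p k i j = c * (gLow g φ y j k * p i - gLow g φ y i k * p j) := by
  rw [Riem0_eq g hφ hy, curvForm_of_constantCurvature g hc hφ hy]
  simp [gForm_std, pair_std]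

end ConstantCurvature

/-! ### The Kähler coefficients -/

section Kahler

variable {A c : ℝ} {lam : ℝ → ℝ}

lemma kahler_c₁_add (hA : 0 < A) (t : ℝ) :
    (kahlerCoeffs A c lam).c₁ t + 2 * t * (kahlerCoeffs A c lam).d₁ t =
      (A ^ 2 - 2 * c * t * lam t ^ 2) / A := by
  simp only [kahlerCoeffs]
  field_simp
  ring

/-- Over the common denominator, the `cλ⁴` terms cancel and the numerator is the square `A²(λ +
2tλ')²`. -/
lemma kahler_c₂_add (hA : 0 < A) {t : ℝ} (hD : 0 < A ^ 2 - 2 * c * t * lam t ^ 2) :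
    (kahlerCoeffs A c lam).c₂ t + 2 * t * (kahlerCoeffs A c lam).d₂ t =
      A * (lam t + 2 * t * deriv0 lam t) ^ 2 / (A ^ 2 - 2 * c * t * lam t ^ 2) := by
  simp only [kahlerCoeffs]
  obtain ⟨D, hD'⟩ : ∃ D, D = A ^ 2 - 2 * c * t * lam t ^ 2 := ⟨_, rfl⟩
  rw [← hD'] at hD ⊢
  field_simp
  rw [hD']
  ring

variable (hA : 0 < A) (hl : ContDiffOn ℝ ∞ lam (Ici 0))
  (hpos : ∀ t, 0 ≤ t → 0 < lam t ∧ 0 < A ^ 2 - 2 * c * t * lam t ^ 2 ∧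
    0 < lam t + 2 * t * deriv0 lam t)
include hA hl hpos

lemma kahlerCoeffs_admissible : (kahlerCoeffs A c lam).Admissible where
  smooth_c₁ := contDiffOn_const
  smooth_c₂ := (hl.pow 2).div_const A
  smooth_d₁ := ((contDiffOn_const.mul (hl.pow 2)).div_const A).neg
  smooth_d₂ := by
    have hl' := contDiffOn_deriv0 hl
    refine ContDiffOn.div ((contDiffOn_const.mul (hl.pow 4)).add ((contDiffOn_const.mul hl').mul
      (hl.add (hl'.mul contDiffOn_id)))) (contDiffOn_const.mul (contDiffOn_const.sub
      ((contDiffOn_const.mul contDiffOn_id).mul (hl.pow 2)))) fun t ht => ?_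
    exact mul_ne_zero hA.ne' (hpos t ht).2.1.ne'
  pos_c₁ _ _ := hA
  pos_c₂ t ht := div_pos (pow_pos (hpos t ht).1 2) hA
  pos_d₁ t ht := by
    rw [kahler_c₁_add hA]
    exact div_pos (hpos t ht).2.1 hA
  pos_d₂ t ht := by
    rw [kahler_c₂_add hA (hpos t ht).2.1]
    exact div_pos (mul_pos hA (pow_pos (hpos t ht).2.2 2)) (hpos t ht).2.1

omit hA hl hpos in
lemma deriv0_eq {f : ℝ → ℝ} {t d : ℝ} (ht : 0 ≤ t) (h : HasDerivWithinAt f d (Ici 0) t) :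
    deriv0 f t = d :=
  h.derivWithin (uniqueDiffOn_Ici 0 t ht)

omit hA hl hpos in
lemma hasDerivWithinAt_deriv0 {f : ℝ → ℝ} (hf : ContDiffOn ℝ ∞ f (Ici 0)) {t : ℝ} (ht : 0 ≤ t) :
    HasDerivWithinAt f (deriv0 f t) (Ici 0) t :=
  (hf.differentiableOn (by simp) t ht).hasDerivWithinAt

omit hA hl hpos in
lemma deriv0_kahler_c₁ {t : ℝ} (ht : 0 ≤ t) : deriv0 (kahlerCoeffs A c lam).c₁ t = 0 :=
  deriv0_eq ht (hasDerivWithinAt_const t _ A)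

omit hA hpos in
lemma deriv0_kahler_c₂ {t : ℝ} (ht : 0 ≤ t) :
    deriv0 (kahlerCoeffs A c lam).c₂ t = 2 * lam t * deriv0 lam t / A := by
  refine deriv0_eq ht ((((hasDerivWithinAt_deriv0 hl ht).pow 2).div_const A).congr_deriv ?_)
  norm_num

omit hA hpos in
lemma deriv0_kahler_d₁ {t : ℝ} (ht : 0 ≤ t) :
    deriv0 (kahlerCoeffs A c lam).d₁ t = -(2 * c * lam t * deriv0 lam t / A) := by
  refine deriv0_eq ht
    (((((hasDerivWithinAt_deriv0 hl ht).pow 2).const_mul c).div_const A).neg.congr_deriv ?_)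
  norm_num
  ring

/-- Quotient rule; the derivative of `A² - 2ctλ²` is `-2cλ(λ + 2tλ')`. -/
lemma deriv0_kahler_d₂ {t : ℝ} (ht : 0 ≤ t) :
    deriv0 (kahlerCoeffs A c lam).d₂ t =
      ((4 * c * lam t ^ 3 * deriv0 lam t + 2 * A ^ 2 * (deriv0 (deriv0 lam) t *
          (lam t + deriv0 lam t * t) + deriv0 lam t *
            (2 * deriv0 lam t + deriv0 (deriv0 lam) t * t))) *
          (A ^ 2 - 2 * c * t * lam t ^ 2) +
        (c * lam t ^ 4 + 2 * A ^ 2 * deriv0 lam t * (lam t + deriv0 lam t * t)) *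
          (2 * c * lam t * (lam t + 2 * t * deriv0 lam t))) /
        (A * (A ^ 2 - 2 * c * t * lam t ^ 2) ^ 2) := by
  refine deriv0_eq ht ?_
  have h0 := hasDerivWithinAt_deriv0 hl ht
  have h1 := hasDerivWithinAt_deriv0 (contDiffOn_deriv0 hl) ht
  have hid := hasDerivWithinAt_id t (Ici (0 : ℝ))
  have hD := (hpos t ht).2.1
  have h := (((h0.pow 4).const_mul c).add ((h1.const_mul (2 * A ^ 2)).mul
    (h0.add (h1.mul hid)))).div (((hid.const_mul (2 * c)).mul (h0.pow 2)).const_sub (A ^ 2)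
      |>.const_mul A) (mul_ne_zero hA.ne' hD.ne')
  refine h.congr_deriv ?_
  simp only [Pi.add_apply, Pi.mul_apply, Pi.pow_apply, id]
  obtain ⟨D, hD'⟩ : ∃ D, D = A ^ 2 - 2 * c * t * lam t ^ 2 := ⟨_, rfl⟩
  rw [← hD'] at hD ⊢
  field_simp
  norm_num
  ring

variable {n : ℕ} {M : Type*} [TopologicalSpace M] [ChartedSpace (Coord n) M]
  [IsManifold (𝓡 n) ∞ M] {φ : LocalChart n M} (g : RMetric n M)

/-- Since `c₁' = 0` and `d₁ = -c c₂`, the `g_{ih} p_j` term of the curvature cancels the one coming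
from `H2`, and the `g_{hj} p_i` terms add up. -/
lemma coefS_kahler (hc : HasConstantCurvature g c) (hφ : φ ∈ IsManifold.maximalAtlas (𝓡 n) ∞ M)
    {y : Coord n} (hy : y ∈ φ.target) (p : Coord n) (h i j : Fin n) :
    coefS g (kahlerCoeffs A c lam) φ y p h i j =
      c * lam (energy g φ y p) / A * J1 g A c lam φ y p h j * p i := by
  have ht := energy_nonneg g hφ hy p
  obtain ⟨hl0, hD, hN⟩ := hpos _ ht
  rw [coefS_eq g (kahlerCoeffs_admissible hA hl hpos) hφ hy]
  simp only [H2, J1, Riem0_of_constantCurvature g hc hφ hy, kahler_c₂_add hA hD,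
    deriv0_kahler_c₁ ht, deriv0_kahler_d₁ hl ht]
  simp only [kahlerCoeffs, gLow_symm g φ y j h, gLow_symm g φ y i h]
  set t := energy g φ y p
  obtain ⟨D, hD'⟩ : ∃ D, D = A ^ 2 - 2 * c * t * lam t ^ 2 := ⟨_, rfl⟩
  -- The two denominators are kept as atoms while fractions are cleared and are expanded only for
  -- the final polynomial identity.
  obtain ⟨N, hN'⟩ : ∃ N, N = lam t + 2 * t * deriv0 lam t := ⟨_, rfl⟩
  rw [← hD'] at hD ⊢
  rw [← hN'] at hN ⊢
  field_simp
  rw [hD', hN']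
  ring

/-- Here too `d₁ = -c c₂` decides: the two terms `p_j H_{(1)}^{hi}` coincide and the Kronecker terms
cancel, leaving `d₁ p_j H_{(1)}^{hi}`. -/
lemma coefP_kahler (hc : HasConstantCurvature g c) (hφ : φ ∈ IsManifold.maximalAtlas (𝓡 n) ∞ M)
    {y : Coord n} (hy : y ∈ φ.target) (p : Coord n) (h i j : Fin n) :
    coefP g (kahlerCoeffs A c lam) φ y p j h i =
      -(c * lam (energy g φ y p) / A) * J2 g A c lam φ y p h i * p j := by
  have ht := energy_nonneg g hφ hy p
  have hC := kahlerCoeffs_admissible hA hl hpos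
  obtain ⟨hl0, hD, hN⟩ := hpos _ ht
  -- Lowering one index of `G_{(2)}`; with constant curvature, the contraction of `G_{(2)}` with
  -- `Riem0` in `P` consists of such terms, and in it the `d₂` parts cancel.
  have e1 : ∀ k, ∑ l, G2 g (kahlerCoeffs A c lam) φ y p i l * gLow g φ y k l =
      (kahlerCoeffs A c lam).c₂ (energy g φ y p) * kron i k +
        (kahlerCoeffs A c lam).d₂ (energy g φ y p) * g0 g φ y p i * p k := fun k => by
    have a1 := sum_gUp_mul_gLow g hφ hy i k
    have a2 := sum_gLow_mul_g0 g hφ hy p k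
    rw [← a1, ← a2]
    simp only [G2, Finset.mul_sum, ← Finset.sum_add_distrib]
    exact Finset.sum_congr rfl fun l _ => by rw [gLow_symm g φ y l k]; ring
  have e2 : ∑ k, H1 g (kahlerCoeffs A c lam) φ y p h k *
      ∑ l, G2 g (kahlerCoeffs A c lam) φ y p i l * Riem0 g φ y p l j k =
      c * (kahlerCoeffs A c lam).c₂ (energy g φ y p) *
        (p j * H1 g (kahlerCoeffs A c lam) φ y p h i -
          kron j i * ∑ k, H1 g (kahlerCoeffs A c lam) φ y p h k * p k) := by
    have b : ∀ k, ∑ l, G2 g (kahlerCoeffs A c lam) φ y p i l * Riem0 g φ y p l j k =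
        c * (kahlerCoeffs A c lam).c₂ (energy g φ y p) * (kron i k * p j - kron j i * p k) := by
      intro k
      have b1 : ∑ l, G2 g (kahlerCoeffs A c lam) φ y p i l * Riem0 g φ y p l j k =
          c * (p j * ∑ l, G2 g (kahlerCoeffs A c lam) φ y p i l * gLow g φ y k l -
            p k * ∑ l, G2 g (kahlerCoeffs A c lam) φ y p i l * gLow g φ y j l) := by
        simp only [Riem0_of_constantCurvature g hc hφ hy, Finset.mul_sum,
          ← Finset.sum_sub_distrib]
        exact Finset.sum_congr rfl fun l _ => by ring
      have e : (kron i j : ℝ) = kron j i := by simp [kron, eq_comm]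
      rw [b1, e1, e1, e]
      ring
    have e : H1 g (kahlerCoeffs A c lam) φ y p h i =
      ∑ k, H1 g (kahlerCoeffs A c lam) φ y p h k * kron i k := by simp [kron]
    rw [e]
    simp only [b, Finset.mul_sum, ← Finset.sum_sub_distrib]
    exact Finset.sum_congr rfl fun k _ => by ring
  rw [coefP_eq g hC hφ hy]
  simp only [e2, sum_H1_mul_momentum g hC hφ hy]
  simp only [H1, J2, kahler_c₁_add hA, deriv0_kahler_c₁ ht,
    deriv0_kahler_d₁ hl ht]
  simp only [kahlerCoeffs]
  set t := energy g φ y p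
  obtain ⟨D, hD'⟩ : ∃ D, D = A ^ 2 - 2 * c * t * lam t ^ 2 := ⟨_, rfl⟩
  rw [← hD'] at hD ⊢
  field_simp
  ring

/-- The Kronecker terms have coefficient `c₂'/(2c₂) = λ'/λ`. In the coefficient of `g^{ij} p_h` the
numerator of `d₂ - λλ'/A` has a factor `λ + 2tλ'`, which reduces the square in `c₂ + 2t d₂`. -/
lemma coefQ_kahler (hφ : φ ∈ IsManifold.maximalAtlas (𝓡 n) ∞ M)
    {y : Coord n} (hy : y ∈ φ.target) (p : Coord n) (h i j : Fin n) :
    let t := energy g φ y p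
    let l := lam t
    let l' := deriv0 lam t
    let l'' := deriv0 (deriv0 lam) t
    coefQ g (kahlerCoeffs A c lam) φ y p h i j =
      (c * l ^ 3 + A ^ 2 * l') / (A * l * (l + 2 * t * l')) *
          J2 g A c lam φ y p i j * p h
        + l' / l * (kron i h * g0 g φ y p j + kron j h * g0 g φ y p i)
        + (l * l'' - 3 * l' ^ 2) / (l * (l + 2 * t * l')) *
          g0 g φ y p i * g0 g φ y p j * p h := by
  have ht := energy_nonneg g hφ hy p
  obtain ⟨hl0, hD, hN⟩ := hpos _ ht
  rw [coefQ_eq g (kahlerCoeffs_admissible hA hl hpos) hφ hy]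
  simp only [J2, kahler_c₂_add hA hD, deriv0_kahler_c₂ hl ht, deriv0_kahler_d₂ hA hl hpos ht]
  simp only [kahlerCoeffs]
  set t := energy g φ y p
  -- With `λ, λ', λ''` and the raised momenta as independent variables, the claim is an identity of
  -- rational functions.
  generalize deriv0 (deriv0 lam) t = l2
  generalize deriv0 lam t = l1 at *
  generalize lam t = l0 at *
  generalize g0 g φ y p i = a
  generalize g0 g φ y p j = b
  obtain ⟨D, hD'⟩ : ∃ D, D = A ^ 2 - 2 * c * t * l0 ^ 2 := ⟨_, rfl⟩
  obtain ⟨N, hN'⟩ : ∃ N, N = l0 + 2 * t * l1 := ⟨_, rfl⟩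
  rw [← hD'] at hD ⊢
  rw [← hN'] at hN ⊢
  field_simp
  rw [hD', hN']
  ring

end Kahler

end CotangentLift

theorem theorem8 {n : ℕ} {M : Type*} [TopologicalSpace M] [ChartedSpace (Coord n) M]
    [IsManifold (𝓡 n) ∞ M] (g : RMetric n M) :
    -- the general form of the Levi-Civita connection, without any condition on the curvature
    (∀ C : DiagCoeffs, C.Admissible →
      IsMTensorField n M 2 1 (fun φ y p up low => coefQ g C φ y p (low 0) (up 0) (up 1)) ∧
      IsMTensorField n M 2 1 (fun φ y p up low => coefP g C φ y p (low 0) (up 0) (up 1)) ∧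
      IsMTensorField n M 0 3 (fun φ y p _ low => coefS g C φ y p (low 0) (low 1) (low 2)) ∧
      ∀ cov : TStarConnection n M, IsLeviCivita (naturalMetric g C) cov →
        ∀ φ ∈ IsManifold.maximalAtlas (𝓡 n) ∞ M,
          HasAdaptedForm g cov φ (coefQ g C φ) (coefP g C φ) (coefS g C φ)) ∧
    -- the Kähler coefficients are admissible, so that the first part applies to them; over a base
    -- of constant curvature `c` the coefficients of the connection are explicit
    (∀ (A c : ℝ) (lam : ℝ → ℝ), 0 < A → ContDiffOn ℝ ∞ lam (Set.Ici 0) →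
      (∀ t, 0 ≤ t → 0 < lam t ∧ 0 < A ^ 2 - 2 * c * t * lam t ^ 2 ∧
        0 < lam t + 2 * t * deriv0 lam t) →
      (kahlerCoeffs A c lam).Admissible ∧
      (HasConstantCurvature g c →
        ∀ φ ∈ IsManifold.maximalAtlas (𝓡 n) ∞ M, ∀ y ∈ φ.target,
        ∀ (p : Coord n) (h i j : Fin n),
          let t := energy g φ y p
          let l := lam t
          let l' := deriv0 lam t
          let l'' := deriv0 (deriv0 lam) t
          coefQ g (kahlerCoeffs A c lam) φ y p h i j =
            (c * l ^ 3 + A ^ 2 * l') / (A * l * (l + 2 * t * l')) *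
                J2 g A c lam φ y p i j * p h
              + l' / l * (kron i h * g0 g φ y p j + kron j h * g0 g φ y p i)
              + (l * l'' - 3 * l' ^ 2) / (l * (l + 2 * t * l')) *
                g0 g φ y p i * g0 g φ y p j * p h ∧
          coefP g (kahlerCoeffs A c lam) φ y p j h i =
            -(c * l / A) * J2 g A c lam φ y p h i * p j ∧
          coefS g (kahlerCoeffs A c lam) φ y p h i j =
            c * l / A * J1 g A c lam φ y p h j * p i)) := by
  refine ⟨fun C hC => ⟨isMTensorField_coefQ g hC, isMTensorField_coefP g hC,
    isMTensorField_coefS g hC, fun cov hcov φ hφ => hcov.hasAdaptedForm g hC hφ⟩,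
    fun A c lam hA hl hpos => ⟨kahlerCoeffs_admissible hA hl hpos,
      fun hc φ hφ y hy p h i j => ⟨coefQ_kahler hA hl hpos g hφ hy p h i j,
        coefP_kahler hA hl hpos g hc hφ hy p h i j, coefS_kahler hA hl hpos g hc hφ hy p h i j⟩⟩⟩
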